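/- Let $n\ge 2$ and let $(M,c)$ be a smooth conformal manifold (Hausdorff, second countable, without boundary) of dimension $d=n+1$ and of any signature. Write $\mathcal E[w]$ for the (complex) bundle of conformal densities of weight $w$: a section is a function $f_g$ for each $g\in c$, with $f_{e^{2\Upsilon}g}=e^{w\Upsilon}f_g$. Let $\mathcal T$ be the standard tractor bundle with the tractor metric $h$ and the normal tractor connection $\nabla$: each $g\in c$ splits $\mathcal T\cong\mathcal E[1]\oplus T^*M[1]\oplus\mathcal E[-1]$, with $h(T,T)=\boldsymbol g^{-1}(\mu,\mu)+2\sigma\rho$ and $$\nabla_a(\sigma,\mu_b,\rho)=(\nabla_a\sigma-\mu_a,\ \nabla_a\mu_b+\boldsymbol g_{ab}\rho+P_{ab}\sigma,\ \nabla_a\rho-P_{ac}\mu^c),$$ where $\boldsymbol g$ is the conformal metric and $P_{ab}$ the Schouten tensor; under $\hat g=e^{2\Upsilon}g$ the splitting changes by $(\sigma,\mu_b,\rho)\mapsto(\sigma,\mu_b+\sigma\Upsilon_b,\rho-\boldsymbol g^{cd}\Upsilon_c\mu_d-\frac12\sigma\boldsymbol g^{cd}\Upsilon_c\Upsilon_d)$,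 $\Upsilon_a=\nabla_a\Upsilon$. Let $\mathcal E^\Phi$ be any tractor bundle, that is, a tensor power of $\mathcal T$ or a tensor part of one (the image of a projection built from permutations of the tensor factors and contractions and insertions of $h$), and $\mathcal E^\Phi[w]=\mathcal E^\Phi\otimes\mathcal E[w]$. The Thomas $D$-operator $D_A:\Gamma\mathcal E^\Phi[w]\to\Gamma(\mathcal T\otimes\mathcal E^\Phi[w-1])$ is given in a scale $g$ by $$D_AV=\big((d+2w-2)wV,\ (d+2w-2)\nabla_aV,\ -(\Delta+wJ)V\big),\qquad J=P_a{}^a,\quad \Delta=\boldsymbol g^{ab}\nabla_a\nabla_b .$$ Let $\sigma$ be a real section of $\mathcal E[1]$ such that the scale tractor $I_A=\frac1d D_A\sigma$ satisfies $I^2=h(I,I)\ne0$ everywhere on $M$, and let $\Sigma$ be the zero locus of $\sigma$. Put $I\cdot D=I^AD_A:\Gamma\mathcal E^\Phi[w]\to\Gamma\mathcal E^\Phi[w-1]$. Then for every integer $k\ge1$ $$P_k:=\Big(-\frac1{I^2}\,I\cdot D\Big)^k$$ is a well-defined linear differential operator $\Gamma\mathcal E^\Phi[\frac{k-n}2]\to\Gamma\mathcal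 E^\Phi[\frac{-k-n}2]$ (independent of the choice of $g\in c$), and it acts tangentially along $\Sigma$: there is a linear operator $\widetilde P:\Gamma\mathcal E^\Phi[\frac{k-n}2-1]\to\Gamma\mathcal E^\Phi[\frac{-k-n}2-1]$ with $P_k\circ\sigma=\sigma\circ\widetilde P$. Consequently there is exactly one linear operator $$P_k^\Sigma:\Gamma\big(\mathcal E^\Phi[\tfrac{k-n}2]|_\Sigma\big)\to\Gamma\big(\mathcal E^\Phi[\tfrac{-k-n}2]|_\Sigma\big)$$ with $P_k^\Sigma(f|_\Sigma)=(P_kf)|_\Sigma$ for all $f\in\Gamma\mathcal E^\Phi[\frac{k-n}2]$, and it is a differential operator. -/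

import Mathlib

open scoped Manifold ContDiff Topology

noncomputable section

namespace Tractor

/-! ## Tensor calculus over a commutative `ℝ`-algebra `A`

Everything in this part is used for `A = C^∞(M)` only: vector fields are the derivations of
`C^∞(M)`, tensor fields are `C^∞(M)`-multilinear maps. -/

section Calculus

variable {A : Type*} [CommRing A] [Algebra ℝ A]

/-- Vector fields: derivations of the algebra of functions. -/
abbrev VectorField (A : Type*) [CommRing A] [Algebra ℝ A] : Type _ := Derivation ℝ A A

/-- One-forms: `A`-linear functionals on vector fields. -/
abbrev OneForm (A : Type*) [CommRing A] [Algebra ℝ A] : Type _ := VectorField A →ₗ[A] A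

/-- The differential of a function. -/
def differential (f : A) : OneForm A where
  toFun X := X f
  map_add' _ _ := rfl
  map_smul' _ _ := rfl

theorem lie_smul_right (f : A) (X Y : VectorField A) : ⁅X, f • Y⁆ = X f • Y + f • ⁅X, Y⁆ := by
  ext a
  simp only [Derivation.commutator_apply, Derivation.smul_apply, Derivation.add_apply, smul_eq_mul,
    Derivation.leibniz]
  ring

theorem lie_smul_left (f : A) (X Y : VectorField A) : ⁅f • X, Y⁆ = f • ⁅X, Y⁆ - Y f • X := by
  ext a
  simp only [Derivation.commutator_apply, Derivation.smul_apply, Derivation.sub_apply, smul_eq_mul,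
    Derivation.leibniz]
  ring

/-- A pseudo-Riemannian metric (of any signature): a symmetric `A`-bilinear form on vector fields
which identifies vector fields with one-forms. -/
structure PseudoRiemMetric (A : Type*) [CommRing A] [Algebra ℝ A] where
  form : VectorField A →ₗ[A] VectorField A →ₗ[A] A
  symm : ∀ X Y, form X Y = form Y X
  perfect : Function.Bijective form

namespace PseudoRiemMetric

/-- Lowering an index. -/
def flat (g : PseudoRiemMetric A) : VectorField A ≃ₗ[A] OneForm A :=
  LinearEquiv.ofBijective g.form g.perfect

/-- Raising an index. -/
def sharp (g : PseudoRiemMetric A) : OneForm A ≃ₗ[A] VectorField A := g.flat.symm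

/-- The inverse metric on one-forms. -/
def inv (g : PseudoRiemMetric A) : OneForm A →ₗ[A] OneForm A →ₗ[A] A :=
  g.form.compl₁₂ g.sharp.toLinearMap g.sharp.toLinearMap

end PseudoRiemMetric

/-- A linear connection on the module `S` (of sections of a vector bundle). -/
structure Connection (S : Type*) [AddCommGroup S] [Module A S] where
  cov : VectorField A → S → S
  add_left : ∀ X Y s, cov (X + Y) s = cov X s + cov Y s
  smul_left : ∀ (f : A) X s, cov (f • X) s = f • cov X s
  add_right : ∀ X s t, cov X (s + t) = cov X s + cov X t
  leibniz : ∀ X (f : A) s, cov X (f • s) = X f • s + f • cov X s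

/-- The connection `X f` on functions; also the connection that a metric `g` induces on
densities, when these are trivialised by `g`. -/
def trivialConnection : Connection (A := A) A where
  cov X f := X f
  add_left _ _ _ := rfl
  smul_left _ _ _ := rfl
  add_right X s t := map_add X s t
  leibniz X f s := by simp [Derivation.leibniz, mul_comm, add_comm]

/-- The metric trace `b^{AB} B_{AB}`: for a nondegenerate form `b` on `V`, this is the unique
`A`-linear map that sends the bilinear map `(x, y) ↦ b(v, x) b(v', y) s` to `b(v, v') s`. -/
def formTrace {V S : Type*} [AddCommGroup V] [Module A V] [AddCommGroup S] [Module A S]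
    (b : V →ₗ[A] V →ₗ[A] A) : (V →ₗ[A] V →ₗ[A] S) →ₗ[A] S :=
  Classical.epsilon fun t : (V →ₗ[A] V →ₗ[A] S) →ₗ[A] S =>
    ∀ (v v' : V) (s : S) (B : V →ₗ[A] V →ₗ[A] S),
      (∀ x y, B x y = (b v x * b v' y) • s) → t B = b v v' • s

namespace PseudoRiemMetric

variable (g : PseudoRiemMetric A)

/-- The right-hand side of the Koszul formula for `2 g(∇_X Y, Z)`, as a one-form in `Z`. -/
def koszul (X Y : VectorField A) : OneForm A where
  toFun Z := X (g.form Y Z) + Y (g.form X Z) - Z (g.form X Y)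
    + g.form ⁅X, Y⁆ Z - g.form ⁅X, Z⁆ Y - g.form ⁅Y, Z⁆ X
  map_add' Z W := by
    simp only [map_add, lie_add, LinearMap.add_apply, Derivation.add_apply]
    ring
  map_smul' f Z := by
    simp only [map_smul, map_add, lie_smul_right, LinearMap.add_apply, LinearMap.smul_apply,
      Derivation.smul_apply, smul_eq_mul, Derivation.leibniz, RingHom.id_apply, g.symm Z Y,
      g.symm Z X]
    ring

/-- The Levi-Civita connection: `2 g(∇_X Y, Z)` is given by the Koszul formula. -/
def leviCivita : Connection (A := A) (VectorField A) where
  cov X Y := algebraMap ℝ A (1 / 2) • g.sharp (g.koszul X Y)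
  add_left X Y s := by
    rw [← smul_add, ← map_add]
    congr 2
    ext Z
    simp only [koszul, LinearMap.coe_mk, AddHom.coe_mk, map_add, add_lie, LinearMap.add_apply,
      Derivation.add_apply]
    ring
  smul_left f X s := by
    have h : g.koszul (f • X) s = f • g.koszul X s := by
      refine LinearMap.ext fun Z => ?_
      simp only [koszul, LinearMap.coe_mk, AddHom.coe_mk, map_smul, map_sub, lie_smul_left,
        LinearMap.sub_apply, LinearMap.smul_apply, Derivation.smul_apply, smul_eq_mul,
        Derivation.leibniz, g.symm X s, g.symm X Z]
      ring
    rw [h, map_smul, smul_comm]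
  add_right X s t := by
    rw [← smul_add, ← map_add]
    congr 2
    ext Z
    simp only [koszul, LinearMap.coe_mk, AddHom.coe_mk, map_add, add_lie, lie_add,
      LinearMap.add_apply, Derivation.add_apply]
    ring
  leibniz X f s := by
    have h : g.koszul X (f • s) = (algebraMap ℝ A 2 * X f) • g.flat s + f • g.koszul X s := by
      have hf : ∀ Z, g.flat s Z = g.form s Z := fun _ => rfl
      ext Z
      simp only [koszul, LinearMap.coe_mk, AddHom.coe_mk, map_smul, map_sub, lie_smul_left,
        lie_smul_right, map_add, LinearMap.add_apply, LinearMap.sub_apply, LinearMap.smul_apply,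
        Derivation.smul_apply, smul_eq_mul, Derivation.leibniz, hf, map_ofNat, g.symm s X]
      ring
    rw [h, map_add, map_smul, map_smul, smul_add, smul_smul, smul_comm f, ← mul_assoc, ← map_mul]
    simp [sharp]

/-- The second covariant derivative `(X, Y) ↦ ∇_X ∇_Y s - ∇_{∇_X Y} s` of a section `s`, for the
connection `D` coupled to the Levi-Civita connection. -/
def hessian {S : Type*} [AddCommGroup S] [Module A S] (D : Connection (A := A) S) (s : S) :
    VectorField A →ₗ[A] VectorField A →ₗ[A] S :=
  LinearMap.mk₂ A (fun X Y => D.cov X (D.cov Y s) - D.cov (g.leviCivita.cov X Y) s)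
    (fun X X' Y => by rw [D.add_left, g.leviCivita.add_left, D.add_left]; abel)
    (fun f X Y => by rw [D.smul_left, g.leviCivita.smul_left, D.smul_left, smul_sub])
    (fun X Y Y' => by
      rw [D.add_left, g.leviCivita.add_right, D.add_left, D.add_right]; abel)
    (fun f X Y => by
      rw [D.smul_left, g.leviCivita.leibniz, D.add_left, D.smul_left, D.smul_left, D.leibniz,
        smul_sub]
      abel)

/-- The Laplacian `Δ = g^{ab} ∇_a ∇_b`. -/
def laplacian {S : Type*} [AddCommGroup S] [Module A S] (D : Connection (A := A) S) (s : S) : S :=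
  formTrace g.form (g.hessian D s)

/-- The Riemann curvature `R(X, Y) Z = ∇_X ∇_Y Z - ∇_Y ∇_X Z - ∇_{[X, Y]} Z`. -/
def curvature (X Y Z : VectorField A) : VectorField A :=
  g.leviCivita.cov X (g.leviCivita.cov Y Z) - g.leviCivita.cov Y (g.leviCivita.cov X Z)
    - g.leviCivita.cov ⁅X, Y⁆ Z

end PseudoRiemMetric

theorem Connection.sub_left {S : Type*} [AddCommGroup S] [Module A S] (D : Connection (A := A) S)
    (X Y : VectorField A) (s : S) : D.cov (X - Y) s = D.cov X s - D.cov Y s := by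
  have h := D.add_left (X - Y) Y s
  rw [sub_add_cancel] at h
  rw [h, add_sub_cancel_right]

namespace PseudoRiemMetric

variable (g : PseudoRiemMetric A)

/-- The bilinear form `(X, W) ↦ g(R(X, Y) Z, W)`. -/
def curvatureForm (Y Z : VectorField A) : VectorField A →ₗ[A] VectorField A →ₗ[A] A where
  toFun X := g.form (g.curvature X Y Z)
  map_add' X X' := by
    rw [← map_add]
    congr 1
    simp only [curvature, Connection.add_left, Connection.add_right, add_lie]
    abel
  map_smul' f X := by
    rw [RingHom.id_apply, ← map_smul]
    congr 1
    simp only [curvature, Connection.smul_left, Connection.leibniz, Connection.sub_left,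
      lie_smul_left, smul_sub]
    abel

/-- The Ricci tensor: `Ric(Y, Z)` is the trace of `X ↦ R(X, Y) Z`. -/
def ricci : VectorField A →ₗ[A] VectorField A →ₗ[A] A :=
  LinearMap.mk₂ A (fun Y Z => formTrace g.form (g.curvatureForm Y Z))
    (fun Y Y' Z => by
      rw [← map_add]
      congr 1
      ext X W
      simp only [curvatureForm, curvature, LinearMap.coe_mk, AddHom.coe_mk, LinearMap.add_apply,
        Connection.add_left, Connection.add_right, lie_add, map_sub, map_add, LinearMap.sub_apply]
      ring)
    (fun f Y Z => by
      rw [← map_smul]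
      congr 1
      ext X W
      simp only [curvatureForm, curvature, LinearMap.coe_mk, AddHom.coe_mk, LinearMap.add_apply,
        LinearMap.smul_apply, Connection.smul_left, Connection.add_left, Connection.leibniz,
        lie_smul_right, map_sub, map_add, map_smul, LinearMap.sub_apply, smul_eq_mul]
      ring)
    (fun Y Z Z' => by
      rw [← map_add]
      congr 1
      ext X W
      simp only [curvatureForm, curvature, LinearMap.coe_mk, AddHom.coe_mk, LinearMap.add_apply,
        Connection.add_right, map_sub, map_add, LinearMap.sub_apply]
      ring)
    (fun f Y Z => by
      rw [← map_smul]
      congr 1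
      ext X W
      simp only [curvatureForm, curvature, LinearMap.coe_mk, AddHom.coe_mk, LinearMap.add_apply,
        LinearMap.smul_apply, Connection.add_right, Connection.leibniz,
        Derivation.commutator_apply, map_sub, map_add, map_smul, LinearMap.sub_apply, smul_eq_mul]
      ring)

/-- The scalar curvature. -/
def scalarCurvature : A := formTrace g.form g.ricci

/-- The Schouten tensor in dimension `d`, determined by `Ric = (d - 2) P + (tr P) g`. -/
def schouten (d : ℕ) : VectorField A →ₗ[A] VectorField A →ₗ[A] A :=
  algebraMap ℝ A (1 / ((d : ℝ) - 2)) •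
    (g.ricci - (algebraMap ℝ A (1 / (2 * ((d : ℝ) - 1))) * g.scalarCurvature) • g.form)

/-- The trace `J` of the Schouten tensor. -/
def schoutenTrace (d : ℕ) : A := formTrace g.form (g.schouten d)

end PseudoRiemMetric

/-! ### The standard tractor bundle in a scale -/

/-- Sections of the standard tractor bundle in the splitting
`E[1] ⊕ T^*M[1] ⊕ E[-1]` given by a metric of the conformal class, all densities being trivialised
by the same metric. -/
abbrev TractorField (A : Type*) [CommRing A] [Algebra ℝ A] : Type _ := A × OneForm A × A

namespace PseudoRiemMetric

variable (g : PseudoRiemMetric A)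

/-- The tractor metric `g⁻¹(μ, μ') + σ ρ' + ρ σ'`. -/
def tractorMetric : TractorField A →ₗ[A] TractorField A →ₗ[A] A :=
  LinearMap.mk₂ A (fun T T' => g.inv T.2.1 T'.2.1 + T.1 * T'.2.2 + T.2.2 * T'.1)
    (fun T T' U => by simp; ring)
    (fun f T U => by simp; ring)
    (fun T U U' => by simp; ring)
    (fun f T U => by simp; ring)

/-- The Levi-Civita connection on one-forms. -/
def covOneForm (X : VectorField A) (μ : OneForm A) : OneForm A where
  toFun Y := X (μ Y) - μ (g.leviCivita.cov X Y)
  map_add' Y Z := by simp only [map_add, Connection.add_right]; ring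
  map_smul' f Y := by
    simp only [map_add, map_smul, Connection.leibniz, smul_eq_mul, Derivation.leibniz,
      RingHom.id_apply]
    ring

/-- The normal tractor connection
`∇_a (σ, μ_b, ρ) = (∇_a σ - μ_a, ∇_a μ_b + g_{ab} ρ + P_{ab} σ, ∇_a ρ - P_{ac} μ^c)`. -/
def tractorConnection (d : ℕ) : Connection (A := A) (TractorField A) where
  cov X T :=
    (X T.1 - T.2.1 X,
      g.covOneForm X T.2.1 + T.2.2 • g.form X + T.1 • g.schouten d X,
      X T.2.2 - g.schouten d X (g.sharp T.2.1))
  add_left X Y T := by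
    refine Prod.ext ?_ (Prod.ext (LinearMap.ext fun Z => ?_) ?_)
    · simp; ring
    · simp [covOneForm, Connection.add_left]; ring
    · simp; ring
  smul_left f X T := by
    refine Prod.ext ?_ (Prod.ext (LinearMap.ext fun Z => ?_) ?_)
    · simp; ring
    · simp [covOneForm, Connection.smul_left]; ring
    · simp; ring
  add_right X T U := by
    refine Prod.ext ?_ (Prod.ext (LinearMap.ext fun Z => ?_) ?_)
    · simp; ring
    · simp [covOneForm]; ring
    · simp; ring
  leibniz X f T := by
    refine Prod.ext ?_ (Prod.ext (LinearMap.ext fun Z => ?_) ?_)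
    · simp; ring
    · simp [covOneForm]; ring
    · simp; ring

end PseudoRiemMetric

/-! ### Tractor tensors -/

/-- Real tractor tensors of rank `r` in a scale: sections of the `r`-th tensor power of the standard
tractor bundle, which is identified with its dual by the tractor metric. -/
abbrev TractorTensor (A : Type*) [CommRing A] [Algebra ℝ A] (r : ℕ) : Type _ :=
  MultilinearMap A (fun _ : Fin r => TractorField A) A

namespace PseudoRiemMetric

variable (g : PseudoRiemMetric A)

/-- The covariant derivative of a tractor tensor:
`(∇_X F)(T₁, …, T_r) = X (F(T₁, …, T_r)) - ∑ i, F(T₁, …, ∇_X T_i, …, T_r)`. -/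
def covTensor (d : ℕ) {r : ℕ} (X : VectorField A) (F : TractorTensor A r) : TractorTensor A r :=
  MultilinearMap.mk' (fun T => X (F T) -
      ∑ i, F (Function.update T i ((g.tractorConnection d).cov X (T i))))
    (fun T j a b => by
      have key : ∀ i, F (Function.update (Function.update T j (a + b)) i
            ((g.tractorConnection d).cov X (Function.update T j (a + b) i)))
          = F (Function.update (Function.update T j a) i
            ((g.tractorConnection d).cov X (Function.update T j a i)))
          + F (Function.update (Function.update T j b) i
            ((g.tractorConnection d).cov X (Function.update T j b i))) := by
        intro i
        by_cases h : i = j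
        · subst h
          simp [Connection.add_right]
        · simp only [Function.update_of_ne h]
          rw [Function.update_comm (Ne.symm h), Function.update_comm (Ne.symm h),
            Function.update_comm (Ne.symm h), F.map_update_add]
      simp only [key, Finset.sum_add_distrib, F.map_update_add, map_add]
      ring)
    (fun T j f a => by
      have key : ∀ i, F (Function.update (Function.update T j (f • a)) i
            ((g.tractorConnection d).cov X (Function.update T j (f • a) i)))
          = f * F (Function.update (Function.update T j a) i
            ((g.tractorConnection d).cov X (Function.update T j a i)))
          + if i = j then X f * F (Function.update T j a) else 0 := by
        intro i
        by_cases h : i = j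
        · subst h
          simp only [Function.update_self, Function.update_idem, Connection.leibniz,
            F.map_update_add, F.map_update_smul, smul_eq_mul, if_true]
          ring
        · simp only [Function.update_of_ne h, if_neg h, add_zero]
          rw [Function.update_comm (Ne.symm h), Function.update_comm (Ne.symm h),
            F.map_update_smul, smul_eq_mul]
      simp only [key, Finset.sum_add_distrib, F.map_update_smul, smul_eq_mul, Derivation.leibniz,
        ← Finset.mul_sum, Finset.sum_ite_eq', Finset.mem_univ, if_true]
      ring)

/-- The tractor connection on tractor tensors. -/
def tensorConnection (d r : ℕ) : Connection (A := A) (TractorTensor A r) where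
  cov := g.covTensor d
  add_left X Y F := by
    ext T
    simp only [covTensor, MultilinearMap.mk'_apply, _root_.add_apply, Derivation.add_apply,
      Connection.add_left, F.map_update_add, Finset.sum_add_distrib]
    ring
  smul_left f X F := by
    ext T
    simp only [covTensor, MultilinearMap.mk'_apply, _root_.smul_apply,
      Derivation.smul_apply, Connection.smul_left, F.map_update_smul, smul_eq_mul,
      ← Finset.mul_sum]
    ring
  add_right X F G := by
    ext T
    simp only [covTensor, MultilinearMap.mk'_apply, _root_.add_apply, map_add,
      Finset.sum_add_distrib]
    ring
  leibniz X f F := by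
    ext T
    simp only [covTensor, MultilinearMap.mk'_apply, _root_.add_apply,
      _root_.smul_apply, smul_eq_mul, Derivation.leibniz, ← Finset.mul_sum]
    ring

/-! ### The Thomas D-operator and the degenerate Laplacian -/

/-- The Thomas D-operator on sections of weight `w`, for the connection `D`:
`((d + 2w - 2) w V, (d + 2w - 2) ∇_a V, -(Δ + J w) V)`. -/
def thomasD (d : ℕ) {S : Type*} [AddCommGroup S] [Module A S] (D : Connection (A := A) S) (w : ℝ)
    (V : S) : S × (VectorField A →ₗ[A] S) × S :=
  (algebraMap ℝ A (((d : ℝ) + 2 * w - 2) * w) • V,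
    algebraMap ℝ A ((d : ℝ) + 2 * w - 2) •
      { toFun := fun X => D.cov X V
        map_add' := fun X Y => D.add_left X Y V
        map_smul' := fun f X => D.smul_left f X V },
    -(g.laplacian D V + (algebraMap ℝ A w * g.schoutenTrace d) • V))

/-- The contraction of a standard tractor `(σ, μ, ρ)` with a tractor with values in `S`, by the
tractor metric. -/
def contract {S : Type*} [AddCommGroup S] [Module A S] (T : TractorField A)
    (U : S × (VectorField A →ₗ[A] S) × S) : S :=
  U.2.1 (g.sharp T.2.1) + T.1 • U.2.2 + T.2.2 • U.1

/-- The scale tractor `I = (1/d) D σ` of a function `σ` that represents a density of weight `1`. -/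
def scaleTractor (d : ℕ) (σ : A) : TractorField A :=
  algebraMap ℝ A (1 / (d : ℝ)) • g.thomasD d trivialConnection 1 σ

/-- The squared length `I²` of the scale tractor. -/
def scaleSq (d : ℕ) (σ : A) : A :=
  g.tractorMetric (g.scaleTractor d σ) (g.scaleTractor d σ)

/-- The degenerate Laplacian `I·D` on tractor tensors of weight `w`. -/
def degenerateLaplacian (d : ℕ) (σ : A) {r : ℕ} (w : ℝ) (F : TractorTensor A r) :
    TractorTensor A r :=
  g.contract (g.scaleTractor d σ) (g.thomasD d (g.tensorConnection d r) w F)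

/-- The operator `-(1/I²) I·D` on tractor tensors of weight `w`. -/
def yOp (d : ℕ) (σ : A) {r : ℕ} (w : ℝ) (F : TractorTensor A r) : TractorTensor A r :=
  -(Ring.inverse (g.scaleSq d σ) • g.degenerateLaplacian d σ w F)

/-- The power `(-(1/I²) I·D)^k`, beginning at weight `w`; each factor lowers the weight by `1`. -/
def yPow (d : ℕ) (σ : A) {r : ℕ} : ℕ → ℝ → TractorTensor A r → TractorTensor A r
  | 0, _, F => F
  | k + 1, w, F => yPow d σ k (w - 1) (g.yOp d σ w F)

/-- The bilinear form that `F` gives in the slots `i` and `j`, the other arguments being those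
of `T`. -/
def slotForm {r : ℕ} (F : TractorTensor A r) (T : Fin r → TractorField A) (i j : Fin r)
    (hij : i ≠ j) : TractorField A →ₗ[A] TractorField A →ₗ[A] A :=
  LinearMap.mk₂ A (fun a b => F (Function.update (Function.update T i a) j b))
    (fun a a' b => by
      rw [Function.update_comm hij, Function.update_comm hij, Function.update_comm hij,
        F.map_update_add])
    (fun f a b => by
      rw [Function.update_comm hij, Function.update_comm hij, F.map_update_smul])
    (fun a b b' => by rw [F.map_update_add])
    (fun f a b => by rw [F.map_update_smul])

end PseudoRiemMetric

end Calculus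

/-! ## Conformal manifolds -/

section Manifold

variable (d : ℕ) (M : Type*) [TopologicalSpace M] [ChartedSpace (EuclideanSpace ℝ (Fin d)) M]

/-- Smooth real functions on `M`. -/
abbrev Fn : Type _ := C^∞⟮𝓡 d, M; 𝓘(ℝ, ℝ), ℝ⟯

/-- Smooth complex functions on `M`. -/
abbrev CFn : Type _ := C^∞⟮𝓡 d, M; 𝓘(ℝ, ℂ), ℂ⟯

variable {d M}

/-- The function `exp (w Υ)`. -/
def expFn (w : ℝ) (Υ : Fn d M) : Fn d M :=
  ⟨fun x => Real.exp (w * Υ x),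
    Real.contDiff_exp.contMDiff.comp (contMDiff_const.mul Υ.contMDiff)⟩

/-- `g' = exp (2 Υ) g`. -/
def IsRescaling (g : PseudoRiemMetric (Fn d M)) (Υ : Fn d M) (g' : PseudoRiemMetric (Fn d M)) : Prop :=
  ∀ X Y, g'.form X Y = expFn 2 Υ * g.form X Y

variable (d M) in
/-- A conformal structure: an equivalence class of metrics, where `g` and `exp (2 Υ) g` are
equivalent. -/
structure ConformalStructure where
  metrics : Set (PseudoRiemMetric (Fn d M))
  nonempty : metrics.Nonempty
  mem_iff : ∀ g ∈ metrics, ∀ g', g' ∈ metrics ↔ ∃ Υ, IsRescaling g Υ g'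

/-- The change of the splitting of the standard tractor bundle from `g` to `exp (2 Υ) g`,
`(σ, μ, ρ) ↦ (σ, μ + σ dΥ, ρ - g⁻¹(dΥ, μ) - (1/2) σ g⁻¹(dΥ, dΥ))`, with the factors that come from
trivialising `E[1]`, `T^*M[1]`, `E[-1]` by the new metric. -/
def changeSplitting (g : PseudoRiemMetric (Fn d M)) (Υ : Fn d M) (T : TractorField (Fn d M)) :
    TractorField (Fn d M) :=
  (expFn 1 Υ * T.1,
    expFn 1 Υ • (T.2.1 + T.1 • differential Υ),
    expFn (-1) Υ * (T.2.2 - g.inv (differential Υ) T.2.1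
      - algebraMap ℝ (Fn d M) (1 / 2) * T.1 * g.inv (differential Υ) (differential Υ)))

/-- A real density of weight `w`: a function for each metric of the class, with
`f̂ = exp (w Υ) f` under `ĝ = exp (2 Υ) g`. -/
structure RealDensity (c : ConformalStructure d M) (w : ℝ) where
  val : c.metrics → Fn d M
  equivariant : ∀ (g g' : c.metrics) (Υ : Fn d M), IsRescaling g.1 Υ g'.1 →
    val g' = expFn w Υ * val g

/-- The zero locus of a density. -/
def RealDensity.zeroLocus {c : ConformalStructure d M} {w : ℝ} (σ : RealDensity c w) : Set M :=
  {x | ∀ g, σ.val g x = 0}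

/-- The natural endomorphisms of the `r`-th tensor power of the standard tractor bundle (given in
each scale): those generated, by real linear combinations and compositions, by the permutations of
the slots and by the maps that contract two slots with the tractor metric and then insert the
tractor metric there. -/
inductive IsNaturalEnd (c : ConformalStructure d M) (r : ℕ) :
    (c.metrics → Module.End (Fn d M) (TractorTensor (Fn d M) r)) → Prop
  | perm (e : Equiv.Perm (Fin r)) (K) (h : ∀ g F T, K g F T = F (T ∘ e)) : IsNaturalEnd c r K
  | contraction (i j : Fin r) (hij : i ≠ j) (K)
      (h : ∀ g F T, K g F T = g.1.tractorMetric (T i) (T j) *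
        formTrace g.1.tractorMetric (PseudoRiemMetric.slotForm F T i j hij)) : IsNaturalEnd c r K
  | add (K L) : IsNaturalEnd c r K → IsNaturalEnd c r L → IsNaturalEnd c r (K + L)
  | comp (K L) : IsNaturalEnd c r K → IsNaturalEnd c r L →
      IsNaturalEnd c r (fun g => (K g).comp (L g))
  | smul (t : ℝ) (K) : IsNaturalEnd c r K →
      IsNaturalEnd c r (fun g => algebraMap ℝ (Fn d M) t • K g)

/-- A tractor bundle `E^Φ`: a tensor power of the standard tractor bundle or a tensor part of one,
that is, the image of a natural projection. -/
structure TractorBundle (c : ConformalStructure d M) where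
  rank : ℕ
  proj : c.metrics → Module.End (Fn d M) (TractorTensor (Fn d M) rank)
  natural : IsNaturalEnd c rank proj
  idem : ∀ g F, proj g (proj g F) = proj g F

/-! ### Complex-valued tensors -/

/-- Complex multiples of complex functions. -/
instance : SMul ℂ (CFn d M) :=
  ⟨fun z f => ⟨fun x => z * f x, (contDiff_const.mul contDiff_id).contMDiff.comp f.contMDiff⟩⟩

instance : Module ℂ (CFn d M) where
  one_smul f := by ext x; exact one_mul (f x)
  mul_smul z w f := by ext x; exact mul_assoc z w (f x)
  smul_zero z := by ext x; exact mul_zero z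
  smul_add z f f' := by ext x; exact mul_add z (f x) (f' x)
  add_smul z w f := by ext x; exact add_mul z w (f x)
  zero_smul f := by ext x; exact zero_mul (f x)

instance : SMulCommClass (Fn d M) ℂ (CFn d M) :=
  ⟨fun a z f => by ext x; exact smul_comm (a x) z (f x)⟩

instance : SMulCommClass ℂ (Fn d M) (CFn d M) :=
  ⟨fun z a f => (smul_comm a z f).symm⟩

/-- The real part. -/
def reFn : CFn d M →ₗ[Fn d M] Fn d M where
  toFun f := ⟨fun x => (f x).re, Complex.reCLM.contMDiff.comp f.contMDiff⟩
  map_add' _ _ := rfl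
  map_smul' a f := by ext x; exact Complex.smul_re (a x) (f x)

/-- The imaginary part. -/
def imFn : CFn d M →ₗ[Fn d M] Fn d M where
  toFun f := ⟨fun x => (f x).im, Complex.imCLM.contMDiff.comp f.contMDiff⟩
  map_add' _ _ := rfl
  map_smul' a f := by ext x; exact Complex.smul_im (a x) (f x)

/-- The inclusion of the real functions in the complex functions. -/
def ofRealFn : Fn d M →ₗ[Fn d M] CFn d M where
  toFun f := ⟨fun x => (f x : ℂ), Complex.ofRealCLM.contMDiff.comp f.contMDiff⟩
  map_add' f g := by ext x; exact Complex.ofReal_add (f x) (g x)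
  map_smul' a f := by
    ext x
    exact (Complex.ofReal_mul (a x) (f x)).trans (Complex.real_smul (x := a x)).symm

variable (d M) in
/-- Complex tractor tensors of rank `r` in a scale. -/
abbrev CTractorTensor (r : ℕ) : Type _ :=
  MultilinearMap (Fn d M) (fun _ : Fin r => TractorField (Fn d M)) (CFn d M)

/-- The real part of a complex tractor tensor. -/
def reT {r : ℕ} (F : CTractorTensor d M r) : TractorTensor (Fn d M) r :=
  reFn.compMultilinearMap F

/-- The imaginary part of a complex tractor tensor. -/
def imT {r : ℕ} (F : CTractorTensor d M r) : TractorTensor (Fn d M) r :=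
  imFn.compMultilinearMap F

theorem reT_add {r : ℕ} (F G : CTractorTensor d M r) : reT (F + G) = reT F + reT G := rfl

theorem imT_add {r : ℕ} (F G : CTractorTensor d M r) : imT (F + G) = imT F + imT G := rfl

theorem reT_fnSMul {r : ℕ} (f : Fn d M) (F : CTractorTensor d M r) : reT (f • F) = f • reT F :=
  MultilinearMap.ext fun T => reFn.map_smul f (F T)

theorem imT_fnSMul {r : ℕ} (f : Fn d M) (F : CTractorTensor d M r) : imT (f • F) = f • imT F :=
  MultilinearMap.ext fun T => imFn.map_smul f (F T)

theorem reT_smul {r : ℕ} (z : ℂ) (F : CTractorTensor d M r) :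
    reT (z • F) = algebraMap ℝ (Fn d M) z.re • reT F - algebraMap ℝ (Fn d M) z.im • imT F :=
  MultilinearMap.ext fun T => by ext x; exact Complex.mul_re z (F T x)

theorem imT_smul {r : ℕ} (z : ℂ) (F : CTractorTensor d M r) :
    imT (z • F) = algebraMap ℝ (Fn d M) z.re • imT F + algebraMap ℝ (Fn d M) z.im • reT F :=
  MultilinearMap.ext fun T => by ext x; exact Complex.mul_im z (F T x)

/-- The complex extension of an operator on real tractor tensors. -/
def complexify {r : ℕ} (P : TractorTensor (Fn d M) r → TractorTensor (Fn d M) r)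
    (F : CTractorTensor d M r) : CTractorTensor d M r :=
  ofRealFn.compMultilinearMap (P (reT F)) +
    Complex.I • ofRealFn.compMultilinearMap (P (imT F))

/-! ### Sections of weighted tractor bundles -/

variable {c : ConformalStructure d M}

/-- The smooth sections of `E^Φ[w]`: a complex tractor tensor for each metric of the class, with
the transformation law of a tensor of weight `w` under a change of the metric, and with values in
`E^Φ`. -/
def sections (Φ : TractorBundle c) (w : ℝ) :
    Submodule ℂ (c.metrics → CTractorTensor d M Φ.rank) where
  carrier := {F | (∀ (g g' : c.metrics) (Υ : Fn d M), IsRescaling g.1 Υ g'.1 →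
      ∀ T, F g' (fun i => changeSplitting g.1 Υ (T i)) = expFn w Υ • F g T) ∧
    ∀ g, Φ.proj g (reT (F g)) = reT (F g) ∧ Φ.proj g (imT (F g)) = imT (F g)}
  add_mem' := by
    rintro F G ⟨hF, hF'⟩ ⟨hG, hG'⟩
    refine ⟨fun g g' Υ h T => ?_, fun g => ⟨?_, ?_⟩⟩
    · simp only [Pi.add_apply, add_apply, hF g g' Υ h, hG g g' Υ h, smul_add]
    · rw [Pi.add_apply, reT_add, map_add, (hF' g).1, (hG' g).1]
    · rw [Pi.add_apply, imT_add, map_add, (hF' g).2, (hG' g).2]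
  zero_mem' := by
    have h₁ : reT (0 : CTractorTensor d M Φ.rank) = 0 := rfl
    have h₂ : imT (0 : CTractorTensor d M Φ.rank) = 0 := rfl
    refine ⟨fun g g' Υ h T => ?_, fun g => ⟨?_, ?_⟩⟩
    · simp
    · rw [Pi.zero_apply, h₁, map_zero]
    · rw [Pi.zero_apply, h₂, map_zero]
  smul_mem' := by
    rintro z F ⟨hF, hF'⟩
    refine ⟨fun g g' Υ h T => ?_, fun g => ⟨?_, ?_⟩⟩
    · simp only [Pi.smul_apply, smul_apply, hF g g' Υ h]
      rw [smul_comm]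
    · rw [Pi.smul_apply, reT_smul, map_sub, map_smul, map_smul, (hF' g).1, (hF' g).2]
    · rw [Pi.smul_apply, imT_smul, map_add, map_smul, map_smul, (hF' g).1, (hF' g).2]

/-- Multiplication of sections by a smooth function. -/
def mulFn (Φ : TractorBundle c) (w : ℝ) (f : Fn d M) : sections Φ w →ₗ[ℂ] sections Φ w where
  toFun F := ⟨fun g => f • F.1 g, by
    refine ⟨fun g g' Υ h T => ?_, fun g => ⟨?_, ?_⟩⟩
    · simp only [smul_apply, F.2.1 g g' Υ h]
      rw [smul_comm]
    · rw [reT_fnSMul, map_smul, (F.2.2 g).1]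
    · rw [imT_fnSMul, map_smul, (F.2.2 g).2]⟩
  map_add' F G := Subtype.ext (funext fun _ => smul_add f _ _)
  map_smul' z F := Subtype.ext (funext fun g => MultilinearMap.ext fun T => smul_comm f z (F.1 g T))

/-- Multiplication of sections by a density of weight `1`. -/
def mulDensity (Φ : TractorBundle c) (σ : RealDensity c 1) (w : ℝ) :
    sections Φ (w - 1) →ₗ[ℂ] sections Φ w where
  toFun F := ⟨fun g => σ.val g • F.1 g, by
    refine ⟨fun g g' Υ h T => ?_, fun g => ⟨?_, ?_⟩⟩
    · have he : expFn 1 Υ * expFn (w - 1) Υ = expFn w Υ := by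
        ext x
        change Real.exp (1 * Υ x) * Real.exp ((w - 1) * Υ x) = Real.exp (w * Υ x)
        rw [← Real.exp_add]
        ring_nf
      simp only [smul_apply, F.2.1 g g' Υ h, σ.equivariant g g' Υ h, smul_smul, ← he]
      ring_nf
    · rw [reT_fnSMul, map_smul, (F.2.2 g).1]
    · rw [imT_fnSMul, map_smul, (F.2.2 g).2]⟩
  map_add' F G := Subtype.ext (funext fun g => smul_add (σ.val g) _ _)
  map_smul' z F := Subtype.ext (funext fun g =>
    MultilinearMap.ext fun T => smul_comm (σ.val g) z (F.1 g T))

/-- The smooth sections of the restriction of `E^Φ[w]` to a subset `Z` of `M`: near each point of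
`Z` they are the restriction of a smooth section of `E^Φ[w]`. (A tensor at a point is given by its
values on tractor fields.) -/
def sectionsOn (Φ : TractorBundle c) (w : ℝ) (Z : Set M) :
    Submodule ℂ (c.metrics → (Fin Φ.rank → TractorField (Fn d M)) → Z → ℂ) where
  carrier := {s | ∀ p : Z, ∃ U ∈ 𝓝 (p : M), ∃ F : sections Φ w,
    ∀ g T (x : Z), (x : M) ∈ U → s g T x = F.1 g T x}
  add_mem' := by
    intro s t hs ht p
    obtain ⟨U, hU, F, hF⟩ := hs p
    obtain ⟨V, hV, G, hG⟩ := ht p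
    refine ⟨U ∩ V, Filter.inter_mem hU hV, F + G, fun g T x hx => ?_⟩
    exact congrArg₂ (· + ·) (hF g T x hx.1) (hG g T x hx.2)
  zero_mem' := fun _ => ⟨Set.univ, Filter.univ_mem, 0, fun _ _ _ _ => rfl⟩
  smul_mem' := by
    intro z s hs p
    obtain ⟨U, hU, F, hF⟩ := hs p
    exact ⟨U, hU, z • F, fun g T x hx => congrArg (z * ·) (hF g T x hx)⟩

/-- The restriction of sections to a subset. -/
def restrict (Φ : TractorBundle c) (w : ℝ) (Z : Set M) :
    sections Φ w →ₗ[ℂ] sectionsOn Φ w Z where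
  toFun F := ⟨fun g T x => F.1 g T x,
    fun _ => ⟨Set.univ, Filter.univ_mem, F, fun _ _ _ _ => rfl⟩⟩
  map_add' _ _ := rfl
  map_smul' _ _ := rfl

/-- A smooth function on a subset `Z` of `M`: near each point of `Z` it is the restriction of a
smooth function on `M`. -/
structure FnOn (d : ℕ) {M : Type*} [TopologicalSpace M]
    [ChartedSpace (EuclideanSpace ℝ (Fin d)) M] (Z : Set M) where
  val : Z → ℝ
  smooth : ∀ p : Z, ∃ U ∈ 𝓝 (p : M), ∃ F : Fn d M, ∀ x : Z, (x : M) ∈ U → val x = F x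

/-- Multiplication of sections over `Z` by a smooth function on `Z`. -/
def mulFnOn (Φ : TractorBundle c) (w : ℝ) (Z : Set M) (f : FnOn d Z) :
    sectionsOn Φ w Z →ₗ[ℂ] sectionsOn Φ w Z where
  toFun s := ⟨fun g T x => f.val x • s.1 g T x, fun p => by
    obtain ⟨U, hU, F, hF⟩ := f.smooth p
    obtain ⟨V, hV, G, hG⟩ := s.2 p
    refine ⟨U ∩ V, Filter.inter_mem hU hV, mulFn Φ w F G, fun g T x hx => ?_⟩
    exact congrArg₂ (· • ·) (hF x hx.1) (hG g T x hx.2)⟩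
  map_add' s t := Subtype.ext (funext fun g => funext fun T => funext fun x =>
    smul_add (f.val x) (s.1 g T x) (t.1 g T x))
  map_smul' z s := Subtype.ext (funext fun g => funext fun T => funext fun x =>
    smul_comm (f.val x) z (s.1 g T x))

end Manifold

/-! ### Differential and tangential operators -/

/-- Linear differential operators of order at most `m` between two modules over an algebra of
functions: the operators that commute with multiplication by functions when `m = 0`, and those whose
commutator with every function is a differential operator of order at most `m` for `m + 1`.
The multiplications by the functions `f : R` are given by `μ` and `ν`. -/
def IsDiffOp {R V W : Type*} [AddCommGroup V] [Module ℂ V] [AddCommGroup W] [Module ℂ W]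
    (μ : R → V →ₗ[ℂ] V) (ν : R → W →ₗ[ℂ] W) : ℕ → (V →ₗ[ℂ] W) → Prop
  | 0, P => ∀ f, P ∘ₗ μ f = ν f ∘ₗ P
  | m + 1, P => ∀ f, IsDiffOp μ ν m (P ∘ₗ μ f - ν f ∘ₗ P)

section Operators

variable {d : ℕ} {M : Type*} [TopologicalSpace M] [ChartedSpace (EuclideanSpace ℝ (Fin d)) M]
  {c : ConformalStructure d M}

/-- `P` is a linear differential operator from sections of `E^Φ[w₁]` to sections of `E^Φ[w₂]`. -/
def IsDifferentialOperator (Φ : TractorBundle c) {w₁ w₂ : ℝ}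
    (P : sections Φ w₁ →ₗ[ℂ] sections Φ w₂) : Prop :=
  ∃ m, IsDiffOp (V := sections Φ w₁) (W := sections Φ w₂) (mulFn Φ w₁) (mulFn Φ w₂) m P

/-- `P` is a linear differential operator between sections of the restrictions of `E^Φ[w₁]` and
`E^Φ[w₂]` to `Z`. -/
def IsDifferentialOperatorOn (Φ : TractorBundle c) {w₁ w₂ : ℝ} (Z : Set M)
    (P : sectionsOn Φ w₁ Z →ₗ[ℂ] sectionsOn Φ w₂ Z) : Prop :=
  ∃ m, IsDiffOp (mulFnOn Φ w₁ Z) (mulFnOn Φ w₂ Z) m P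

/-- `P` acts tangentially along the zero locus of `σ`: `P ∘ σ = σ ∘ P'` for some linear operator
`P'`. -/
def ActsTangentially (Φ : TractorBundle c) (σ : RealDensity c 1) {w₁ w₂ : ℝ}
    (P : sections Φ w₁ →ₗ[ℂ] sections Φ w₂) : Prop :=
  ∃ P' : sections Φ (w₁ - 1) →ₗ[ℂ] sections Φ (w₂ - 1),
    P ∘ₗ mulDensity Φ σ w₁ = mulDensity Φ σ w₂ ∘ₗ P'

end Operators

end Tractor

end

open Tractor

noncomputable section

set_option linter.unusedSectionVars false

namespace Tractor

/-! ## Smooth functions on a vector space -/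

section Euclidean

variable {E F : Type} [NormedAddCommGroup E] [NormedSpace ℝ E]
  [NormedAddCommGroup F] [NormedSpace ℝ F]

/-! The theorem is an `sl(2)` computation followed by a division argument. In a scale write `I = (σ,
dσ, ρ)`. On weight `w` the Leibniz rule gives `[I·D, σ] = (d + 2w) I²`: the gradient terms cancel,
and the relation `d · ρ = -(Δσ + Jσ)` assembles the rest into `I² = |dσ|² + 2σρ`
(`degenerateLaplacian_mul_scale`). Hence `y = -(1/I²) I·D` satisfies `[y, σ] = -(d + 2w)`, and
summing over the weights met by successive factors gives `y^(k+1) σ = σ y^(k+1) - (k+1)(d + 2w - k)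
y^k` (`yPow_succ_mul_scale`). For `P_k` in dimension `n + 1`, acting on weight `(k - n)/2`, the
corresponding coefficient vanishes. So `P_k` commutes with `σ`, and the operator on the other side
is the same power begun one weight lower.

The operator is defined scale by scale. Its independence of the scale rests on the conformal change
of the Schouten tensor, which makes the change of splitting intertwine the tractor connections
(`IsConformalChange.tractorConnection`), and on the transformation of the Thomas operator
(`IsConformalChange.contract_thomasD`). Values in `E^Φ` are preserved because natural endomorphisms
are parallel (`IsNaturalEnd.covTensor`, `map_yPow`).

At a zero of `σ` one has `I² = |dσ|²`, so `dσ ≠ 0` there, and Hadamard's lemma shows that a section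
vanishing on the zero locus is `σ` times a smooth section (`exists_mulDensity_eq`). `P_k` maps such
a section to a multiple of `σ`, so it descends to the zero locus. Partitions of unity make
restriction surjective, whence existence and uniqueness. Functions on the zero locus extend to `M`,
so iterated commutators descend too, and the induced operator is differential.

Metric traces are specified by a choice, so their existence has to be proved first, by gluing traces
computed in local frames (`exists_trace`). The tensor algebra then runs over an abstract algebra in
which `IsTraceForm` and `HasDimension` hold. -/

theorem sub_eq_integral_fderiv {u : E → ℝ} (hu : ContDiff ℝ ∞ u) (a b : E) :
    u b - u a = ∫ t in (0 : ℝ)..1, fderiv ℝ u (a + t • (b - a)) (b - a) := by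
  have hd : ∀ t ∈ Set.uIcc (0 : ℝ) 1, HasDerivAt (fun t : ℝ => u (a + t • (b - a)))
      (fderiv ℝ u (a + t • (b - a)) (b - a)) t := by
    intro t _
    have h1 := (hu.differentiable (by simp) (a + t • (b - a))).hasFDerivAt
    have h2 : HasDerivAt (fun t : ℝ => a + t • (b - a)) (b - a) t := by
      simpa using ((hasDerivAt_id t).smul_const (b - a)).const_add a
    exact h1.comp_hasDerivAt t h2
  have hi : IntervalIntegrable (fun t : ℝ => fderiv ℝ u (a + t • (b - a)) (b - a))
      MeasureTheory.volume 0 1 := by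
    refine Continuous.intervalIntegrable ?_ 0 1
    exact ((hu.continuous_fderiv (by simp)).comp (by fun_prop)).clm_apply continuous_const
  rw [intervalIntegral.integral_eq_sub_of_hasDerivAt hd hi]
  simp

variable [FiniteDimensional ℝ E]

/-- Differentiation under the integral sign: the derivative of the integrand is continuous, hence
bounded on the compact set `closedBall x 1 × [0, 1]`, and a constant dominates it. -/
theorem hasFDerivAt_parametric_integral {f : E → ℝ → F}
    (hf : ContDiff ℝ ∞ (Function.uncurry f)) (x : E) :
    HasFDerivAt (fun x => ∫ t in (0 : ℝ)..1, f x t)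
      (∫ t in (0 : ℝ)..1, (fderiv ℝ (Function.uncurry f) (x, t)).comp
        (ContinuousLinearMap.inl ℝ E ℝ)) x := by
  have hc : Continuous fun p : E × ℝ =>
      (fderiv ℝ (Function.uncurry f) p).comp (ContinuousLinearMap.inl ℝ E ℝ) :=
    (hf.continuous_fderiv (by simp)).clm_comp continuous_const
  have hK : IsCompact (Metric.closedBall x 1 ×ˢ Set.Icc (0 : ℝ) 1) :=
    (isCompact_closedBall x 1).prod isCompact_Icc
  obtain ⟨C, hC⟩ := hK.exists_bound_of_continuousOn hc.continuousOn
  refine intervalIntegral.hasFDerivAt_integral_of_dominated_of_fderiv_le (𝕜 := ℝ)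
    (bound := fun _ => C) (s := Metric.closedBall x 1)
    (F' := fun x t => (fderiv ℝ (Function.uncurry f) (x, t)).comp (ContinuousLinearMap.inl ℝ E ℝ))
    (Metric.closedBall_mem_nhds x one_pos) ?_ ?_ ?_ ?_ ?_ ?_
  · exact Filter.Eventually.of_forall fun y =>
      (hf.continuous.comp (Continuous.prodMk_right y)).aestronglyMeasurable
  · exact (hf.continuous.comp (Continuous.prodMk_right x)).intervalIntegrable 0 1
  · exact (hc.comp (Continuous.prodMk_right x)).aestronglyMeasurable
  · refine Filter.Eventually.of_forall fun t ht y hy => hC (y, t) ⟨hy, ?_⟩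
    rw [Set.uIoc_of_le zero_le_one] at ht
    exact ⟨ht.1.le, ht.2⟩
  · exact intervalIntegrable_const
  · refine Filter.Eventually.of_forall fun t _ y _ => ?_
    have h1 : HasFDerivAt (Function.uncurry f) (fderiv ℝ (Function.uncurry f) (y, t)) (y, t) :=
      (hf.differentiable (by simp) (y, t)).hasFDerivAt
    exact HasFDerivAt.comp (g := Function.uncurry f) (f := fun e => (e, t)) y h1
      (hasFDerivAt_prodMk_left y t)

/-- The derivative of the integral is again such an integral, now with values in `E →L[ℝ] F`; the
induction therefore quantifies over all target spaces. -/
theorem contDiff_nat_parametric_integral (m : ℕ) : ∀ {F : Type} [NormedAddCommGroup F]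
    [NormedSpace ℝ F] {f : E → ℝ → F}, ContDiff ℝ ∞ (Function.uncurry f) →
    ContDiff ℝ m (fun x => ∫ t in (0 : ℝ)..1, f x t) := by
  induction m with
  | zero =>
    intro F _ _ f hf
    simp only [Nat.cast_zero, contDiff_zero]
    exact intervalIntegral.continuous_parametric_intervalIntegral_of_continuous' hf.continuous 0 1
  | succ m ih =>
    intro F _ _ f hf
    rw [Nat.cast_add, Nat.cast_one, contDiff_succ_iff_hasFDerivAt]
    refine ⟨_, ih ?_, hasFDerivAt_parametric_integral hf⟩
    have h : ContDiff ℝ ∞ (fderiv ℝ (Function.uncurry f)) := hf.fderiv_right (by simp)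
    exact h.clm_comp contDiff_const

theorem contDiff_parametric_integral {f : E → ℝ → F} (hf : ContDiff ℝ ∞ (Function.uncurry f)) :
    ContDiff ℝ ∞ (fun x => ∫ t in (0 : ℝ)..1, f x t) :=
  contDiff_infty.2 fun m => contDiff_nat_parametric_integral m hf

/-- Hadamard's lemma. -/
theorem exists_hadamard {u : E → ℝ} (hu : ContDiff ℝ ∞ u) (c : E) :
    ∃ K : E → E →L[ℝ] ℝ, ContDiff ℝ ∞ K ∧ (∀ z, u z - u c = K z (z - c)) ∧ K c = fderiv ℝ u c := by
  have hc : Continuous (fderiv ℝ u) := hu.continuous_fderiv (by simp)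
  refine ⟨fun z => ∫ t in (0 : ℝ)..1, fderiv ℝ u (c + t • (z - c)), ?_, fun z => ?_, ?_⟩
  · apply contDiff_parametric_integral
    have h : ContDiff ℝ ∞ (fderiv ℝ u) := hu.fderiv_right (by simp)
    exact h.comp (contDiff_const.add (contDiff_snd.smul (contDiff_fst.sub contDiff_const)))
  · rw [sub_eq_integral_fderiv hu c z, ContinuousLinearMap.intervalIntegral_apply]
    exact (hc.comp (by fun_prop)).intervalIntegrable 0 1
  · simp

/-- A smooth function that vanishes on a hyperplane is divisible by its linear equation. -/
theorem exists_eq_linear_mul {f : E → ℝ} (hf : ContDiff ℝ ∞ f) (l : E →L[ℝ] ℝ) {v : E}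
    (hv : l v = 1) (h0 : ∀ z, l z = 0 → f z = 0) :
    ∃ h : E → ℝ, ContDiff ℝ ∞ h ∧ ∀ z, f z = l z * h z := by
  -- The segment from `z - l z • v`, which lies on the hyperplane, to `z` has direction `l z • v`.
  -- Pulling `l z` out of the fundamental theorem of calculus leaves this integral.
  refine ⟨fun z => ∫ t in (0 : ℝ)..1, fderiv ℝ f (z - l z • v + t • l z • v) v, ?_, fun z => ?_⟩
  · apply contDiff_parametric_integral
    have h : ContDiff ℝ ∞ (fderiv ℝ f) := hf.fderiv_right (by simp)
    have hl : ContDiff ℝ ∞ fun p : E × ℝ => l p.1 := l.contDiff.comp contDiff_fst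
    exact (h.comp ((contDiff_fst.sub (hl.smul contDiff_const)).add
      (contDiff_snd.smul (hl.smul contDiff_const)))).clm_apply contDiff_const
  · have h1 := sub_eq_integral_fderiv hf (z - l z • v) z
    rw [h0 (z - l z • v) (by simp [hv]), sub_zero, sub_sub_cancel] at h1
    rw [h1, ← intervalIntegral.integral_const_mul]
    simp

/-- A smooth function that vanishes, near a point `q`, on the zero set of a function with nonzero
differential at `q` is divisible by this function near `q`. -/
theorem exists_eventually_eq_mul {f s : E → ℝ} (hf : ContDiff ℝ ∞ f) (hs : ContDiff ℝ ∞ s) {q : E}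
    (hq : fderiv ℝ s q ≠ 0) (h0 : ∀ᶠ z in 𝓝 q, s z = 0 → f z = 0) :
    ∃ h : E → ℝ, ContDiff ℝ ∞ h ∧ ∀ᶠ z in 𝓝 q, f z = s z * h z := by
  set l := fderiv ℝ s q with hl
  obtain ⟨v, hv⟩ : ∃ v, l v = 1 := by
    obtain ⟨v, hv⟩ : ∃ v, l v ≠ 0 := by
      by_contra! h
      exact hq (ContinuousLinearMap.ext h)
    exact ⟨(l v)⁻¹ • v, by simp [hv]⟩
  -- `Φ` straightens the zero set: `l ∘ Φ = s`, and its derivative at `q` is the identity because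
  -- `l` is the derivative of `s` there.
  set Φ : E → E := fun y => y + (s y - l y) • v with hΦ
  have hΦs : ContDiff ℝ ∞ Φ := contDiff_id.add ((hs.sub l.contDiff).smul contDiff_const)
  have hlΦ : ∀ y, l (Φ y) = s y := fun y => by simp [hΦ, hv]
  have hΦ' : HasFDerivAt Φ ((ContinuousLinearEquiv.refl ℝ E : E ≃L[ℝ] E) : E →L[ℝ] E) q := by
    have h1 : HasFDerivAt Φ (ContinuousLinearMap.id ℝ E +
        (l - l).smulRight v) q :=
      (hasFDerivAt_id q).add
        (((hs.differentiable (by simp) q).hasFDerivAt.sub l.hasFDerivAt).smul_const v)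
    simpa using h1
  have hcd : ContDiffAt ℝ ∞ Φ q := hΦs.contDiffAt
  let e := hcd.toOpenPartialHomeomorph Φ hΦ' (by simp)
  have hecoe : ∀ y, e y = Φ y := fun _ => rfl
  have hqe : q ∈ e.source := hcd.mem_toOpenPartialHomeomorph_source hΦ' (by simp)
  -- The inverse has to be smooth on a whole neighbourhood and not only at `Φ q`, so invertibility
  -- of the derivative is propagated to nearby points.
  have hinv : ∀ᶠ y in 𝓝 q, ∃ L : E ≃L[ℝ] E, HasFDerivAt Φ (L : E →L[ℝ] E) y := by
    have hcont : Continuous (fderiv ℝ Φ) := hΦs.continuous_fderiv (by simp)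
    have hmem : Set.range ((↑) : (E ≃L[ℝ] E) → E →L[ℝ] E) ∈ 𝓝 (fderiv ℝ Φ q) := by
      rw [hΦ'.fderiv]
      exact ContinuousLinearEquiv.nhds _
    filter_upwards [hcont.continuousAt hmem] with y hy
    obtain ⟨L, hL⟩ := hy
    exact ⟨L, by rw [hL]; exact (hΦs.differentiable (by simp) y).hasFDerivAt⟩
  have hqt : e q ∈ e.target := e.map_source hqe
  have hsymm : ∀ᶠ z in 𝓝 (e q), z ∈ e.target ∧ ContDiffAt ℝ ∞ e.symm z ∧
      (s (e.symm z) = 0 → f (e.symm z) = 0) := by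
    have hcs : Filter.Tendsto e.symm (𝓝 (e q)) (𝓝 q) := by
      have := e.continuousAt_symm hqt
      rwa [ContinuousAt, e.left_inv hqe] at this
    filter_upwards [e.open_target.mem_nhds hqt, hcs.eventually hinv, hcs.eventually h0]
      with z hz hi hz0
    obtain ⟨L, hL⟩ := hi
    exact ⟨hz, e.contDiffAt_symm hz hL hΦs.contDiffAt, hz0⟩
  obtain ⟨r, hr, hball⟩ := Metric.nhds_basis_closedBall.mem_iff.1 hsymm
  -- The cut-off turns `f ∘ Φ⁻¹` into a smooth function on all of `E`, as `exists_eq_linear_mul`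
  -- requires.
  let β : ContDiffBump (e q) := ⟨r / 2, r, by positivity, by linarith⟩
  have hF : ContDiff ℝ ∞ fun z => β z * f (e.symm z) := by
    rw [contDiff_iff_contDiffAt]
    intro z
    by_cases hz : z ∈ tsupport β
    · rw [β.tsupport_eq] at hz
      exact β.contDiff.contDiffAt.mul (hf.contDiffAt.comp z (hball hz).2.1)
    · have : (fun z => β z * f (e.symm z)) =ᶠ[𝓝 z] fun _ => 0 := by
        filter_upwards [notMem_tsupport_iff_eventuallyEq.1 hz] with y hy
        simp [hy]
      exact contDiffAt_const.congr_of_eventuallyEq this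
  obtain ⟨h, hh, hFh⟩ := exists_eq_linear_mul hF l hv (fun z hz => by
    by_cases hz' : z ∈ Metric.closedBall (e q) r
    · have h3 := hball hz'
      have h4 : s (e.symm z) = 0 := by
        rw [← hlΦ, ← hecoe, e.right_inv h3.1, hz]
      rw [h3.2.2 h4, mul_zero]
    · have : β z = 0 := by
        refine β.zero_of_le_dist ?_
        rw [Metric.mem_closedBall, not_le] at hz'
        exact hz'.le
      rw [this, zero_mul])
  refine ⟨h ∘ Φ, hh.comp hΦs, ?_⟩
  have hβ : ∀ᶠ y in 𝓝 q, β (e y) = 1 :=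
    (e.continuousAt hqe).eventually β.eventuallyEq_one
  filter_upwards [hβ, e.open_source.mem_nhds hqe] with y hy hys
  have h5 := hFh (e y)
  rw [hy, e.left_inv hys, one_mul, hecoe, hlΦ] at h5
  exact h5

end Euclidean

/-! ## Smooth functions and derivations on a manifold -/

section SmoothFunctions

variable {d : ℕ} {M : Type*} [TopologicalSpace M] [ChartedSpace (EuclideanSpace ℝ (Fin d)) M]

theorem Fn.add_apply (f g : Fn d M) (x : M) : (f + g) x = f x + g x := rfl
theorem Fn.sub_apply (f g : Fn d M) (x : M) : (f - g) x = f x - g x := rfl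
theorem Fn.mul_apply (f g : Fn d M) (x : M) : (f * g) x = f x * g x := rfl
theorem Fn.algebraMap_apply (r : ℝ) (x : M) : algebraMap ℝ (Fn d M) r x = r := rfl

theorem Fn.sum_apply {ι : Type*} (s : Finset ι) (f : ι → Fn d M) (x : M) :
    (∑ i ∈ s, f i) x = ∑ i ∈ s, f i x := by
  classical
  induction s using Finset.induction_on with
  | empty => rfl
  | insert a s ha ih => rw [Finset.sum_insert ha, Finset.sum_insert ha, Fn.add_apply, ih]

/-- Functions that are locally equal to smooth functions are smooth. -/
theorem exists_fn_of_local (h : M → Fn d M) (hh : ∀ x, ∀ᶠ y in 𝓝 x, h x y = h y y) :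
    ∃ H : Fn d M, ∀ x, H x = h x x :=
  ⟨⟨fun x => h x x, fun x => (h x).contMDiff.contMDiffAt.congr_of_eventuallyEq
    ((hh x).mono fun _ hy => hy.symm)⟩, fun _ => rfl⟩

/-- The reciprocal of a function without zeros. -/
theorem isUnit_of_forall_ne_zero (f : Fn d M) (hf : ∀ x, f x ≠ 0) : IsUnit f := by
  have h : ContMDiff (𝓡 d) 𝓘(ℝ, ℝ) ∞ fun x => (f x)⁻¹ := fun x =>
    (contDiffAt_inv ℝ (hf x)).contMDiffAt.comp x f.contMDiff.contMDiffAt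
  exact IsUnit.of_mul_eq_one ⟨_, h⟩ (by ext x; exact mul_inv_cancel₀ (hf x))

/-- The composition of a smooth function with a smooth function of a real variable. -/
def compFn (u : ℝ → ℝ) (hu : ContDiff ℝ ∞ u) (f : Fn d M) : Fn d M :=
  ⟨fun x => u (f x), hu.contMDiff.comp f.contMDiff⟩

variable [T2Space M] [IsManifold (𝓡 d) ∞ M]

theorem exists_bump {x : M} {U : Set M} (hU : U ∈ 𝓝 x) :
    ∃ χ : Fn d M, (∀ᶠ y in 𝓝 x, χ y = 1) ∧ tsupport χ ⊆ U ∧ ∀ y, χ y ≤ 1 := by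
  obtain ⟨f, -, hf⟩ := (SmoothBumpFunction.nhds_basis_tsupport (I := 𝓡 d) x).mem_iff.1 hU
  exact ⟨⟨f, f.contMDiff⟩, f.eventuallyEq_one, hf, fun y => f.le_one⟩

theorem exists_fn_eventuallyEq {x : M} (h : M → ℝ)
    (hh : ∀ᶠ y in 𝓝 x, ContMDiffAt (𝓡 d) 𝓘(ℝ, ℝ) ∞ h y) :
    ∃ f : Fn d M, ∀ᶠ y in 𝓝 x, f y = h y := by
  obtain ⟨χ, h1, hs, -⟩ := exists_bump (d := d) hh
  refine ⟨⟨fun y => χ y * h y, contMDiff_of_tsupport fun y hy => ?_⟩, ?_⟩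
  · refine χ.contMDiff.contMDiffAt.mul (hs ?_)
    exact (tsupport_mul_subset_left (f := χ) (g := h)) hy
  · filter_upwards [h1] with y hy
    change χ y * h y = h y
    rw [hy, one_mul]

/-- Derivations are local operators. -/
theorem derivation_congr (X : VectorField (Fn d M)) {f f' : Fn d M} {x : M}
    (h : ∀ᶠ y in 𝓝 x, f y = f' y) : X f x = X f' x := by
  obtain ⟨χ, h1, hs, -⟩ := exists_bump (d := d) h
  -- At `x`, where `χ = 1` and `f = f'`, the Leibniz rule for this product leaves only `X f x - X f'
  -- x`.
  have hz : χ * (f - f') = 0 := by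
    ext y
    change χ y * (f y - f' y) = 0
    by_cases hy : y ∈ tsupport χ
    · rw [show f y = f' y from hs hy, sub_self, mul_zero]
    · rw [image_eq_zero_of_notMem_tsupport hy, zero_mul]
  have h2 : (X (χ * (f - f'))) x = 0 := by rw [hz, map_zero]; rfl
  rw [Derivation.leibniz, map_sub] at h2
  have h3 : χ x * (X f x - X f' x) + (f x - f' x) * X χ x = 0 := h2
  rw [h1.self_of_nhds, h.self_of_nhds] at h3
  linarith

/-- The chain rule for derivations. -/
theorem derivation_compFn (X : VectorField (Fn d M)) (u : ℝ → ℝ) (hu : ContDiff ℝ ∞ u)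
    (f : Fn d M) (x : M) : X (compFn u hu f) x = deriv u (f x) * X f x := by
  obtain ⟨K, hK, huK, hKc⟩ := exists_hadamard hu (f x)
  have hk : ContDiff ℝ ∞ fun t => K t 1 := hK.clm_apply contDiff_const
  -- Hadamard's lemma at the value `f x` writes `u ∘ f` as a constant plus `f - f x` times a smooth
  -- function, so the algebraic Leibniz rule alone yields the chain rule.
  have h1 : compFn u hu f = algebraMap ℝ (Fn d M) (u (f x)) +
      (f - algebraMap ℝ (Fn d M) (f x)) * compFn _ hk f := by
    ext y
    change u (f y) = u (f x) + (f y - f x) * K (f y) 1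
    have h2 := huK (f y)
    rw [show f y - f x = (f y - f x) • (1 : ℝ) by simp, map_smul] at h2
    rw [smul_eq_mul] at h2
    linarith
  rw [h1, map_add, Derivation.map_algebraMap, zero_add, Derivation.leibniz, map_sub,
    Derivation.map_algebraMap, sub_zero]
  change (f x - f x) * _ + K (f x) 1 * X f x = _
  rw [hKc, sub_self, zero_mul, zero_add, fderiv_apply_one_eq_deriv]

theorem derivation_expFn (X : VectorField (Fn d M)) (w : ℝ) (Υ : Fn d M) :
    X (expFn w Υ) = algebraMap ℝ (Fn d M) w * expFn w Υ * X Υ := by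
  have hu : ContDiff ℝ ∞ fun t : ℝ => Real.exp (w * t) := by fun_prop
  ext x
  have h := derivation_compFn X _ hu Υ x
  have hd : deriv (fun t : ℝ => Real.exp (w * t)) (Υ x) = Real.exp (w * Υ x) * w := by
    have : HasDerivAt (fun t : ℝ => Real.exp (w * t)) (Real.exp (w * Υ x) * w) (Υ x) := by
      simpa using ((hasDerivAt_id (Υ x)).const_mul w).exp
    exact this.deriv
  rw [hd] at h
  refine h.trans ?_
  change Real.exp (w * Υ x) * w * X Υ x = w * Real.exp (w * Υ x) * X Υ x
  ring

/-! ### Local coordinates -/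

theorem contDiffOn_comp_symm (x₀ : M) (f : Fn d M) :
    ContDiffOn ℝ ∞ (f ∘ (extChartAt (𝓡 d) x₀).symm) (extChartAt (𝓡 d) x₀).target :=
  contMDiffOn_iff_contDiffOn.1 (f.contMDiff.comp_contMDiffOn (contMDiffOn_extChartAt_symm x₀))

/-- The coordinate expression is multiplied by a bump function, so that it is smooth on the whole
Euclidean space, where Hadamard's lemma applies. -/
theorem exists_contDiff_eventuallyEq (x₀ : M) {y : M} (hy : y ∈ (extChartAt (𝓡 d) x₀).source)
    (f : Fn d M) : ∃ u : EuclideanSpace ℝ (Fin d) → ℝ, ContDiff ℝ ∞ u ∧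
      ∀ᶠ z in 𝓝 y, f z = u (extChartAt (𝓡 d) x₀ z) := by
  set φ := extChartAt (𝓡 d) x₀
  have ht : φ.target ∈ 𝓝 (φ y) := (isOpen_extChartAt_target x₀).mem_nhds (φ.map_source hy)
  obtain ⟨r, hr, hball⟩ := Metric.nhds_basis_closedBall.mem_iff.1 ht
  let β : ContDiffBump (φ y) := ⟨r / 2, r, by positivity, by linarith⟩
  refine ⟨fun z => β z * f (φ.symm z), ?_, ?_⟩
  · rw [contDiff_iff_contDiffAt]
    intro z
    by_cases hz : z ∈ tsupport β
    · rw [β.tsupport_eq] at hz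
      exact β.contDiff.contDiffAt.mul ((contDiffOn_comp_symm x₀ f).contDiffAt
        ((isOpen_extChartAt_target x₀).mem_nhds (hball hz)))
    · refine contDiffAt_const (c := (0 : ℝ)).congr_of_eventuallyEq ?_
      filter_upwards [notMem_tsupport_iff_eventuallyEq.1 hz] with y hy
      simp [hy]
  · have hβ := (continuousAt_extChartAt' hy).eventually β.eventuallyEq_one
    filter_upwards [hβ, (isOpen_extChartAt_source x₀).mem_nhds hy] with z hz hzs
    rw [hz, φ.left_inv hzs]
    simp

theorem exists_fn_comp_chart (x₀ : M) {y : M} (hy : y ∈ (extChartAt (𝓡 d) x₀).source)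
    {u : EuclideanSpace ℝ (Fin d) → ℝ} (hu : ContDiff ℝ ∞ u) :
    ∃ f : Fn d M, ∀ᶠ z in 𝓝 y, f z = u (extChartAt (𝓡 d) x₀ z) := by
  refine exists_fn_eventuallyEq (fun z => u (extChartAt (𝓡 d) x₀ z)) ?_
  filter_upwards [(isOpen_extChartAt_source x₀).mem_nhds hy] with z hz
  rw [extChartAt_source] at hz
  exact hu.contMDiff.contMDiffAt.comp z (contMDiffAt_extChartAt' hz)

/-- The action of a derivation in local coordinates. -/
theorem derivation_apply_eq_sum (X : VectorField (Fn d M)) (x₀ : M) {y : M}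
    (hy : y ∈ (extChartAt (𝓡 d) x₀).source) (ξ : Fin d → Fn d M)
    (hξ : ∀ i, ∀ᶠ z in 𝓝 y, ξ i z = extChartAt (𝓡 d) x₀ z i) (f : Fn d M)
    {u : EuclideanSpace ℝ (Fin d) → ℝ} (hu : ContDiff ℝ ∞ u)
    (hfu : ∀ᶠ z in 𝓝 y, f z = u (extChartAt (𝓡 d) x₀ z)) :
    X f y = ∑ i, X (ξ i) y *
      fderiv ℝ u (extChartAt (𝓡 d) x₀ y) (EuclideanSpace.single i 1) := by
  set φ := extChartAt (𝓡 d) x₀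
  obtain ⟨K, hK, huK, hKc⟩ := exists_hadamard hu (φ y)
  choose k hk using fun i : Fin d => exists_fn_comp_chart x₀ hy
    (u := fun z => K z (EuclideanSpace.single i 1)) (hK.clm_apply contDiff_const)
  have hsum : ∀ v : EuclideanSpace ℝ (Fin d), v = ∑ i, v i • EuclideanSpace.single i (1 : ℝ) := by
    intro v
    ext j
    simp [Finset.sum_apply, Pi.single_apply]
  -- Hadamard expansion around `y`. A derivation kills the constant, and since each `ξ i - φ y i`
  -- vanishes at `y`, only the terms with `X (ξ i)` survive.
  have h1 : ∀ᶠ z in 𝓝 y, f z = (algebraMap ℝ (Fn d M) (u (φ y)) +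
      ∑ i, (ξ i - algebraMap ℝ (Fn d M) (φ y i)) * k i) z := by
    filter_upwards [hfu, Filter.eventually_all.2 hξ, Filter.eventually_all.2 hk] with z h2 h3 h4
    rw [h2, Fn.add_apply, Fn.sum_apply, Fn.algebraMap_apply]
    simp only [Fn.mul_apply, Fn.sub_apply, Fn.algebraMap_apply, h3, h4]
    have h5 := huK (φ z)
    rw [hsum (φ z - φ y), map_sum] at h5
    simp only [map_smul, smul_eq_mul, PiLp.sub_apply] at h5
    change u (φ z) = u (φ y) + ∑ i, (φ z i - φ y i) * K (φ z) (EuclideanSpace.single i 1)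
    linarith
  rw [derivation_congr X h1, map_add, Derivation.map_algebraMap, zero_add, map_sum, Fn.sum_apply]
  refine Finset.sum_congr rfl fun i _ => ?_
  rw [Derivation.leibniz, map_sub, Derivation.map_algebraMap, sub_zero]
  change (ξ i y - φ y i) * X (k i) y + k i y * X (ξ i) y = _
  rw [(hξ i).self_of_nhds, (hk i).self_of_nhds, sub_self, zero_mul, zero_add, hKc, mul_comm]

/-- The coordinate vector field `χ ∂_i` of the chart at `x₀`, cut off by a bump function. -/
def coordinateField {x₀ : M} (χ : SmoothBumpFunction (𝓡 d) x₀) (i : Fin d) :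
    VectorField (Fn d M) :=
  Derivation.mk'
    { toFun := fun f => ⟨fun y => χ y • fderiv ℝ (f ∘ (extChartAt (𝓡 d) x₀).symm)
          (extChartAt (𝓡 d) x₀ y) (EuclideanSpace.single i 1), by
        refine χ.contMDiff_smul ?_
        have h1 : ContDiffOn ℝ ∞ (fun z => fderiv ℝ (f ∘ (extChartAt (𝓡 d) x₀).symm) z
            (EuclideanSpace.single i 1)) (extChartAt (𝓡 d) x₀).target :=
          ((contDiffOn_comp_symm x₀ f).fderiv_of_isOpen (isOpen_extChartAt_target x₀)
            (by simp)).clm_apply contDiffOn_const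
        refine h1.contMDiffOn.comp contMDiffOn_extChartAt fun y hy => ?_
        rw [← extChartAt_source (𝓡 d)] at hy
        exact (extChartAt (𝓡 d) x₀).map_source hy⟩
      map_add' := fun f g => by
        ext y
        by_cases hy : y ∈ (extChartAt (𝓡 d) x₀).source
        · have ht := (isOpen_extChartAt_target x₀).mem_nhds ((extChartAt (𝓡 d) x₀).map_source hy)
          have hf := ((contDiffOn_comp_symm x₀ f).contDiffAt ht).differentiableAt (by simp)
          have hg := ((contDiffOn_comp_symm x₀ g).contDiffAt ht).differentiableAt (by simp)
          have h := fderiv_add hf hg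
          change χ y * fderiv ℝ (f ∘ _ + g ∘ _) _ _ = χ y * _ + χ y * _
          rw [h, _root_.add_apply, mul_add]
        · have h0 : χ y = 0 := by
            by_contra h
            exact hy (by rw [extChartAt_source]; exact χ.support_subset_source h)
          change χ y * _ = χ y * _ + χ y * _
          simp [h0]
      map_smul' := fun r f => by
        ext y
        have h := congrFun (fderiv_const_smul_field (𝕜 := ℝ) (R := ℝ) r
          (f := f ∘ (extChartAt (𝓡 d) x₀).symm)) (extChartAt (𝓡 d) x₀ y)
        change χ y * fderiv ℝ (r • (f ∘ _)) _ _ = r * (χ y * _)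
        rw [h, Pi.smul_apply, _root_.smul_apply, smul_eq_mul]
        ring }
    (fun f g => by
      ext y
      by_cases hy : y ∈ (extChartAt (𝓡 d) x₀).source
      · have ht := (isOpen_extChartAt_target x₀).mem_nhds ((extChartAt (𝓡 d) x₀).map_source hy)
        have hf := ((contDiffOn_comp_symm x₀ f).contDiffAt ht).differentiableAt (by simp)
        have hg := ((contDiffOn_comp_symm x₀ g).contDiffAt ht).differentiableAt (by simp)
        have h := fderiv_mul hf hg
        change χ y * fderiv ℝ ((f ∘ _) * (g ∘ _)) _ _ = f y * (χ y * _) + g y * (χ y * _)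
        rw [h]
        simp only [_root_.add_apply, _root_.smul_apply, smul_eq_mul, Function.comp_apply,
          (extChartAt (𝓡 d) x₀).left_inv hy]
        ring
      · have h0 : χ y = 0 := by
          by_contra h
          exact hy (by rw [extChartAt_source]; exact χ.support_subset_source h)
        change χ y * _ = f y * (χ y * _) + g y * (χ y * _)
        simp [h0])

theorem coordinateField_apply {x₀ : M} (χ : SmoothBumpFunction (𝓡 d) x₀) (i : Fin d)
    (f : Fn d M) {y : M} (hy : y ∈ (extChartAt (𝓡 d) x₀).source)
    {u : EuclideanSpace ℝ (Fin d) → ℝ}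
    (hfu : ∀ᶠ z in 𝓝 y, f z = u (extChartAt (𝓡 d) x₀ z)) :
    coordinateField χ i f y =
      χ y * fderiv ℝ u (extChartAt (𝓡 d) x₀ y) (EuclideanSpace.single i 1) := by
  have ht : (extChartAt (𝓡 d) x₀).target ∈ 𝓝 (extChartAt (𝓡 d) x₀ y) :=
    (isOpen_extChartAt_target x₀).mem_nhds ((extChartAt (𝓡 d) x₀).map_source hy)
  have h1 : f ∘ (extChartAt (𝓡 d) x₀).symm =ᶠ[𝓝 (extChartAt (𝓡 d) x₀ y)] u := by
    have hc : Filter.Tendsto (extChartAt (𝓡 d) x₀).symm (𝓝 (extChartAt (𝓡 d) x₀ y)) (𝓝 y) := by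
      have h := continuousAt_extChartAt_symm' hy
      rwa [ContinuousAt, (extChartAt (𝓡 d) x₀).left_inv hy] at h
    filter_upwards [hc.eventually hfu, ht] with z hz hzt
    rw [Function.comp_apply, hz, (extChartAt (𝓡 d) x₀).right_inv hzt]
  change χ y * fderiv ℝ (f ∘ _) _ _ = _
  rw [h1.fderiv_eq]

/-- A local frame of vector fields and its dual coframe. -/
theorem exists_local_frame (x : M) :
    ∃ (χ : Fn d M) (e : Fin d → VectorField (Fn d M)) (θ : Fin d → OneForm (Fn d M)),
      (∀ᶠ y in 𝓝 x, χ y = 1) ∧ (∀ X, χ • X = ∑ i, θ i X • e i) ∧ ∀ i, θ i (e i) x = 1 := by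
  let ψ : SmoothBumpFunction (𝓡 d) x := Classical.arbitrary _
  -- Near every point of the support of `χ` the inner cut-off `ψ` is identically `1`, so the
  -- functions and fields cut off by `ψ` are there the true coordinates and coordinate fields.
  have hW : ∀ᶠ y in 𝓝 x, y ∈ (extChartAt (𝓡 d) x).source ∧ ∀ᶠ z in 𝓝 y, ψ z = 1 :=
    Filter.Eventually.and ((isOpen_extChartAt_source x).mem_nhds (mem_extChartAt_source x))
      (eventually_eventually_nhds.2 ψ.eventuallyEq_one)
  obtain ⟨χ, h1, hs, -⟩ := exists_bump (d := d) hW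
  let ξ : Fin d → Fn d M := fun i => ⟨fun y => ψ y • extChartAt (𝓡 d) x y i, by
    refine ψ.contMDiff_smul ?_
    have hp : ContDiff ℝ ∞ fun z : EuclideanSpace ℝ (Fin d) => z i := by fun_prop
    exact hp.contMDiff.comp_contMDiffOn contMDiffOn_extChartAt⟩
  have hξ : ∀ y, (∀ᶠ z in 𝓝 y, ψ z = 1) → ∀ i, ∀ᶠ z in 𝓝 y, ξ i z = extChartAt (𝓡 d) x z i := by
    intro y hy i
    filter_upwards [hy] with z hz
    change ψ z * _ = _
    rw [hz, one_mul]
  refine ⟨χ, fun i => χ • coordinateField ψ i, fun i => differential (ξ i), h1, fun X => ?_,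
    fun i => ?_⟩
  · ext f y
    rw [Derivation.smul_apply, ← Derivation.coeFnAddMonoidHom_apply (∑ i, _), map_sum,
      Finset.sum_apply, Fn.sum_apply]
    change χ y * X f y = ∑ i, X (ξ i) y * (χ y * coordinateField ψ i f y)
    by_cases hy : y ∈ tsupport χ
    · obtain ⟨hys, hyψ⟩ := hs hy
      obtain ⟨u, hu, hfu⟩ := exists_contDiff_eventuallyEq x hys f
      rw [derivation_apply_eq_sum X x hys ξ (hξ y hyψ) f hu hfu, Finset.mul_sum]
      refine Finset.sum_congr rfl fun i _ => ?_
      rw [coordinateField_apply ψ i f hys hfu, hyψ.self_of_nhds]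
      ring
    · simp [image_eq_zero_of_notMem_tsupport hy]
  · obtain ⟨hxs, hxψ⟩ := hW.self_of_nhds
    change χ x * coordinateField ψ i (ξ i) x = 1
    have hd : fderiv ℝ (fun z : EuclideanSpace ℝ (Fin d) => z i) (extChartAt (𝓡 d) x x)
        (EuclideanSpace.single i 1) = 1 := by
      let p : EuclideanSpace ℝ (Fin d) →L[ℝ] ℝ := EuclideanSpace.proj i
      rw [show (fun z : EuclideanSpace ℝ (Fin d) => z i) = p from rfl, p.fderiv]
      simp [p]
    rw [coordinateField_apply ψ i (ξ i) hxs (u := fun z => z i) (hξ x hxψ i), hd,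
      h1.self_of_nhds, hxψ.self_of_nhds]
    norm_num

/-! ### Division by a defining function -/

/-- The function `s` has nonzero differential at its zeros. -/
def IsDefining (s : Fn d M) : Prop := ∀ x, s x = 0 → ∃ X : VectorField (Fn d M), X s x ≠ 0

/-- At a zero of `s` the Leibniz rule gives `X (s * h) x = h x * X s x`, and some `X` has `X s x ≠
0`; elsewhere one divides by `s x`. -/
theorem IsDefining.eq_zero_of_mul_eventually {s : Fn d M} (hs : IsDefining s) {h : Fn d M} {x : M}
    (hh : ∀ᶠ y in 𝓝 x, s y * h y = 0) : h x = 0 := by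
  by_cases hx : s x = 0
  · obtain ⟨X, hX⟩ := hs x hx
    have h1 : X (s * h) x = X (0 : Fn d M) x := derivation_congr X hh
    rw [map_zero, Derivation.leibniz] at h1
    have h2 : s x * X h x + h x * X s x = 0 := h1
    rw [hx, zero_mul, zero_add] at h2
    exact (mul_eq_zero.1 h2).resolve_right hX
  · exact (mul_eq_zero.1 hh.self_of_nhds).resolve_left hx

theorem IsDefining.eq_zero_of_mul {s : Fn d M} (hs : IsDefining s) {h : Fn d M}
    (hh : s * h = 0) : h = 0 := by
  ext x
  exact hs.eq_zero_of_mul_eventually (Filter.Eventually.of_forall fun y =>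
    congrArg (fun f : Fn d M => f y) hh)

/-- Near a zero of `s` its coordinate form has nonzero differential, so division in Euclidean space
applies; near any other point `s` is invertible. -/
theorem IsDefining.exists_local_quotient {s : Fn d M} (hs : IsDefining s) (f : Fn d M)
    (hf : ∀ x, s x = 0 → f x = 0) (x : M) : ∃ h : Fn d M, ∀ᶠ y in 𝓝 x, f y = s y * h y := by
  by_cases hx : s x = 0
  · obtain ⟨X, hX⟩ := hs x hx
    have hxs := mem_extChartAt_source (I := 𝓡 d) x
    obtain ⟨u, hu, hsu⟩ := exists_contDiff_eventuallyEq x hxs s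
    obtain ⟨v, hv, hfv⟩ := exists_contDiff_eventuallyEq x hxs f
    have hu' : fderiv ℝ u (extChartAt (𝓡 d) x x) ≠ 0 := by
      intro h0
      choose ξ hξ using fun i : Fin d => exists_fn_comp_chart x hxs
        (u := fun z => z i) (by fun_prop)
      apply hX
      rw [derivation_apply_eq_sum X x hxs ξ hξ s hu hsu, h0]
      simp
    have hc : Filter.Tendsto (extChartAt (𝓡 d) x).symm (𝓝 (extChartAt (𝓡 d) x x)) (𝓝 x) := by
      have h := continuousAt_extChartAt_symm' hxs
      rwa [ContinuousAt, (extChartAt (𝓡 d) x).left_inv hxs] at h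
    obtain ⟨k, hk, huvk⟩ := exists_eventually_eq_mul hv hu hu' (by
      filter_upwards [hc.eventually hsu, hc.eventually hfv, extChartAt_target_mem_nhds x]
        with z h1 h2 h3 hz
      rw [(extChartAt (𝓡 d) x).right_inv h3] at h1 h2
      rw [← h2]
      exact hf _ (h1.trans hz))
    obtain ⟨h, hh⟩ := exists_fn_comp_chart x hxs hk
    refine ⟨h, ?_⟩
    filter_upwards [hsu, hfv, hh, (continuousAt_extChartAt x).eventually huvk] with y h1 h2 h3 h4
    rw [h1, h2, h3, h4]
  · have hU : ∀ᶠ y in 𝓝 x, s y ≠ 0 := s.contMDiff.continuous.continuousAt.eventually_ne hx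
    obtain ⟨χ, h1, hχ, hle⟩ := exists_bump (d := d) hU
    -- `s² + (1 - χ)` has no zeros: on the support of `χ` the first term is positive and `χ ≤ 1`,
    -- and off it the second term is `1`. Near `x` it equals `s²`, so `f * s * q` is `f / s` there.
    obtain ⟨q, hq⟩ := (isUnit_of_forall_ne_zero (s * s + (1 - χ)) (fun y => by
      change s y * s y + (1 - χ y) ≠ 0
      by_cases hy : y ∈ tsupport χ
      · have h2 : 0 < s y * s y := mul_self_pos.2 (hχ hy)
        have := hle y
        intro h; linarith
      · rw [image_eq_zero_of_notMem_tsupport hy]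
        nlinarith [mul_self_nonneg (s y)])).exists_right_inv
    refine ⟨f * s * q, ?_⟩
    filter_upwards [h1] with y hy
    have h2 : (s y * s y + (1 - χ y)) * q y = 1 := congrArg (fun f : Fn d M => f y) hq
    rw [hy, sub_self, add_zero] at h2
    change f y = s y * (f y * s y * q y)
    linear_combination -(f y) * h2

/-- A smooth function that vanishes on the zero locus of a defining function is divisible by it. -/
theorem IsDefining.exists_quotient {s : Fn d M} (hs : IsDefining s) (f : Fn d M)
    (hf : ∀ x, s x = 0 → f x = 0) : ∃ h : Fn d M, f = s * h := by
  choose h hh using hs.exists_local_quotient f hf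
  obtain ⟨H, hH⟩ := exists_fn_of_local h (fun x => by
    filter_upwards [eventually_eventually_nhds.2 (hh x)] with y hy
    -- Two local quotients agree where both are valid, since `s` annihilates their difference near
    -- the point.
    have h1 : (h x - h y) y = 0 := by
      refine hs.eq_zero_of_mul_eventually ?_
      filter_upwards [hy, hh y] with z h2 h3
      rw [Fn.sub_apply, mul_sub, ← h2, ← h3, sub_self]
    exact sub_eq_zero.1 h1)
  refine ⟨H, ?_⟩
  ext x
  rw [Fn.mul_apply, hH, (hh x).self_of_nhds]

end SmoothFunctions

/-! ## Metric traces -/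

section Trace

variable {d : ℕ} {M : Type*} [TopologicalSpace M] [ChartedSpace (EuclideanSpace ℝ (Fin d)) M]

/-- The bilinear map `(x, y) ↦ b(v, x) b(v', y) s`. -/
def rankOne {A V S : Type*} [CommRing A] [AddCommGroup V] [Module A V] [AddCommGroup S]
    [Module A S] (b : V →ₗ[A] V →ₗ[A] A) (v v' : V) (s : S) : V →ₗ[A] V →ₗ[A] S :=
  LinearMap.mk₂ A (fun x y => (b v x * b v' y) • s)
    (fun x x' y => by rw [map_add, add_mul, add_smul])
    (fun f x y => by rw [map_smul, smul_eq_mul, mul_assoc, mul_smul])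
    (fun x y y' => by rw [map_add, mul_add, add_smul])
    (fun f x y => by rw [map_smul, smul_eq_mul, mul_left_comm, mul_smul])

theorem rankOne_apply {A V S : Type*} [CommRing A] [AddCommGroup V] [Module A V] [AddCommGroup S]
    [Module A S] (b : V →ₗ[A] V →ₗ[A] A) (v v' : V) (s : S) (x y : V) :
    rankOne b v v' s x y = (b v x * b v' y) • s := rfl

/-- The metric trace of `S`-valued bilinear maps is given by the expected formulas. -/
class IsTraceForm {A V : Type*} [CommRing A] [AddCommGroup V] [Module A V]
    (b : V →ₗ[A] V →ₗ[A] A) (S : Type*) [AddCommGroup S] [Module A S] : Prop where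
  /-- The trace of `(x, y) ↦ b(v, x) b(v', y) s`. -/
  formTrace_rankOne : ∀ v v' (s : S), formTrace b (rankOne b v v' s) = b v v' • s
  /-- Linear maps that agree on bilinear maps of rank one are equal. -/
  ext_rankOne : ∀ u u' : (V →ₗ[A] V →ₗ[A] S) →ₗ[A] S,
    (∀ v v' s, u (rankOne b v v' s) = u' (rankOne b v v' s)) → u = u'
  /-- The trace of `(x, y) ↦ b(v, x) l(y)`. -/
  formTrace_left : ∀ (v : V) (l : V →ₗ[A] S) (B : V →ₗ[A] V →ₗ[A] S),
    (∀ x y, B x y = b v x • l y) → formTrace b B = l v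
  /-- The trace of `(x, y) ↦ b(v, y) l(x)`. -/
  formTrace_right : ∀ (v : V) (l : V →ₗ[A] S) (B : V →ₗ[A] V →ₗ[A] S),
    (∀ x y, B x y = b v y • l x) → formTrace b B = l v
  /-- The trace of `(x, y) ↦ B(x, y) s` for a bilinear form `B`. -/
  formTrace_compr : ∀ (B : V →ₗ[A] V →ₗ[A] A) (s : S),
    formTrace b (B.compr₂ (LinearMap.toSpanSingleton A S s)) = formTrace b B • s

/-- Vector fields over `A` have rank `d`. -/
class HasDimension (A : Type*) [CommRing A] [Algebra ℝ A] (d : ℕ) : Prop where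
  formTrace_form : ∀ g : PseudoRiemMetric A, formTrace g.form g.form = algebraMap ℝ A d

/-- The trace commutes with linear maps. -/
theorem map_formTrace {A V S : Type*} [CommRing A] [AddCommGroup V] [Module A V] [AddCommGroup S]
    [Module A S] (b : V →ₗ[A] V →ₗ[A] A) [IsTraceForm b S] (L : S →ₗ[A] S)
    (B : V →ₗ[A] V →ₗ[A] S) : L (formTrace b B) = formTrace b (B.compr₂ L) := by
  have h : L ∘ₗ formTrace b = formTrace b ∘ₗ
      ({ toFun := fun B => B.compr₂ L
         map_add' := fun B C => LinearMap.ext fun x => LinearMap.ext fun y => by simp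
         map_smul' := fun f B => LinearMap.ext fun x => LinearMap.ext fun y => by simp } :
        (V →ₗ[A] V →ₗ[A] S) →ₗ[A] (V →ₗ[A] V →ₗ[A] S)) := by
    refine IsTraceForm.ext_rankOne (b := b) _ _ fun v v' s => ?_
    rw [LinearMap.comp_apply, LinearMap.comp_apply, IsTraceForm.formTrace_rankOne, map_smul,
      ← IsTraceForm.formTrace_rankOne (b := b)]
    congr 1
    refine LinearMap.ext fun x => LinearMap.ext fun y => ?_
    simp [rankOne_apply]
  exact congrArg (fun u => u B) h

variable (d M) in
/-- A module of functions whose elements are determined locally and can be glued. -/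
class IsLocalModule (S : Type*) [AddCommGroup S] [Module (Fn d M) S] : Prop where
  eq_zero : ∀ s : S, (∀ x, ∃ χ : Fn d M, χ x = 1 ∧ χ • s = 0) → s = 0
  glue : ∀ h : M → S, (∀ x, ∀ᶠ y in 𝓝 x, ∃ χ : Fn d M, χ y = 1 ∧ χ • (h x - h y) = 0) →
    ∃ H : S, ∀ x, ∃ χ : Fn d M, χ x = 1 ∧ χ • (H - h x) = 0

theorem IsLocalModule.ext {S : Type*} [AddCommGroup S] [Module (Fn d M) S] [IsLocalModule d M S]
    {s t : S} (h : ∀ x, ∃ χ : Fn d M, χ x = 1 ∧ χ • s = χ • t) : s = t := by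
  refine sub_eq_zero.1 (IsLocalModule.eq_zero (d := d) (M := M) _ fun x => ?_)
  obtain ⟨χ, h1, h2⟩ := h x
  exact ⟨χ, h1, by rw [smul_sub, h2, sub_self]⟩

variable (d M) in
/-- A module with local frames. -/
class LocallyFramed (V : Type*) [AddCommGroup V] [Module (Fn d M) V] : Prop where
  exists_frame : ∀ x : M, ∃ (m : ℕ) (χ : Fn d M) (e : Fin m → V) (θ : Fin m → V →ₗ[Fn d M] Fn d M),
    (∀ᶠ y in 𝓝 x, χ y = 1) ∧ ∀ v, χ • v = ∑ i, θ i v • e i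

variable [T2Space M] [IsManifold (𝓡 d) ∞ M]

/-- For absorbing a factor `f` that is `1` only near `x`: after multiplication by `χ` the factor
disappears. -/
theorem exists_mul_eq_self {x : M} {f : Fn d M} (hf : ∀ᶠ y in 𝓝 x, f y = 1) :
    ∃ χ : Fn d M, χ x = 1 ∧ χ * f = χ := by
  obtain ⟨χ, h1, hs, -⟩ := exists_bump (d := d) hf
  refine ⟨χ, h1.self_of_nhds, ?_⟩
  ext y
  rw [Fn.mul_apply]
  by_cases hy : y ∈ tsupport χ
  · rw [show f y = 1 from hs hy, mul_one]
  · rw [image_eq_zero_of_notMem_tsupport hy, zero_mul]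

instance : IsLocalModule d M (Fn d M) where
  eq_zero s h := by
    ext x
    obtain ⟨χ, h1, h2⟩ := h x
    have h3 : χ x * s x = 0 := congrArg (fun f : Fn d M => f x) h2
    rwa [h1, one_mul] at h3
  glue h hh := by
    have key : ∀ x, ∀ᶠ y in 𝓝 x, h x y = h y y := fun x => (hh x).mono fun y hy => by
      obtain ⟨χ, h1, h2⟩ := hy
      have h3 : χ y * (h x y - h y y) = 0 := congrArg (fun f : Fn d M => f y) h2
      rw [h1, one_mul] at h3
      exact sub_eq_zero.1 h3
    obtain ⟨H, hH⟩ := exists_fn_of_local h key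
    refine ⟨H, fun x => ?_⟩
    obtain ⟨χ, h1, hs, -⟩ := exists_bump (d := d) (key x)
    refine ⟨χ, h1.self_of_nhds, ?_⟩
    ext y
    change χ y * (H y - h x y) = 0
    by_cases hy : y ∈ tsupport χ
    · rw [hH, show h x y = h y y from hs hy, sub_self, mul_zero]
    · rw [image_eq_zero_of_notMem_tsupport hy, zero_mul]

instance {r : ℕ} {W : Type*} [AddCommGroup W] [Module (Fn d M) W] :
    IsLocalModule d M (MultilinearMap (Fn d M) (fun _ : Fin r => W) (Fn d M)) where
  eq_zero s h := by
    refine MultilinearMap.ext fun T => IsLocalModule.eq_zero (d := d) (M := M) _ fun x => ?_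
    obtain ⟨χ, h1, h2⟩ := h x
    exact ⟨χ, h1, congrArg (fun f => f T) h2⟩
  glue h hh := by
    -- The values are glued separately for each argument `T`. Multilinearity is then checked
    -- pointwise, where the glued tensor has the value of `h x`.
    choose H hH using fun T => IsLocalModule.glue (d := d) (M := M) (fun x => h x T) (fun x =>
      (hh x).mono fun y hy => by
        obtain ⟨χ, h1, h2⟩ := hy
        exact ⟨χ, h1, congrArg (fun f => f T) h2⟩)
    have hval : ∀ T x, H T x = h x T x := fun T x => by
      obtain ⟨χ, h1, h2⟩ := hH T x
      have h3 : χ x * (H T x - h x T x) = 0 := congrArg (fun f : Fn d M => f x) h2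
      rw [h1, one_mul] at h3
      exact sub_eq_zero.1 h3
    refine ⟨MultilinearMap.mk' H (fun T i a b => ?_) (fun T i f a => ?_), fun x => ?_⟩
    · ext x
      rw [Fn.add_apply, hval, hval, hval, MultilinearMap.map_update_add]
      rfl
    · ext x
      change H _ x = f x * H _ x
      rw [hval, hval, MultilinearMap.map_update_smul]
      rfl
    · obtain ⟨χ, h1, hs, -⟩ := exists_bump (d := d) (hh x)
      refine ⟨χ, h1.self_of_nhds, MultilinearMap.ext fun T => ?_⟩
      ext y
      change χ y * (H T y - h x T y) = 0
      by_cases hy : y ∈ tsupport χ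
      · obtain ⟨ψ, h2, h3⟩ := hs hy
        have h4 : ψ y * (h x T y - h y T y) = 0 := congrArg (fun f => f T y) h3
        rw [h2, one_mul] at h4
        rw [hval, sub_eq_zero.1 h4, sub_self, mul_zero]
      · rw [image_eq_zero_of_notMem_tsupport hy, zero_mul]

section Form

variable {V S S' : Type*} [AddCommGroup V] [Module (Fn d M) V] [AddCommGroup S] [Module (Fn d M) S]
  [AddCommGroup S'] [Module (Fn d M) S'] {b : V →ₗ[Fn d M] V →ₗ[Fn d M] Fn d M}

/-- For maps obtained by gluing: each value is known only after multiplication by its own cut-off,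
and the product of the cut-offs makes the values comparable. -/
theorem smul_add_of_cutoff {A N : Type*} [CommRing A] [AddCommGroup N] [Module A N]
    {a b c : A} {s s' t t' u : N} (h : a • s = a • s') (h' : b • t = b • t')
    (h'' : c • u = c • (s' + t')) : (a * b * c) • u = (a * b * c) • (s + t) := by
  have q1 : (a * b * c) • u = (a * b) • c • u := mul_smul _ _ _
  have q2 : (a * b * c) • s = (b * c) • a • s := by rw [smul_smul]; congr 1; ring
  have q3 : (a * b * c) • t = (a * c) • b • t := by rw [smul_smul]; congr 1; ring
  rw [smul_add, q1, q2, q3, h, h', h'']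
  module

theorem smul_smul_of_cutoff {A N : Type*} [CommRing A] [AddCommGroup N] [Module A N]
    {a b f : A} {s s' u : N} (h : a • s = a • s') (h' : b • u = b • (f • s')) :
    (a * b) • u = (a * b) • (f • s) := by
  have q1 : (a * b) • u = a • b • u := mul_smul _ _ _
  have q2 : (a * b) • f • s = (b * f) • a • s := by rw [smul_smul, smul_smul]; congr 1; ring
  rw [q1, q2, h, h']
  module

/-- The trace computed in a frame `e` whose coframe is `b(v i, ·)`. -/
def frameTrace (b : V →ₗ[Fn d M] V →ₗ[Fn d M] Fn d M) {m : ℕ} (e v : Fin m → V) :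
    (V →ₗ[Fn d M] V →ₗ[Fn d M] S) →ₗ[Fn d M] S where
  toFun B := ∑ i, ∑ j, b (v i) (v j) • B (e i) (e j)
  map_add' B C := by simp only [LinearMap.add_apply, smul_add, Finset.sum_add_distrib]
  map_smul' f B := by
    simp only [LinearMap.smul_apply, Finset.smul_sum, RingHom.id_apply]
    exact Finset.sum_congr rfl fun i _ => Finset.sum_congr rfl fun j _ => smul_comm _ _ _

/-- The frame relation is contracted once in each slot, and each contraction replaces a sum over the
frame by one factor `χ`. -/
theorem frameTrace_rankOne (hs : ∀ x y, b x y = b y x) {m : ℕ} {e v : Fin m → V} {χ : Fn d M}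
    (h : ∀ x, χ • x = ∑ i, b (v i) x • e i) (a a' : V) (s : S) :
    frameTrace b e v (rankOne b a a' s) = (χ * χ * b a a') • s := by
  have h1 : ∀ x y, ∑ i, b (v i) x * b y (e i) = χ * b y x := fun x y => by
    rw [← smul_eq_mul, ← map_smul, h x, map_sum]
    simp only [map_smul, smul_eq_mul]
  have h2 : frameTrace b e v (rankOne b a a' s) =
      (∑ i, ∑ j, b (v i) (v j) * (b a (e i) * b a' (e j))) • s := by
    simp only [frameTrace, LinearMap.coe_mk, AddHom.coe_mk, Finset.sum_smul, rankOne_apply,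
      smul_smul]
  have h3 : ∀ j, ∑ i, b (v i) (v j) * (b a (e i) * b a' (e j)) = χ * (b (v j) a * b a' (e j)) := by
    intro j
    simp only [← mul_assoc]
    rw [← Finset.sum_mul, h1, hs a]
  rw [h2, Finset.sum_comm]
  simp only [h3]
  rw [← Finset.mul_sum, h1, hs a', mul_assoc]

/-- A bilinear map is locally a sum of bilinear maps of rank one. -/
theorem smul_eq_sum_rankOne {m : ℕ} {e v : Fin m → V} {χ : Fn d M}
    (h : ∀ x, χ • x = ∑ i, b (v i) x • e i) (B : V →ₗ[Fn d M] V →ₗ[Fn d M] S) :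
    (χ * χ) • B = ∑ i, ∑ j, rankOne b (v i) (v j) (B (e i) (e j)) := by
  refine LinearMap.ext fun x => LinearMap.ext fun y => ?_
  have h1 : ((χ * χ) • B) x y = B (χ • x) (χ • y) := by
    rw [map_smul, map_smul, LinearMap.smul_apply, LinearMap.smul_apply, LinearMap.smul_apply,
      smul_smul]
  rw [h1, h x, h y]
  simp only [map_sum, LinearMap.sum_apply, map_smul, LinearMap.smul_apply, rankOne_apply]
  simp only [Finset.smul_sum]
  rw [Finset.sum_comm]
  exact Finset.sum_congr rfl fun i _ => Finset.sum_congr rfl fun j _ => by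
    rw [smul_smul, mul_comm]

variable [LocallyFramed d M V]

theorem exists_frame_form (hb : Function.Surjective b) (x : M) :
    ∃ (m : ℕ) (χ : Fn d M) (e v : Fin m → V),
      (∀ᶠ y in 𝓝 x, χ y = 1) ∧ ∀ y, χ • y = ∑ i, b (v i) y • e i := by
  obtain ⟨m, χ, e, θ, h1, h2⟩ := LocallyFramed.exists_frame (d := d) (V := V) x
  choose v hv using fun i => hb (θ i)
  exact ⟨m, χ, e, v, h1, fun y => by rw [h2]; simp only [hv]⟩

/-- Linear maps that agree on bilinear maps of rank one are equal. -/
theorem ext_rankOne (hb : Function.Surjective b) [IsLocalModule d M S']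
    {u u' : (V →ₗ[Fn d M] V →ₗ[Fn d M] S) →ₗ[Fn d M] S'}
    (h : ∀ v v' s, u (rankOne b v v' s) = u' (rankOne b v v' s)) : u = u' := by
  refine LinearMap.ext fun B => IsLocalModule.ext (d := d) (M := M) fun x => ?_
  obtain ⟨m, χ, e, v, h1, h2⟩ := exists_frame_form hb x
  refine ⟨χ * χ, by rw [Fn.mul_apply, h1.self_of_nhds, one_mul], ?_⟩
  rw [← map_smul, ← map_smul, smul_eq_sum_rankOne h2]
  simp only [map_sum, h]

/-- The trace is glued from the frame traces around the points of `M`. Two of these agree where both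
cut-offs are `1`, and the rank-one formula is inherited from `frameTrace_rankOne`. -/
theorem exists_trace (hs : ∀ x y, b x y = b y x) (hb : Function.Surjective b)
    [IsLocalModule d M S] :
    ∃ t : (V →ₗ[Fn d M] V →ₗ[Fn d M] S) →ₗ[Fn d M] S,
      ∀ v v' s, t (rankOne b v v' s) = b v v' • s := by
  choose m χ e v h1 h2 using exists_frame_form (d := d) (M := M) hb
  -- Apply the frame trace at `x` to the rank-one expansion of `(χ y)² B` in the frame at `y`: each
  -- rank-one map contributes `(χ x)²` times its trace.
  have key : ∀ x y (B : V →ₗ[Fn d M] V →ₗ[Fn d M] S),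
      (χ y * χ y) • frameTrace b (e x) (v x) B = (χ x * χ x) • frameTrace b (e y) (v y) B := by
    intro x y B
    rw [← map_smul, smul_eq_sum_rankOne (h2 y)]
    simp only [map_sum, frameTrace_rankOne hs (h2 x)]
    simp only [frameTrace, LinearMap.coe_mk, AddHom.coe_mk, Finset.smul_sum, smul_smul]
  have cut : ∀ x, ∃ ψ : Fn d M, ψ x = 1 ∧ ψ * (χ x * χ x) = ψ := fun x =>
    exists_mul_eq_self ((h1 x).mono fun y hy => by rw [Fn.mul_apply, hy, one_mul])
  choose t ht using fun B : V →ₗ[Fn d M] V →ₗ[Fn d M] S =>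
    IsLocalModule.glue (d := d) (M := M) (fun x => frameTrace b (e x) (v x) B) (fun x => by
      filter_upwards [eventually_eventually_nhds.2 (h1 x)] with y hy
      obtain ⟨ψ, h3, h4⟩ := cut y
      obtain ⟨ψ', h5, h6⟩ := exists_mul_eq_self (f := χ x * χ x)
        (hy.mono fun y hy => by rw [Fn.mul_apply, hy, one_mul])
      refine ⟨ψ * ψ', by rw [Fn.mul_apply, h3, h5, one_mul], ?_⟩
      rw [smul_sub, sub_eq_zero]
      calc (ψ * ψ') • frameTrace b (e x) (v x) B
          = (ψ * ψ') • (χ y * χ y) • frameTrace b (e x) (v x) B := by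
            rw [smul_smul]; congr 1; linear_combination -ψ' * h4
        _ = (ψ * ψ') • frameTrace b (e y) (v y) B := by
            rw [key, smul_smul]; congr 1; linear_combination ψ * h6)
  simp only [smul_sub, sub_eq_zero] at ht
  refine ⟨⟨⟨t, fun B C => ?_⟩, fun f B => ?_⟩, fun a a' s => ?_⟩
  · refine IsLocalModule.ext (d := d) (M := M) fun x => ?_
    obtain ⟨ψ, p1, p2⟩ := ht B x
    obtain ⟨ψ', p3, p4⟩ := ht C x
    obtain ⟨ψ'', p5, p6⟩ := ht (B + C) x
    refine ⟨ψ * ψ' * ψ'', by simp only [Fn.mul_apply, p1, p3, p5, one_mul], ?_⟩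
    exact smul_add_of_cutoff p2 p4 (p6.trans (by rw [map_add]))
  · change t (f • B) = f • t B
    refine IsLocalModule.ext (d := d) (M := M) fun x => ?_
    obtain ⟨ψ, p1, p2⟩ := ht B x
    obtain ⟨ψ', p3, p4⟩ := ht (f • B) x
    refine ⟨ψ * ψ', by simp only [Fn.mul_apply, p1, p3, one_mul], ?_⟩
    exact smul_smul_of_cutoff p2 (p4.trans (by rw [map_smul]))
  · change t (rankOne b a a' s) = b a a' • s
    refine IsLocalModule.ext (d := d) (M := M) fun x => ?_
    obtain ⟨ψ, p1, p2⟩ := ht (rankOne b a a' s) x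
    obtain ⟨ψ', p3, p4⟩ := cut x
    refine ⟨ψ * ψ', by simp only [Fn.mul_apply, p1, p3, one_mul], ?_⟩
    have h3 : (ψ * ψ') • t (rankOne b a a' s) = ψ' • ψ • t (rankOne b a a' s) := by
      rw [smul_smul, mul_comm]
    have h4 : ψ' * ψ * (χ x * χ x * b a a') = ψ * ψ' * b a a' := by
      linear_combination (ψ * b a a') * p4
    rw [h3, p2, frameTrace_rankOne hs (h2 x), smul_smul, smul_smul, h4, smul_smul]

/-- `formTrace` is a choice among the linear maps obeying the rank-one formula, so it obeys the
formula as soon as `exists_trace` provides one such map. -/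
theorem formTrace_rankOne (hs : ∀ x y, b x y = b y x) (hb : Function.Surjective b)
    [IsLocalModule d M S] (v v' : V) (s : S) : formTrace b (rankOne b v v' s) = b v v' • s := by
  obtain ⟨t, ht⟩ := exists_trace (S := S) hs hb
  have h := Classical.epsilon_spec (p := fun t : (V →ₗ[Fn d M] V →ₗ[Fn d M] S) →ₗ[Fn d M] S =>
    ∀ (v v' : V) (s : S) (B : V →ₗ[Fn d M] V →ₗ[Fn d M] S),
      (∀ x y, B x y = (b v x * b v' y) • s) → t B = b v v' • s)
    ⟨t, fun v v' s B hB => by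
      rw [← ht]
      congr 1
      exact LinearMap.ext fun x => LinearMap.ext fun y => hB x y⟩
  exact h v v' s _ fun x y => rfl

/-- The trace of `(x, y) ↦ b(v, x) l(y)`. -/
theorem formTrace_left (hs : ∀ x y, b x y = b y x) (hb : Function.Surjective b)
    [IsLocalModule d M S] (v : V) (l : V →ₗ[Fn d M] S) (B : V →ₗ[Fn d M] V →ₗ[Fn d M] S)
    (h : ∀ x y, B x y = b v x • l y) : formTrace b B = l v := by
  refine IsLocalModule.ext (d := d) (M := M) fun x => ?_
  obtain ⟨m, χ, e, a, h1, h2⟩ := exists_frame_form hb x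
  refine ⟨χ, h1.self_of_nhds, ?_⟩
  have h3 : χ • B = ∑ i, rankOne b v (a i) (l (e i)) := by
    refine LinearMap.ext fun x => LinearMap.ext fun y => ?_
    rw [LinearMap.smul_apply, LinearMap.smul_apply, ← map_smul, h, h2 y]
    simp only [LinearMap.sum_apply, rankOne_apply, map_sum, map_smul, Finset.smul_sum, smul_smul]
  rw [← map_smul, h3, map_sum, ← map_smul, h2 v, map_sum]
  exact Finset.sum_congr rfl fun i _ => by rw [formTrace_rankOne hs hb, map_smul, hs]

/-- The trace of `(x, y) ↦ b(v, y) l(x)`. -/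
theorem formTrace_right (hs : ∀ x y, b x y = b y x) (hb : Function.Surjective b)
    [IsLocalModule d M S] (v : V) (l : V →ₗ[Fn d M] S) (B : V →ₗ[Fn d M] V →ₗ[Fn d M] S)
    (h : ∀ x y, B x y = b v y • l x) : formTrace b B = l v := by
  refine IsLocalModule.ext (d := d) (M := M) fun x => ?_
  obtain ⟨m, χ, e, a, h1, h2⟩ := exists_frame_form hb x
  refine ⟨χ, h1.self_of_nhds, ?_⟩
  have h3 : χ • B = ∑ i, rankOne b (a i) v (l (e i)) := by
    refine LinearMap.ext fun x => LinearMap.ext fun y => ?_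
    have : (χ • B) x y = B (χ • x) y := by simp
    rw [this, h, h2 x]
    simp only [LinearMap.sum_apply, rankOne_apply, map_sum, map_smul, Finset.smul_sum, smul_smul]
    exact Finset.sum_congr rfl fun i _ => by rw [mul_comm]
  rw [← map_smul, h3, map_sum, ← map_smul, h2 v, map_sum]
  exact Finset.sum_congr rfl fun i _ => by rw [formTrace_rankOne hs hb, map_smul]

/-- The trace of `(x, y) ↦ B(x, y) s` for a bilinear form `B`. -/
theorem formTrace_compr (hs : ∀ x y, b x y = b y x) (hb : Function.Surjective b)
    [IsLocalModule d M S] (B : V →ₗ[Fn d M] V →ₗ[Fn d M] Fn d M) (s : S) :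
    formTrace b (B.compr₂ (LinearMap.toSpanSingleton (Fn d M) S s)) = formTrace b B • s := by
  let c : (V →ₗ[Fn d M] V →ₗ[Fn d M] Fn d M) →ₗ[Fn d M] (V →ₗ[Fn d M] V →ₗ[Fn d M] S) :=
    { toFun := fun B => B.compr₂ (LinearMap.toSpanSingleton (Fn d M) S s)
      map_add' := fun B C => LinearMap.ext fun x => LinearMap.ext fun y => add_smul _ _ s
      map_smul' := fun f B => LinearMap.ext fun x => LinearMap.ext fun y => mul_smul _ _ s }
  have h : formTrace b ∘ₗ c = LinearMap.toSpanSingleton (Fn d M) S s ∘ₗ formTrace b := by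
    refine ext_rankOne hb fun v v' f => ?_
    have h1 : c (rankOne b v v' f) = rankOne b v v' (f • s) := by
      refine LinearMap.ext fun x => LinearMap.ext fun y => ?_
      change ((b v x * b v' y) * f) • s = _
      rw [rankOne_apply, smul_smul]
    rw [LinearMap.comp_apply, h1, formTrace_rankOne hs hb, LinearMap.comp_apply,
      formTrace_rankOne hs hb, LinearMap.toSpanSingleton_apply, smul_smul, smul_eq_mul]
  exact congrArg (fun u => u B) h

theorem isTraceForm (hs : ∀ x y, b x y = b y x) (hb : Function.Surjective b)
    [IsLocalModule d M S] : IsTraceForm b S where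
  formTrace_rankOne := formTrace_rankOne hs hb
  ext_rankOne _ _ h := ext_rankOne hb h
  formTrace_left := formTrace_left hs hb
  formTrace_right := formTrace_right hs hb
  formTrace_compr := formTrace_compr hs hb

end Form

/-! ### Traces over vector fields -/

instance : LocallyFramed d M (VectorField (Fn d M)) where
  exists_frame x := by
    obtain ⟨χ, e, θ, h1, h2, -⟩ := exists_local_frame (d := d) x
    exact ⟨d, χ, e, θ, h1, h2⟩

instance : LocallyFramed d M (TractorField (Fn d M)) where
  exists_frame x := by
    obtain ⟨χ, e, θ, h1, h2, -⟩ := exists_local_frame (d := d) x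
    -- The local coframe is completed by one section for each outer slot, whence `d + 2`. The middle
    -- coefficients `μ (e i)` need no further cut-off because `χ μ = ∑ i, μ (e i) θ i`.
    let E : Fin (d + 2) → TractorField (Fn d M) :=
      Fin.cons (1, 0, 0) (Fin.cons (0, 0, 1) fun i => (0, θ i, 0))
    let c : Fin (d + 2) → TractorField (Fn d M) →ₗ[Fn d M] Fn d M :=
      Fin.cons (χ • LinearMap.fst _ _ _)
        (Fin.cons (χ • (LinearMap.snd _ _ _ ∘ₗ LinearMap.snd _ _ _)) fun i =>
          LinearMap.applyₗ (e i) ∘ₗ LinearMap.fst _ _ _ ∘ₗ LinearMap.snd _ _ _)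
    refine ⟨d + 2, χ, E, c, h1, fun T => ?_⟩
    have h3 : χ • T.2.1 = ∑ i, T.2.1 (e i) • θ i := by
      refine LinearMap.ext fun X => ?_
      rw [LinearMap.smul_apply, ← map_smul, h2 X, map_sum, LinearMap.sum_apply]
      exact Finset.sum_congr rfl fun i _ => by
        rw [map_smul, LinearMap.smul_apply, smul_eq_mul, smul_eq_mul, mul_comm]
    have h4 : ∑ i, c i T • E i = (χ * T.1) • (1, 0, 0) + ((χ * T.2.2) • (0, 0, 1) +
        ∑ i, T.2.1 (e i) • ((0, θ i, 0) : TractorField (Fn d M))) := by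
      rw [Fin.sum_univ_succ, Fin.sum_univ_succ]
      rfl
    have h5 : ∑ i, T.2.1 (e i) • ((0, θ i, 0) : TractorField (Fn d M)) = (0, χ • T.2.1, 0) := by
      rw [h3]
      refine Prod.ext ?_ (Prod.ext ?_ ?_) <;> simp [Prod.fst_sum, Prod.snd_sum]
    rw [h4, h5]
    refine Prod.ext ?_ (Prod.ext ?_ ?_) <;> simp

instance (g : PseudoRiemMetric (Fn d M)) {S : Type*} [AddCommGroup S] [Module (Fn d M) S]
    [IsLocalModule d M S] : IsTraceForm g.form S :=
  isTraceForm g.symm g.perfect.2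

namespace PseudoRiemMetric

variable (g : PseudoRiemMetric (Fn d M))

/-- In a local frame `χ g = ∑ θ i ⊗ g (e i, ·)` is a sum of `d` rank-one forms; its trace is `∑ θ i
(e i)`, and each term equals `1` at `x`. -/
theorem formTrace_form : formTrace g.form g.form = algebraMap ℝ (Fn d M) d := by
  ext x
  obtain ⟨χ, e, θ, h1, h2, h3⟩ := exists_local_frame (d := d) x
  have h4 : χ • g.form = ∑ i, rankOne g.form (g.sharp (θ i)) (e i) (1 : Fn d M) := by
    refine LinearMap.ext fun X => LinearMap.ext fun Y => ?_
    rw [LinearMap.smul_apply, ← map_smul, h2 X, map_sum]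
    simp only [LinearMap.sum_apply, rankOne_apply, map_smul, LinearMap.smul_apply, smul_eq_mul,
      mul_one]
    refine Finset.sum_congr rfl fun i _ => ?_
    congr 1
    exact (congrArg (fun f : OneForm _ => f X) (g.flat.apply_symm_apply (θ i))).symm
  have h5 : χ * formTrace g.form g.form = ∑ i, θ i (e i) := by
    rw [← smul_eq_mul, ← map_smul, h4, map_sum]
    refine Finset.sum_congr rfl fun i _ => ?_
    rw [formTrace_rankOne g.symm g.perfect.2, smul_eq_mul, mul_one]
    exact congrArg (fun f : OneForm _ => f (e i)) (g.flat.apply_symm_apply (θ i))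
  have h6 := congrArg (fun f : Fn d M => f x) h5
  simp only [Fn.mul_apply, Fn.sum_apply, h1.self_of_nhds, h3, one_mul] at h6
  rw [h6, Fn.algebraMap_apply]
  simp

end PseudoRiemMetric

instance : HasDimension (Fn d M) d := ⟨fun g => g.formTrace_form⟩

end Trace

/-! ## Conformal change of the metric -/

theorem formTrace_sub {A V S : Type*} [CommRing A] [AddCommGroup V] [Module A V] [AddCommGroup S]
    [Module A S] (b : V →ₗ[A] V →ₗ[A] A) (B C : V →ₗ[A] V →ₗ[A] S) :
    formTrace b (B - C) = formTrace b B - formTrace b C :=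
  LinearMap.map_sub _ _ _

/-! ### The Levi-Civita connection and the curvature under a conformal change. -/

section LeviCivita

variable {A : Type*} [CommRing A] [Algebra ℝ A]

theorem two_mul_half : (2 : A) * algebraMap ℝ A (1 / 2) = 1 := by
  rw [← map_ofNat (algebraMap ℝ A), ← map_mul]; norm_num

theorem Connection.sub_right {S : Type*} [AddCommGroup S] [Module A S]
    (D : Connection (A := A) S) (X : VectorField A) (s t : S) :
    D.cov X (s - t) = D.cov X s - D.cov X t := by
  have h := D.add_right X (s - t) t
  rw [sub_add_cancel] at h
  rw [h, add_sub_cancel_right]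

namespace PseudoRiemMetric

variable (g : PseudoRiemMetric A)

theorem form_sharp (α : OneForm A) (X : VectorField A) : g.form (g.sharp α) X = α X :=
  congrArg (fun f : OneForm A => f X) (g.flat.apply_symm_apply α)

theorem form_sharp_right (α : OneForm A) (X : VectorField A) : g.form X (g.sharp α) = α X := by
  rw [g.symm, form_sharp]

theorem inv_apply (α β : OneForm A) : g.inv α β = α (g.sharp β) := g.form_sharp α _

theorem inv_comm (α β : OneForm A) : g.inv α β = g.inv β α := g.symm _ _

theorem ext_form {X Y : VectorField A} (h : ∀ Z, g.form X Z = g.form Y Z) : X = Y :=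
  g.perfect.1 (LinearMap.ext h)

theorem form_leviCivita (X Y Z : VectorField A) :
    g.form (g.leviCivita.cov X Y) Z = algebraMap ℝ A (1 / 2) * g.koszul X Y Z := by
  change g.form (algebraMap ℝ A (1 / 2) • g.sharp (g.koszul X Y)) Z = _
  rw [map_smul, LinearMap.smul_apply, form_sharp, smul_eq_mul]

theorem koszul_apply (X Y Z : VectorField A) :
    g.koszul X Y Z = X (g.form Y Z) + Y (g.form X Z) - Z (g.form X Y)
      + g.form ⁅X, Y⁆ Z - g.form ⁅X, Z⁆ Y - g.form ⁅Y, Z⁆ X := rfl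

theorem leviCivita_torsion (X Y : VectorField A) :
    g.leviCivita.cov X Y = g.leviCivita.cov Y X + ⁅X, Y⁆ := by
  refine g.ext_form fun Z => ?_
  rw [map_add, LinearMap.add_apply, form_leviCivita, form_leviCivita, koszul_apply, koszul_apply,
    ← lie_skew X Y, map_neg, LinearMap.neg_apply, g.symm Y X]
  linear_combination (-g.form ⁅Y, X⁆ Z) * two_mul_half (A := A)

theorem leviCivita_metric (X Y Z : VectorField A) :
    X (g.form Y Z) = g.form (g.leviCivita.cov X Y) Z + g.form Y (g.leviCivita.cov X Z) := by
  rw [g.symm Y (g.leviCivita.cov X Z), form_leviCivita, form_leviCivita, koszul_apply,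
    koszul_apply, ← lie_skew Y Z, map_neg, LinearMap.neg_apply, g.symm Z Y]
  linear_combination (-X (g.form Y Z)) * two_mul_half (A := A)

/-- The gradient of a function. -/
def grad (f : A) : VectorField A := g.sharp (differential f)

theorem form_grad (f : A) (X : VectorField A) : g.form (g.grad f) X = X f := g.form_sharp _ X

theorem form_grad_right (f : A) (X : VectorField A) : g.form X (g.grad f) = X f :=
  g.form_sharp_right _ X

/-- The Hessian of a function. -/
abbrev hess (f : A) : VectorField A →ₗ[A] VectorField A →ₗ[A] A := g.hessian trivialConnection f

theorem hess_apply (f : A) (X Y : VectorField A) :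
    g.hess f X Y = X (Y f) - g.leviCivita.cov X Y f := rfl

theorem hess_eq_form (f : A) (X Y : VectorField A) :
    g.hess f X Y = g.form (g.leviCivita.cov X (g.grad f)) Y := by
  have h := g.leviCivita_metric X (g.grad f) Y
  rw [form_grad, form_grad] at h
  rw [hess_apply, h]
  ring

end PseudoRiemMetric

/-- `g' = Ω² g` with `Ω = exp Υ` and `Ω' = exp (-Υ)`. -/
structure IsConformalChange (g g' : PseudoRiemMetric A) (Υ Ω Ω' : A) : Prop where
  form : ∀ X Y, g'.form X Y = Ω * Ω * g.form X Y
  mul_inv : Ω * Ω' = 1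
  deriv : ∀ X : VectorField A, X Ω = Ω * X Υ
  deriv_inv : ∀ X : VectorField A, X Ω' = -(Ω' * X Υ)

namespace IsConformalChange

open PseudoRiemMetric

variable {g g' : PseudoRiemMetric A} {Υ Ω Ω' : A}

theorem sharp (H : IsConformalChange g g' Υ Ω Ω')
    (α : OneForm A) : g'.sharp α = (Ω' * Ω') • g.sharp α := by
  refine g'.ext_form fun Z => ?_
  rw [form_sharp, H.form, map_smul, LinearMap.smul_apply, form_sharp, smul_eq_mul]
  linear_combination (-α Z) * (Ω * Ω' + 1) * H.mul_inv

/-- In the Koszul formula the bracket terms merely scale; the correction comes from the derivatives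
`X (Ω²) = 2 Ω² X Υ`. -/
theorem leviCivita (H : IsConformalChange g g' Υ Ω Ω')
    (X Y : VectorField A) : g'.leviCivita.cov X Y =
    g.leviCivita.cov X Y + X Υ • Y + Y Υ • X - g.form X Y • g.grad Υ := by
  refine g'.ext_form fun Z => ?_
  rw [form_leviCivita, koszul_apply, H.form (_ - _)]
  simp only [H.form, map_sub, map_add, map_smul, LinearMap.sub_apply, LinearMap.add_apply,
    LinearMap.smul_apply, form_leviCivita, koszul_apply, form_grad, smul_eq_mul,
    Derivation.leibniz, H.deriv]
  rw [g.symm X Z]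
  linear_combination (Ω * Ω * (X Υ * g.form Y Z + Y Υ * g.form Z X - Z Υ * g.form X Y)) *
    two_mul_half (A := A)

/-- The last index is lowered with `g`, so no factor `Ω²` appears. After inserting the changed
connection twice, the non-tensorial terms cancel by metric compatibility, vanishing torsion and `X
(Y Υ) - Y (X Υ) = ⁅X, Y⁆ Υ`. -/
theorem curvature (H : IsConformalChange g g' Υ Ω Ω')
    (X Y Z W : VectorField A) :
    g.form (g'.curvature X Y Z) W = g.form (g.curvature X Y Z) W
      + g.hess Υ X Z * g.form Y W - g.hess Υ Y Z * g.form X W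
      - g.form Y Z * g.hess Υ X W + g.form Z X * g.hess Υ Y W
      + Y Υ * Z Υ * g.form X W - X Υ * Z Υ * g.form Y W
      - Y Υ * g.form Z X * W Υ + X Υ * g.form Y Z * W Υ
      - g.grad Υ Υ * (g.form Y Z * g.form X W - g.form Z X * g.form Y W) := by
  have t1 := g.leviCivita_metric X Y Z
  have t2 := g.leviCivita_metric Y X Z
  have t3 := g.leviCivita_torsion X Y
  have t4 : X (Y Υ) - Y (X Υ) = ⁅X, Y⁆ Υ := (Derivation.commutator_apply ..).symm
  have t6 := congrArg (fun V => g.form V Z) t3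
  have t7 := congrArg (fun V => g.form V W) t3
  simp only [map_add, LinearMap.add_apply] at t6 t7
  simp only [PseudoRiemMetric.curvature, H.leviCivita, Connection.add_right, Connection.leibniz,
    Connection.sub_right, map_add, map_sub, map_smul, LinearMap.add_apply, LinearMap.sub_apply,
    LinearMap.smul_apply, smul_eq_mul, Derivation.add_apply, Derivation.sub_apply,
    Derivation.smul_apply, form_grad, form_grad_right, ← hess_eq_form, hess_apply]
  rw [g.symm Z X, g.symm Y X]
  linear_combination g.form Z W * t4 + Z Υ * t7 - W Υ * t1 + W Υ * t2 - W Υ * t6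

end IsConformalChange

end LeviCivita

/-! ### Traces, Ricci and Schouten tensors and the Laplacian under a conformal change. -/

section Schouten

variable {A : Type*} [CommRing A] [Algebra ℝ A] {d : ℕ} [HasDimension A d]
  [∀ g : PseudoRiemMetric A, IsTraceForm g.form A] {g g' : PseudoRiemMetric A} {Υ Ω Ω' : A}

namespace IsConformalChange

open PseudoRiemMetric

/-- A rank-one map built with `g'` is `Ω⁴` times the one built with `g`, while its trace gains only
`Ω²`; the trace operator therefore scales by `Ω⁻²`. -/
theorem formTrace (H : IsConformalChange g g' Υ Ω Ω')
    {S : Type*} [AddCommGroup S] [Module A S] [∀ g : PseudoRiemMetric A, IsTraceForm g.form S]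
    (B : VectorField A →ₗ[A] VectorField A →ₗ[A] S) :
    formTrace g'.form B = (Ω' * Ω') • formTrace g.form B := by
  have h : Tractor.formTrace (S := S) g'.form = (Ω' * Ω') • Tractor.formTrace g.form := by
    refine IsTraceForm.ext_rankOne (b := g'.form) _ _ fun v v' s => ?_
    rw [IsTraceForm.formTrace_rankOne]
    have h1 : rankOne g'.form v v' s = (Ω * Ω * (Ω * Ω)) • rankOne g.form v v' s := by
      refine LinearMap.ext fun X => LinearMap.ext fun Y => ?_
      rw [LinearMap.smul_apply, LinearMap.smul_apply, rankOne_apply, rankOne_apply, H.form,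
        H.form, smul_smul]
      congr 1
      ring
    rw [h1, map_smul, LinearMap.smul_apply, IsTraceForm.formTrace_rankOne, H.form,
      smul_smul, smul_smul]
    congr 1
    linear_combination -(Ω * Ω * g.form v v') * (Ω * Ω' + 1) * H.mul_inv
  rw [h, LinearMap.smul_apply]

/-- The curvature formula is assembled from bilinear forms in `(X, W)` whose traces can be evaluated
one by one. Lowering the index with `g'` produces the factor `Ω²`. -/
theorem curvatureForm (H : IsConformalChange g g' Υ Ω Ω')
    (Y Z : VectorField A) : g'.curvatureForm Y Z = (Ω * Ω) •
    (g.curvatureForm Y Z + ((g.hess Υ).flip Z).smulRight (g.form Y)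
      - (g.hess Υ Y Z - Y Υ * Z Υ + g.grad Υ Υ * g.form Y Z) • g.form
      - g.form Y Z • g.hess Υ + (g.form Z).smulRight (g.hess Υ Y)
      - (Z Υ • differential Υ).smulRight (g.form Y)
      - (g.form Z).smulRight (Y Υ • differential Υ)
      + g.form Y Z • (g.form (g.grad Υ)).smulRight (differential Υ)
      + g.grad Υ Υ • (g.form Z).smulRight (g.form Y)) := by
  have hd : ∀ X : VectorField A, differential Υ X = X Υ := fun _ => rfl
  refine LinearMap.ext fun X => LinearMap.ext fun W => ?_
  change g'.form (g'.curvature X Y Z) W = _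
  have hc : g.curvatureForm Y Z X W = g.form (g.curvature X Y Z) W := rfl
  rw [H.form, H.curvature]
  simp only [LinearMap.add_apply, LinearMap.sub_apply, LinearMap.smul_apply, smul_eq_mul,
    LinearMap.smulRight_apply, LinearMap.flip_apply, hd, hc, form_grad]
  ring

/-- The factor `Ω²` of the curvature form cancels against the `Ω⁻²` of the trace. In the coefficient
`d - 2` of the Hessian, `d` is the trace of `g` and the `2` comes from the two mixed terms `e1` and
`e2`. -/
theorem ricci (H : IsConformalChange g g' Υ Ω Ω')
    (Y Z : VectorField A) : g'.ricci Y Z = g.ricci Y Z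
    - (algebraMap ℝ A d - 2) * (g.hess Υ Y Z - Y Υ * Z Υ)
    - (g.laplacian trivialConnection Υ + (algebraMap ℝ A d - 2) * g.grad Υ Υ)
      * g.form Y Z := by
  have hd : ∀ X : VectorField A, differential Υ X = X Υ := fun _ => rfl
  change Tractor.formTrace g'.form (g'.curvatureForm Y Z) =
    Tractor.formTrace g.form (g.curvatureForm Y Z) - _ - _
  have e1 : Tractor.formTrace g.form (((g.hess Υ).flip Z).smulRight (g.form Y)) = g.hess Υ Y Z :=
    IsTraceForm.formTrace_right Y ((g.hess Υ).flip Z) _ fun X W => by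
      rw [LinearMap.smulRight_apply, LinearMap.smul_apply, smul_eq_mul, smul_eq_mul]
      exact mul_comm _ _
  have e2 : Tractor.formTrace g.form ((g.form Z).smulRight (g.hess Υ Y)) = g.hess Υ Y Z :=
    IsTraceForm.formTrace_left Z (g.hess Υ Y) _ fun X W => rfl
  have e3 : Tractor.formTrace g.form ((Z Υ • differential Υ).smulRight (g.form Y)) = Z Υ * Y Υ :=
    IsTraceForm.formTrace_right Y (Z Υ • differential Υ) _ fun X W => by
      simp only [LinearMap.smulRight_apply, LinearMap.smul_apply, smul_eq_mul]; ring
  have e4 : Tractor.formTrace g.form ((g.form Z).smulRight (Y Υ • differential Υ)) = Y Υ * Z Υ :=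
    IsTraceForm.formTrace_left Z (Y Υ • differential Υ) _ fun X W => rfl
  have e5 : Tractor.formTrace g.form ((g.form (g.grad Υ)).smulRight (differential Υ)) =
      g.grad Υ Υ :=
    IsTraceForm.formTrace_left (g.grad Υ) (differential Υ) _ fun X W => rfl
  have e6 : Tractor.formTrace g.form ((g.form Z).smulRight (g.form Y)) = g.form Y Z :=
    IsTraceForm.formTrace_left Z (g.form Y) _ fun X W => rfl
  have e7 : Tractor.formTrace g.form (g.hess Υ) = g.laplacian trivialConnection Υ := rfl
  rw [H.formTrace, H.curvatureForm]
  simp only [map_smul, map_add, formTrace_sub, smul_eq_mul, e1, e2, e3, e4, e5, e6, e7,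
    HasDimension.formTrace_form (d := d) g]
  generalize Tractor.formTrace g.form (g.curvatureForm Y Z) = R
  generalize g.hess Υ Y Z = h
  generalize g.laplacian trivialConnection Υ = L
  generalize g.form Y Z = G
  generalize g.grad Υ Υ = u
  generalize Y Υ = y
  generalize Z Υ = z
  generalize algebraMap ℝ A d = D
  linear_combination (R - (D - 2) * (h - y * z) - (L + (D - 2) * u) * G)
    * (Ω * Ω' + 1) * H.mul_inv

theorem formTrace_differential (g : PseudoRiemMetric A) (Υ : A) :
    Tractor.formTrace g.form ((differential Υ).smulRight (differential Υ)) = g.grad Υ Υ :=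
  IsTraceForm.formTrace_left (g.grad Υ) (differential Υ) _ fun X W => by
    rw [form_grad]; rfl

theorem scalarCurvature (H : IsConformalChange g g' Υ Ω Ω') :
    g'.scalarCurvature = Ω' * Ω' * (g.scalarCurvature
    - 2 * (algebraMap ℝ A d - 1) * g.laplacian trivialConnection Υ
    - (algebraMap ℝ A d - 1) * (algebraMap ℝ A d - 2) * g.grad Υ Υ) := by
  have h : g'.ricci = g.ricci
      - (algebraMap ℝ A d - 2) • (g.hess Υ - (differential Υ).smulRight (differential Υ))
      - (g.laplacian trivialConnection Υ + (algebraMap ℝ A d - 2) * g.grad Υ Υ)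
        • g.form :=
    LinearMap.ext fun Y => LinearMap.ext fun Z => H.ricci Y Z
  have e7 : Tractor.formTrace g.form (g.hess Υ) = g.laplacian trivialConnection Υ := rfl
  change Tractor.formTrace g'.form g'.ricci = Ω' * Ω' * (Tractor.formTrace g.form g.ricci - _ - _)
  rw [H.formTrace, h]
  simp only [formTrace_sub, map_smul, smul_eq_mul, e7, formTrace_differential g Υ, HasDimension.formTrace_form (d := d) g]
  ring

/-- The normalising constants are the inverses of `d - 2` and `2 (d - 1)`, both nonzero as `d ≥ 3`.
They remove the Laplacian of `Υ` and leave coefficients free of the dimension. -/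
theorem schouten (H : IsConformalChange g g' Υ Ω Ω')
    (hd : 3 ≤ d) (Y Z : VectorField A) : g'.schouten d Y Z = g.schouten d Y Z
    - g.hess Υ Y Z + Y Υ * Z Υ
    - algebraMap ℝ A (1 / 2) * g.grad Υ Υ * g.form Y Z := by
  have hd' : (3 : ℝ) ≤ d := by exact_mod_cast hd
  have c1 : algebraMap ℝ A (1 / ((d : ℝ) - 2)) * (algebraMap ℝ A d - 2) = 1 := by
    rw [← map_ofNat (algebraMap ℝ A) 2, ← map_sub, ← map_mul, one_div_mul_cancel, map_one]
    linarith
  have c2 : algebraMap ℝ A (1 / (2 * ((d : ℝ) - 1))) *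
      (2 * (algebraMap ℝ A d - 1)) = 1 := by
    rw [← map_ofNat (algebraMap ℝ A) 2, ← map_one (algebraMap ℝ A), ← map_sub,
      ← map_mul, ← map_mul, one_div_mul_cancel, map_one]
    have : (2 * ((d : ℝ) - 1)) ≠ 0 := by
      have : 0 < 2 * ((d : ℝ) - 1) := by linarith
      exact this.ne'
    exact this
  have c3 := two_mul_half (A := A)
  simp only [PseudoRiemMetric.schouten, LinearMap.smul_apply, LinearMap.sub_apply, smul_eq_mul]
  rw [H.ricci (d := d), H.scalarCurvature (d := d), H.form]
  generalize g.ricci Y Z = R at *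
  generalize g.scalarCurvature = S at *
  generalize g.hess Υ Y Z = h at *
  generalize g.laplacian trivialConnection Υ = L at *
  generalize g.form Y Z = G at *
  generalize g.grad Υ Υ = u at *
  generalize Y Υ = y at *
  generalize Z Υ = z at *
  generalize algebraMap ℝ A d = D at *
  generalize algebraMap ℝ A (1 / ((d : ℝ) - 2)) = k at *
  generalize algebraMap ℝ A (1 / (2 * ((d : ℝ) - 1))) = l at *
  generalize algebraMap ℝ A (1 / 2) = m at *
  have hm := H.mul_inv
  have hm2 : Ω' * Ω' * (Ω * Ω) = 1 := by linear_combination (Ω * Ω' + 1) * hm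
  have e : k * (R - (D - 2) * (h - y * z) - (L + (D - 2) * u) * G -
      l * (S - 2 * (D - 1) * L - (D - 1) * (D - 2) * u) * G)
      = k * (R - l * S * G) - h + y * z - m * u * G := by
    have c4 : l * (D - 1) = m := by linear_combination m * c2 - l * (D - 1) * c3
    linear_combination (-h + y * z - u * G) * c1 + k * L * G * c2 + k * (D - 2) * u * G * c4
      + m * u * G * c1 + u * G * c3
  linear_combination e - k * l * (S - 2 * (D - 1) * L - (D - 1) * (D - 2) * u) * G * hm2

theorem schoutenTrace (H : IsConformalChange g g' Υ Ω Ω')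
    (hd : 3 ≤ d) : g'.schoutenTrace d = Ω' * Ω' * (g.schoutenTrace d
    - g.laplacian trivialConnection Υ + g.grad Υ Υ
    - algebraMap ℝ A (1 / 2) * algebraMap ℝ A d * g.grad Υ Υ) := by
  have h : g'.schouten d = g.schouten d - g.hess Υ + (differential Υ).smulRight (differential Υ)
      - (algebraMap ℝ A (1 / 2) * g.grad Υ Υ) • g.form :=
    LinearMap.ext fun Y => LinearMap.ext fun Z => H.schouten hd Y Z
  have e7 : Tractor.formTrace g.form (g.hess Υ) = g.laplacian trivialConnection Υ := rfl
  change Tractor.formTrace g'.form (g'.schouten d) =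
    Ω' * Ω' * (Tractor.formTrace g.form (g.schouten d) - _ + _ - _)
  rw [H.formTrace, h]
  simp only [formTrace_sub, map_add, map_smul, smul_eq_mul, e7, formTrace_differential g Υ,
    HasDimension.formTrace_form (d := d) g]
  ring

/-- The three corrections to the Hessian contribute `-1`, `-1` and `d` times the derivative along
`grad Υ`. -/
theorem laplacian (H : IsConformalChange g g' Υ Ω Ω')
    {S : Type*} [AddCommGroup S] [Module A S] [∀ g : PseudoRiemMetric A, IsTraceForm g.form S]
    (D : Connection (A := A) S) (s : S) : g'.laplacian D s = (Ω' * Ω') •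
      (g.laplacian D s + (algebraMap ℝ A d - 2) • D.cov (g.grad Υ) s) := by
  let l : VectorField A →ₗ[A] S :=
    { toFun := fun X => D.cov X s
      map_add' := fun X Y => D.add_left X Y s
      map_smul' := fun f X => D.smul_left f X s }
  have h : g'.hessian D s = g.hessian D s - (g.form (g.grad Υ)).smulRight l
      - (LinearMap.lsmul A S).flip.compl₁₂ l (differential Υ)
      + g.form.compr₂ (LinearMap.toSpanSingleton A S (l (g.grad Υ))) := by
    refine LinearMap.ext fun X => LinearMap.ext fun Y => ?_
    change D.cov X (D.cov Y s) - D.cov (g'.leviCivita.cov X Y) s =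
      D.cov X (D.cov Y s) - D.cov (g.leviCivita.cov X Y) s - g.form (g.grad Υ) X • D.cov Y s
        - Y Υ • D.cov X s + g.form X Y • D.cov (g.grad Υ) s
    rw [H.leviCivita, form_grad, Connection.sub_left, D.add_left, D.add_left, D.smul_left,
      D.smul_left, D.smul_left]
    abel
  have e1 : Tractor.formTrace g.form ((g.form (g.grad Υ)).smulRight l) = l (g.grad Υ) :=
    IsTraceForm.formTrace_left (g.grad Υ) l _ fun X W => rfl
  have e2 : Tractor.formTrace g.form ((LinearMap.lsmul A S).flip.compl₁₂ l (differential Υ)) =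
      l (g.grad Υ) :=
    IsTraceForm.formTrace_right (g.grad Υ) l _ fun X W => by rw [form_grad]; rfl
  have e3 : Tractor.formTrace g.form
      (g.form.compr₂ (LinearMap.toSpanSingleton A S (l (g.grad Υ)))) =
      algebraMap ℝ A d • l (g.grad Υ) := by
    rw [IsTraceForm.formTrace_compr, HasDimension.formTrace_form (d := d)]
  change Tractor.formTrace g'.form (g'.hessian D s) = _
  rw [H.formTrace, h, map_add, formTrace_sub, formTrace_sub, e1, e2, e3]
  change (Ω' * Ω') • (g.laplacian D s - D.cov (g.grad Υ) s - D.cov (g.grad Υ) s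
    + algebraMap ℝ A d • D.cov (g.grad Υ) s) = _
  module

end IsConformalChange

end Schouten

/-! ## Conformal invariance of the tractor calculus -/

section Invariance

variable {A : Type*} [CommRing A] [Algebra ℝ A]

namespace PseudoRiemMetric

variable (g : PseudoRiemMetric A)

theorem sharp_covOneForm (X : VectorField A) (μ : OneForm A) :
    g.sharp (g.covOneForm X μ) = g.leviCivita.cov X (g.sharp μ) := by
  refine g.ext_form fun Z => ?_
  have h := g.leviCivita_metric X (g.sharp μ) Z
  rw [form_sharp, form_sharp] at h
  rw [form_sharp]
  change X (μ Z) - μ (g.leviCivita.cov X Z) = _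
  rw [h]
  ring

theorem tractorMetric_apply (T T' : TractorField A) : g.tractorMetric T T' =
    g.inv T.2.1 T'.2.1 + T.1 * T'.2.2 + T.2.2 * T'.1 := rfl

theorem tractorMetric_comm (T T' : TractorField A) :
    g.tractorMetric T T' = g.tractorMetric T' T := by
  rw [tractorMetric_apply, tractorMetric_apply, inv_comm]
  ring

/-- The outer slots are paired with each other and the middle one with itself, so a functional is
represented by exchanging its outer components. This is the nondegeneracy that traces over tractors
need. -/
theorem tractorMetric_surjective : Function.Surjective g.tractorMetric := by
  intro l
  let ν : OneForm A := l ∘ₗ LinearMap.inr A A (OneForm A × A) ∘ₗ LinearMap.inl A (OneForm A) A ∘ₗ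
    g.flat.toLinearMap
  refine ⟨(l (0, 0, 1), ν, l (1, 0, 0)), LinearMap.ext fun T => ?_⟩
  have h1 : ν (g.sharp T.2.1) = l (0, T.2.1, 0) := by
    change l (0, g.flat (g.flat.symm T.2.1), 0) = _
    rw [LinearEquiv.apply_symm_apply]
  have h2 : T = T.1 • ((1, 0, 0) : TractorField A) + ((0, T.2.1, 0) : TractorField A)
      + T.2.2 • ((0, 0, 1) : TractorField A) := by
    refine Prod.ext ?_ (Prod.ext ?_ ?_) <;> simp
  rw [tractorMetric_apply, inv_apply, h1]
  conv_rhs => rw [h2]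
  rw [map_add, map_add, map_smul, map_smul, smul_eq_mul, smul_eq_mul]
  ring

/-- The terms `ρ g` and `σ P` in the middle slot cancel against `μ` in the top slot and `P μ` in the
bottom slot; what remains is compatibility of the Levi-Civita connection with `g`. -/
theorem tractorConnection_metric (d : ℕ) (X : VectorField A) (T T' : TractorField A) :
    X (g.tractorMetric T T') = g.tractorMetric ((g.tractorConnection d).cov X T) T'
      + g.tractorMetric T ((g.tractorConnection d).cov X T') := by
  have h := g.leviCivita_metric X (g.sharp T.2.1) (g.sharp T'.2.1)
  rw [← sharp_covOneForm, ← sharp_covOneForm] at h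
  have e1 : g.inv ((g.tractorConnection d).cov X T).2.1 T'.2.1 =
      g.inv (g.covOneForm X T.2.1) T'.2.1 + T.2.2 * T'.2.1 X
        + T.1 * g.schouten d X (g.sharp T'.2.1) := by
    rw [inv_apply, inv_apply]
    change g.covOneForm X T.2.1 (g.sharp T'.2.1) + T.2.2 * g.form X (g.sharp T'.2.1) +
      T.1 * g.schouten d X (g.sharp T'.2.1) = _
    rw [form_sharp_right]
  have e2 : g.inv T.2.1 ((g.tractorConnection d).cov X T').2.1 =
      g.inv T.2.1 (g.covOneForm X T'.2.1) + T'.2.2 * T.2.1 X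
        + T'.1 * g.schouten d X (g.sharp T.2.1) := by
    rw [inv_comm, inv_apply, inv_comm, inv_apply]
    change g.covOneForm X T'.2.1 (g.sharp T.2.1) + T'.2.2 * g.form X (g.sharp T.2.1) +
      T'.1 * g.schouten d X (g.sharp T.2.1) = _
    rw [form_sharp_right]
  have h' : X (g.inv T.2.1 T'.2.1) = g.inv (g.covOneForm X T.2.1) T'.2.1
      + g.inv T.2.1 (g.covOneForm X T'.2.1) := h
  simp only [tractorMetric_apply, e1, e2, map_add, Derivation.leibniz, h', smul_eq_mul]
  simp only [tractorConnection]
  ring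

/-- The change of splitting to the metric `Ω² g`, where `Ω = exp Υ` and `Ω' = exp (-Υ)`. -/
def splitting (Υ Ω Ω' : A) : TractorField A →ₗ[A] TractorField A where
  toFun T := (Ω * T.1, Ω • (T.2.1 + T.1 • differential Υ),
    Ω' * (T.2.2 - g.inv (differential Υ) T.2.1
      - algebraMap ℝ A (1 / 2) * T.1 * g.inv (differential Υ) (differential Υ)))
  map_add' T T' := by
    refine Prod.ext ?_ (Prod.ext ?_ ?_)
    · simp; ring
    · simp only [Prod.fst_add, Prod.snd_add, add_smul, smul_add]; abel
    · simp; ring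
  map_smul' f T := by
    refine Prod.ext ?_ (Prod.ext ?_ ?_)
    · simp; ring
    · simp only [Prod.smul_fst, Prod.smul_snd, smul_eq_mul, RingHom.id_apply]
      module
    · simp; ring

theorem inv_differential (f : A) (μ : OneForm A) : g.inv (differential f) μ = μ (g.grad f) := by
  rw [inv_comm, inv_apply]
  rfl

end PseudoRiemMetric

namespace IsConformalChange

open PseudoRiemMetric

variable {g g' : PseudoRiemMetric A} {Υ Ω Ω' : A}

theorem inv (H : IsConformalChange g g' Υ Ω Ω')
    (α β : OneForm A) : g'.inv α β = Ω' * Ω' * g.inv α β := by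
  rw [inv_apply, inv_apply, H.sharp, map_smul, smul_eq_mul]

theorem tractorMetric (H : IsConformalChange g g' Υ Ω Ω')
    (T T' : TractorField A) :
    g'.tractorMetric (g.splitting Υ Ω Ω' T) (g.splitting Υ Ω Ω' T') = g.tractorMetric T T' := by
  have h2 := two_mul_half (A := A)
  have h3 : Ω' * Ω' * (Ω * Ω) = 1 := by linear_combination (Ω * Ω' + 1) * H.mul_inv
  have h1 := H.mul_inv
  simp only [tractorMetric_apply, splitting, LinearMap.coe_mk, AddHom.coe_mk, H.inv, map_smul,
    map_add, LinearMap.smul_apply, LinearMap.add_apply, smul_eq_mul]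
  rw [g.inv_comm T.2.1 (differential Υ)]
  generalize g.inv (differential Υ) T.2.1 = a
  generalize g.inv (differential Υ) T'.2.1 = b
  generalize g.inv (differential Υ) (differential Υ) = u
  generalize g.inv T.2.1 T'.2.1 = q
  obtain ⟨s, μ, ρ⟩ := T
  obtain ⟨s', μ', ρ'⟩ := T'
  simp only
  generalize algebraMap ℝ A (1 / 2) = m at *
  linear_combination (q + s * b + s' * a + s * s' * u) * h3
    + (s * (ρ' - b - m * s' * u) + s' * (ρ - a - m * s * u)) * h1 - s * s' * u * h2

/-- Differentiating the splitting produces the Hessian of `Υ`, which the Schouten tensor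
compensates. The Schouten law enters as a hypothesis, so neither traces nor the dimension are
involved here. -/
theorem tractorConnection (H : IsConformalChange g g' Υ Ω Ω')
    {d : ℕ}
    (hP : ∀ Y Z, g'.schouten d Y Z = g.schouten d Y Z - g.hess Υ Y Z + Y Υ * Z Υ
      - algebraMap ℝ A (1 / 2) * g.grad Υ Υ * g.form Y Z)
    (X : VectorField A) (T : TractorField A) :
    (g'.tractorConnection d).cov X (g.splitting Υ Ω Ω' T) =
      g.splitting Υ Ω Ω' ((g.tractorConnection d).cov X T) := by
  have h2 := two_mul_half (A := A)
  have h3 : Ω' * Ω' * (Ω * Ω) = 1 := by linear_combination (Ω * Ω' + 1) * H.mul_inv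
  have h1 := H.mul_inv
  have hd : ∀ Y : VectorField A, differential Υ Y = Y Υ := fun _ => rfl
  obtain ⟨s, μ, ρ⟩ := T
  refine Prod.ext ?_ (Prod.ext (LinearMap.ext fun Y => ?_) ?_)
  · simp only [PseudoRiemMetric.tractorConnection, splitting, LinearMap.coe_mk, AddHom.coe_mk,
      LinearMap.smul_apply, LinearMap.add_apply, smul_eq_mul, hd, Derivation.leibniz, H.deriv]
    ring
  · simp only [PseudoRiemMetric.tractorConnection, splitting, covOneForm, LinearMap.coe_mk,
      AddHom.coe_mk,
      LinearMap.smul_apply, LinearMap.add_apply, smul_eq_mul, hd, Derivation.leibniz, H.deriv,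
      map_add, hP, H.form, H.leviCivita, map_sub, map_smul, inv_differential, hess_apply,
      Derivation.add_apply, Derivation.smul_apply]
    linear_combination Ω * (ρ - μ (g.grad Υ) - algebraMap ℝ A (1 / 2) * s * g.grad Υ Υ) *
      g.form X Y * h1 - Ω * s * g.grad Υ Υ * g.form X Y * h2
  · have k1 : g.hess Υ X (g.sharp μ) = μ (g.leviCivita.cov X (g.grad Υ)) := by
      rw [hess_eq_form, form_sharp_right]
    have k2 : g.sharp μ Υ = μ (g.grad Υ) := by rw [← form_grad, form_sharp_right]
    -- Since `grad Υ Υ` is the squared length of the gradient, this handles the derivative of the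
    -- quadratic term of the splitting.
    have k3 : X (g.grad Υ Υ) = 2 * g.hess Υ X (g.grad Υ) := by
      rw [← g.form_grad Υ (g.grad Υ), leviCivita_metric, g.symm (g.grad Υ), hess_eq_form]
      ring
    have k4 : g.sharp (differential Υ) = g.grad Υ := rfl
    simp only [PseudoRiemMetric.tractorConnection, splitting, covOneForm, LinearMap.coe_mk,
      AddHom.coe_mk,
      LinearMap.smul_apply, LinearMap.add_apply, smul_eq_mul, hd, Derivation.leibniz, H.deriv_inv,
      map_add, hP, H.sharp, map_sub, map_smul, inv_differential,
      Derivation.add_apply, Derivation.smul_apply, Derivation.map_algebraMap, k1, k2, k3, k4,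
      form_sharp_right, form_grad_right]
    linear_combination (-Ω' * (g.schouten d X (g.sharp μ) + s * g.schouten d X (g.grad Υ)
      - μ (g.leviCivita.cov X (g.grad Υ)) - s * g.hess Υ X (g.grad Υ)
      + X Υ * (μ (g.grad Υ) + s * g.grad Υ Υ)
      - algebraMap ℝ A (1 / 2) * g.grad Υ Υ * (μ X + s * X Υ))) * h1
      - Ω' * s * g.hess Υ X (g.grad Υ) * h2 + Ω' * s * g.grad Υ Υ * X Υ * h2

end IsConformalChange

/-! ### Tractor tensors -/

/-- The pull-back of tractor tensors by an endomorphism of the standard tractor bundle. -/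
def pullback (L : TractorField A →ₗ[A] TractorField A) (r : ℕ) :
    TractorTensor A r →ₗ[A] TractorTensor A r where
  toFun F := F.compLinearMap fun _ => L
  map_add' _ _ := rfl
  map_smul' _ _ := rfl

theorem pullback_covTensor {g g' : PseudoRiemMetric A} {d r : ℕ}
    {L : TractorField A →ₗ[A] TractorField A}
    (hL : ∀ X T, (g'.tractorConnection d).cov X (L T) = L ((g.tractorConnection d).cov X T))
    (X : VectorField A) (F : TractorTensor A r) :
    pullback L r (g'.covTensor d X F) = g.covTensor d X (pullback L r F) := by
  refine MultilinearMap.ext fun T => ?_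
  change X (F fun i => L (T i)) - ∑ i, F (Function.update (fun i => L (T i)) i
      ((g'.tractorConnection d).cov X (L (T i)))) =
    X (F fun i => L (T i)) - ∑ i, F fun j =>
      L (Function.update T i ((g.tractorConnection d).cov X (T i)) j)
  congr 1
  refine Finset.sum_congr rfl fun i _ => congrArg F (funext fun j => ?_)
  by_cases h : j = i
  · subst h
    rw [Function.update_self, Function.update_self, hL]
  · rw [Function.update_of_ne h, Function.update_of_ne h]

namespace PseudoRiemMetric

variable (g : PseudoRiemMetric A)

/-- A linear map that intertwines two connections intertwines the contractions of the Thomas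
operator. -/
theorem map_contract_thomasD {S : Type*} [AddCommGroup S] [Module A S] [IsTraceForm g.form S]
    {D D' : Connection (A := A) S} (L : S →ₗ[A] S)
    (hL : ∀ X s, L (D'.cov X s) = D.cov X (L s)) (d : ℕ) (w : ℝ) (T : TractorField A) (s : S) :
    L (g.contract T (g.thomasD d D' w s)) = g.contract T (g.thomasD d D w (L s)) := by
  have h : L (g.laplacian D' s) = g.laplacian D (L s) := by
    rw [laplacian, laplacian, map_formTrace]
    congr 1
    refine LinearMap.ext fun X => LinearMap.ext fun Y => ?_
    change L (D'.cov X (D'.cov Y s) - D'.cov (g.leviCivita.cov X Y) s) =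
      D.cov X (D.cov Y (L s)) - D.cov (g.leviCivita.cov X Y) (L s)
    rw [map_sub, hL, hL, hL]
  simp only [contract, thomasD, map_add, map_smul, map_neg, h, LinearMap.smul_apply,
    LinearMap.coe_mk, AddHom.coe_mk, hL]

end PseudoRiemMetric

/-! ### The Thomas operator: Leibniz rule and conformal invariance. -/

section Thomas

open PseudoRiemMetric

variable {d : ℕ} [HasDimension A d] [∀ g : PseudoRiemMetric A, IsTraceForm g.form A]
  {S : Type*} [AddCommGroup S] [Module A S] [∀ g : PseudoRiemMetric A, IsTraceForm g.form S]

/-- The Leibniz rule for the Laplacian. -/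
theorem laplacian_smul (g : PseudoRiemMetric A) (D : Connection (A := A) S) (f : A) (s : S) :
    g.laplacian D (f • s) = f • g.laplacian D s + (2 : A) • D.cov (g.grad f) s
      + g.laplacian trivialConnection f • s := by
  let l : VectorField A →ₗ[A] S :=
    { toFun := fun X => D.cov X s
      map_add' := fun X Y => D.add_left X Y s
      map_smul' := fun f X => D.smul_left f X s }
  have h : g.hessian D (f • s) = f • g.hessian D s + (g.form (g.grad f)).smulRight l
      + (LinearMap.lsmul A S).flip.compl₁₂ l (differential f)
      + (g.hess f).compr₂ (LinearMap.toSpanSingleton A S s) := by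
    refine LinearMap.ext fun X => LinearMap.ext fun Y => ?_
    change D.cov X (D.cov Y (f • s)) - D.cov (g.leviCivita.cov X Y) (f • s) =
      f • (D.cov X (D.cov Y s) - D.cov (g.leviCivita.cov X Y) s) + g.form (g.grad f) X • D.cov Y s
        + Y f • D.cov X s + (X (Y f) - g.leviCivita.cov X Y f) • s
    rw [form_grad, D.leibniz, D.leibniz, D.add_right, D.leibniz, D.leibniz]
    module
  have e1 : formTrace g.form ((g.form (g.grad f)).smulRight l) = l (g.grad f) :=
    IsTraceForm.formTrace_left (g.grad f) l _ fun X W => rfl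
  have e2 : formTrace g.form ((LinearMap.lsmul A S).flip.compl₁₂ l (differential f)) =
      l (g.grad f) :=
    IsTraceForm.formTrace_right (g.grad f) l _ fun X W => by rw [form_grad]; rfl
  change formTrace g.form (g.hessian D (f • s)) = _
  rw [h, map_add, map_add, map_add, map_smul, e1, e2, IsTraceForm.formTrace_compr]
  change f • g.laplacian D s + D.cov (g.grad f) s + D.cov (g.grad f) s
    + g.laplacian trivialConnection f • s = _
  module

/-- Here and below `E` plays the role of `exp (w Υ)`; only its differential equation enters. -/
theorem grad_eq_of_deriv {g : PseudoRiemMetric A} {Υ E a : A}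
    (hE : ∀ X : VectorField A, X E = a * E * X Υ) : g.grad E = (a * E) • g.grad Υ := by
  refine g.ext_form fun Z => ?_
  rw [form_grad, map_smul, LinearMap.smul_apply, form_grad, hE, smul_eq_mul]

theorem laplacian_eq_of_deriv {g : PseudoRiemMetric A} {Υ E : A} {w : ℝ}
    (hE : ∀ X : VectorField A, X E = algebraMap ℝ A w * E * X Υ) :
    g.laplacian trivialConnection E = algebraMap ℝ A w * E * (g.laplacian trivialConnection Υ
      + algebraMap ℝ A w * g.grad Υ Υ) := by
  have h : g.hess E = (algebraMap ℝ A w * E) • (g.hess Υ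
      + algebraMap ℝ A w • (g.form (g.grad Υ)).smulRight (differential Υ)) := by
    refine LinearMap.ext fun X => LinearMap.ext fun Y => ?_
    change X (Y E) - g.leviCivita.cov X Y E = algebraMap ℝ A w * E * ((X (Y Υ)
      - g.leviCivita.cov X Y Υ) + algebraMap ℝ A w * (g.form (g.grad Υ) X * Y Υ))
    simp only [hE, Derivation.leibniz, Derivation.map_algebraMap, smul_eq_mul, form_grad]
    ring
  have e1 : formTrace g.form ((g.form (g.grad Υ)).smulRight (differential Υ)) = g.grad Υ Υ :=
    IsTraceForm.formTrace_left (g.grad Υ) (differential Υ) _ fun X W => rfl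
  change formTrace g.form (g.hess E) = _
  rw [h, map_smul, map_add, map_smul, e1]
  rfl

namespace IsConformalChange

variable {g g' : PseudoRiemMetric A} {Υ Ω Ω' : A}

/-- The connection `D` stays fixed. The change of metric gives `d - 2` and the factor `E` gives `2w`
in the coefficient of the derivative along `grad Υ`; their sum is the factor of the middle slot. The
Laplacian of `Υ` cancels between that of `E` and the change of `J`. -/
theorem thomasD_bottom (H : IsConformalChange g g' Υ Ω Ω')
    (hd : 3 ≤ d) (D : Connection (A := A) S) {E : A} {w : ℝ}
    (hE : ∀ X : VectorField A, X E = algebraMap ℝ A w * E * X Υ) (V : S) :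
    (g'.thomasD d D w (E • V)).2.2 = (E * (Ω' * Ω')) • ((g.thomasD d D w V).2.2
      - (g.thomasD d D w V).2.1 (g.grad Υ)
      - (algebraMap ℝ A (1 / 2) * g.grad Υ Υ) • (g.thomasD d D w V).1) := by
  have h2 := two_mul_half (A := A)
  simp only [thomasD, LinearMap.smul_apply, LinearMap.coe_mk, AddHom.coe_mk, map_sub, map_add,
    map_mul, map_ofNat]
  rw [H.laplacian (d := d), H.schoutenTrace hd, laplacian_smul, laplacian_eq_of_deriv hE,
    grad_eq_of_deriv hE, D.leibniz, D.smul_left, hE]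
  generalize g.laplacian D V = L
  generalize D.cov (g.grad Υ) V = N
  generalize g.laplacian trivialConnection Υ = l
  generalize g.grad Υ Υ = u
  generalize g.schoutenTrace d = J
  generalize algebraMap ℝ A w = p
  generalize algebraMap ℝ A d = δ
  generalize algebraMap ℝ A (1 / 2) = m at *
  match_scalars
  · ring
  · ring
  · linear_combination (E * Ω' ^ 2 * u * p * (δ + p - 1)) * h2

/-- The corrections in the bottom slot are paired off with those of the splitting of `T`, as in the
invariance of the tractor metric. The factor `E Ω'` stands for `exp ((w - 1) Υ)`: the weight drops
by one. -/
theorem contract_thomasD (H : IsConformalChange g g' Υ Ω Ω')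
    (hd : 3 ≤ d) (D : Connection (A := A) S) {E : A} {w : ℝ}
    (hE : ∀ X : VectorField A, X E = algebraMap ℝ A w * E * X Υ) (T : TractorField A) (V : S) :
    g'.contract (g.splitting Υ Ω Ω' T) (g'.thomasD d D w (E • V)) =
      (E * Ω') • g.contract T (g.thomasD d D w V) := by
  have h2 := two_mul_half (A := A)
  have h1 := H.mul_inv
  have hdd : ∀ Y : VectorField A, differential Υ Y = Y Υ := fun _ => rfl
  have k2 : ∀ μ : OneForm A, g.sharp μ Υ = μ (g.grad Υ) := fun μ => by
    rw [← g.form_grad, form_sharp_right]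
  simp only [contract]
  rw [H.thomasD_bottom hd D hE]
  simp only [thomasD, splitting, LinearMap.smul_apply, LinearMap.coe_mk, AddHom.coe_mk, H.sharp,
    map_smul, map_add, D.leibniz, hE, inv_differential, hdd, k2]
  rw [show g.sharp (differential Υ) = g.grad Υ from rfl]
  generalize g.laplacian D V = L
  generalize D.cov (g.grad Υ) V = N
  generalize D.cov (g.sharp T.2.1) V = K
  generalize T.2.1 (g.grad Υ) = a
  generalize g.grad Υ Υ = u
  generalize g.schoutenTrace d = J
  simp only [map_mul, map_sub, map_add, map_ofNat]
  generalize algebraMap ℝ A w = p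
  generalize algebraMap ℝ A d = δ
  generalize algebraMap ℝ A (1 / 2) = m at *
  obtain ⟨s, μ, ρ⟩ := T
  simp only
  match_scalars
  · linear_combination ((δ + 2 * p - 2) * (p * a + s * p * u)
      + s * (-(p * J) - m * u * (δ + 2 * p - 2) * p)) * Ω' * E * h1
      - E * Ω' * (δ + 2 * p - 2) * s * p * u * h2
  · linear_combination E * Ω' * (δ + 2 * p - 2) * h1
  · ring
  · linear_combination -(E * Ω' * s) * h1

theorem scaleTractor (H : IsConformalChange g g' Υ Ω Ω')
    (hd : 3 ≤ d) (σ : A) :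
    g'.scaleTractor d (Ω * σ) = g.splitting Υ Ω Ω' (g.scaleTractor d σ) := by
  have hΩ : ∀ X : VectorField A, X Ω = algebraMap ℝ A 1 * Ω * X Υ := fun X => by
    rw [H.deriv, map_one, one_mul]
  have hdd : ∀ Y : VectorField A, differential Υ Y = Y Υ := fun _ => rfl
  rw [PseudoRiemMetric.scaleTractor, PseudoRiemMetric.scaleTractor, map_smul]
  congr 1
  refine Prod.ext ?_ (Prod.ext (LinearMap.ext fun X => ?_) ?_)
  · simp only [thomasD, splitting, LinearMap.coe_mk, AddHom.coe_mk, smul_eq_mul]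
    ring
  · simp only [thomasD, splitting, LinearMap.coe_mk, AddHom.coe_mk, smul_eq_mul,
      LinearMap.smul_apply, LinearMap.add_apply, hdd, trivialConnection, Derivation.leibniz,
      H.deriv, mul_one]
    ring
  · have h := H.thomasD_bottom hd trivialConnection hΩ σ
    rw [smul_eq_mul] at h
    rw [h]
    simp only [splitting, LinearMap.coe_mk, AddHom.coe_mk, inv_differential, smul_eq_mul]
    rw [show differential Υ (g.grad Υ) = g.grad Υ Υ from rfl]
    generalize (g.thomasD d trivialConnection 1 σ).2.2 = c
    generalize (g.thomasD d trivialConnection 1 σ).2.1 (g.grad Υ) = b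
    generalize (g.thomasD d trivialConnection 1 σ).1 = a
    linear_combination (Ω' * (c - b - algebraMap ℝ A (1 / 2) * g.grad Υ Υ * a)) * H.mul_inv

theorem scaleSq (H : IsConformalChange g g' Υ Ω Ω')
    (hd : 3 ≤ d) (σ : A) : g'.scaleSq d (Ω * σ) = g.scaleSq d σ := by
  rw [PseudoRiemMetric.scaleSq, H.scaleTractor hd, H.tractorMetric]
  rfl

/-- Pull-back to the scale `g` turns the tractor connection of `g'` into that of `g`, after which
`contract_thomasD` applies with a single connection. -/
theorem degenerateLaplacian (H : IsConformalChange g g' Υ Ω Ω')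
    (hd : 3 ≤ d) {r : ℕ}
    [∀ g : PseudoRiemMetric A, IsTraceForm g.form (TractorTensor A r)] {E : A} {w : ℝ}
    (hE : ∀ X : VectorField A, X E = algebraMap ℝ A w * E * X Υ) (σ : A) {F F' : TractorTensor A r}
    (hF : pullback (g.splitting Υ Ω Ω') r F' = E • F) :
    pullback (g.splitting Υ Ω Ω') r (g'.degenerateLaplacian d (Ω * σ) w F') =
      (E * Ω') • g.degenerateLaplacian d σ w F := by
  rw [PseudoRiemMetric.degenerateLaplacian, PseudoRiemMetric.degenerateLaplacian,
    H.scaleTractor hd, g'.map_contract_thomasD (D := g.tensorConnection d r) _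
      (pullback_covTensor (H.tractorConnection (H.schouten hd))), hF, H.contract_thomasD hd _ hE]

theorem yOp (H : IsConformalChange g g' Υ Ω Ω')
    (hd : 3 ≤ d) {r : ℕ}
    [∀ g : PseudoRiemMetric A, IsTraceForm g.form (TractorTensor A r)] {E : A} {w : ℝ}
    (hE : ∀ X : VectorField A, X E = algebraMap ℝ A w * E * X Υ) (σ : A) {F F' : TractorTensor A r}
    (hF : pullback (g.splitting Υ Ω Ω') r F' = E • F) :
    pullback (g.splitting Υ Ω Ω') r (g'.yOp d (Ω * σ) w F') = (E * Ω') • g.yOp d σ w F := by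
  rw [PseudoRiemMetric.yOp, PseudoRiemMetric.yOp, map_neg, map_smul,
    H.degenerateLaplacian hd hE σ hF, H.scaleSq hd, smul_neg, smul_comm]

theorem yPow (H : IsConformalChange g g' Υ Ω Ω')
    (hd : 3 ≤ d) {r : ℕ}
    [∀ g : PseudoRiemMetric A, IsTraceForm g.form (TractorTensor A r)] {E : ℝ → A}
    (hE : ∀ w, ∀ X : VectorField A, X (E w) = algebraMap ℝ A w * E w * X Υ)
    (hE' : ∀ w, E w * Ω' = E (w - 1)) (σ : A) (k : ℕ) (w : ℝ) {F F' : TractorTensor A r}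
    (hF : pullback (g.splitting Υ Ω Ω') r F' = E w • F) :
    pullback (g.splitting Υ Ω Ω') r (g'.yPow d (Ω * σ) k w F') =
      E (w - k) • g.yPow d σ k w F := by
  induction k generalizing w F F' with
  | zero => simpa [PseudoRiemMetric.yPow] using hF
  | succ k ih =>
    have h := ih (w - 1) ((H.yOp hd (hE w) σ hF).trans (by rw [hE']))
    rw [show w - 1 - (k : ℝ) = w - ((k + 1 : ℕ) : ℝ) by push_cast; ring] at h
    exact h

end IsConformalChange

end Thomas

/-! ### Natural endomorphisms are parallel -/

/-- The failure of `X` to commute with the trace is `A`-linear in `B`, the Leibniz terms cancelling,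
so it is determined by rank-one forms; on these it vanishes by `hD`. -/
theorem derivation_formTrace {V : Type*} [AddCommGroup V] [Module A V]
    {b : V →ₗ[A] V →ₗ[A] A} [IsTraceForm b A]
    (D : Connection (A := A) V) (X : VectorField A)
    (hD : ∀ v v', X (b v v') = b (D.cov X v) v' + b v (D.cov X v'))
    (B B' : V →ₗ[A] V →ₗ[A] A)
    (hB : ∀ v v', B' v v' = X (B v v') - B (D.cov X v) v' - B v (D.cov X v')) :
    X (formTrace b B) = formTrace b B' := by
  let c : (V →ₗ[A] V →ₗ[A] A) → (V →ₗ[A] V →ₗ[A] A) := fun B =>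
    LinearMap.mk₂ A (fun v v' => X (B v v') - B (D.cov X v) v' - B v (D.cov X v'))
      (fun v v' u => by
        simp only [map_add, LinearMap.add_apply, D.add_right]; ring)
      (fun f v u => by
        simp only [map_smul, map_add, LinearMap.smul_apply, LinearMap.add_apply, D.leibniz,
          smul_eq_mul, Derivation.leibniz]
        ring)
      (fun v u u' => by
        simp only [map_add, D.add_right]; ring)
      (fun f v u => by
        simp only [map_smul, map_add, D.leibniz, smul_eq_mul, Derivation.leibniz]
        ring)
  have hc : ∀ B v v', c B v v' = X (B v v') - B (D.cov X v) v' - B v (D.cov X v') :=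
    fun _ _ _ => rfl
  let u : (V →ₗ[A] V →ₗ[A] A) →ₗ[A] A :=
    { toFun := fun B => X (formTrace b B) - formTrace b (c B)
      map_add' := fun B C => by
        have h : c (B + C) = c B + c C := LinearMap.ext fun v => LinearMap.ext fun v' => by
          simp only [hc, LinearMap.add_apply, map_add]; ring
        rw [h, map_add, map_add, map_add]; ring
      map_smul' := fun f B => by
        have h : c (f • B) = f • c B + X f • B := LinearMap.ext fun v => LinearMap.ext fun v' => by
          simp only [hc, LinearMap.add_apply, LinearMap.smul_apply, smul_eq_mul,
            Derivation.leibniz]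
          ring
        rw [h, map_add, (formTrace b).map_smul, (formTrace b).map_smul, (formTrace b).map_smul]
        simp only [smul_eq_mul, RingHom.id_apply, Derivation.leibniz]
        ring }
  have hu : u = 0 := by
    refine IsTraceForm.ext_rankOne (b := b) _ _ fun v v' s => ?_
    have h : c (rankOne b v v' s) = rankOne b (D.cov X v) v' s + rankOne b v (D.cov X v') s
        + rankOne b v v' (X s) := LinearMap.ext fun y => LinearMap.ext fun y' => by
      simp only [hc, LinearMap.add_apply, rankOne_apply, smul_eq_mul, Derivation.leibniz, hD]
      ring
    change X (formTrace b (rankOne b v v' s)) - formTrace b (c (rankOne b v v' s)) = 0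
    rw [h, map_add, map_add]
    simp only [IsTraceForm.formTrace_rankOne, smul_eq_mul, Derivation.leibniz, hD]
    ring
  have h1 : X (formTrace b B) - formTrace b (c B) = 0 := congrArg (fun u => u B) hu
  rw [sub_eq_zero.1 h1]
  congr 1
  exact LinearMap.ext fun v => LinearMap.ext fun v' => (hB v v').symm

theorem covTensor_apply (g : PseudoRiemMetric A) (d : ℕ) {r : ℕ} (X : VectorField A)
    (F : TractorTensor A r) (T : Fin r → TractorField A) : g.covTensor d X F T = X (F T) -
      ∑ i, F (Function.update T i ((g.tractorConnection d).cov X (T i))) := rfl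

theorem covTensor_perm (g : PseudoRiemMetric A) (d : ℕ) {r : ℕ} (e : Equiv.Perm (Fin r))
    (K : Module.End A (TractorTensor A r)) (hK : ∀ F T, K F T = F (T ∘ e)) (X : VectorField A)
    (F : TractorTensor A r) : K (g.covTensor d X F) = g.covTensor d X (K F) := by
  refine MultilinearMap.ext fun T => ?_
  rw [hK, covTensor_apply, covTensor_apply, hK]
  congr 1
  refine Eq.trans ?_ (Equiv.sum_comp e _)
  refine Finset.sum_congr rfl fun i _ => ?_
  rw [hK]
  congr 1
  exact (Function.update_comp_eq_of_injective T e.injective i _).symm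

theorem sum_eq_of_two {ι : Type*} [Fintype ι] [DecidableEq ι] {N : Type*} [AddCommGroup N]
    {u v : ι → N} {i j : ι} (hij : i ≠ j) (h : ∀ l, l ≠ i → l ≠ j → u l = v l) :
    ∑ l, u l = ∑ l, v l + (u i - v i) + (u j - v j) := by
  have h1 : ∑ l, (u l - v l) = ∑ l ∈ {i, j}, (u l - v l) := by
    refine (Finset.sum_subset (Finset.subset_univ _) fun l _ hl => ?_).symm
    simp only [Finset.mem_insert, Finset.mem_singleton, not_or] at hl
    rw [h l hl.1 hl.2, sub_self]
  rw [Finset.sum_pair hij, Finset.sum_sub_distrib] at h1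
  rw [add_assoc, ← h1]
  abel

/-- The tractor metric is parallel, and hence so is its trace by `derivation_formTrace`. The rest is
bookkeeping of the slots in which the connection acts. -/
theorem covTensor_contraction (g : PseudoRiemMetric A) [IsTraceForm g.tractorMetric A] (d : ℕ)
    {r : ℕ} (i j : Fin r) (hij : i ≠ j) (K : Module.End A (TractorTensor A r))
    (hK : ∀ F T, K F T = g.tractorMetric (T i) (T j) *
      formTrace g.tractorMetric (PseudoRiemMetric.slotForm F T i j hij))
    (X : VectorField A) (F : TractorTensor A r) :
    K (g.covTensor d X F) = g.covTensor d X (K F) := by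
  refine MultilinearMap.ext fun T => ?_
  set D := g.tractorConnection d with hDdef
  set T' : Fin r → Fin r → TractorField A := fun l => Function.update T l (D.cov X (T l)) with hT'
  set B := PseudoRiemMetric.slotForm F T i j hij with hB
  set C : Fin r → TractorField A →ₗ[A] TractorField A →ₗ[A] A :=
    fun l => PseudoRiemMetric.slotForm F (T' l) i j hij with hC
  have hslot : ∀ (F : TractorTensor A r) T a b, PseudoRiemMetric.slotForm F T i j hij a b =
    F (Function.update (Function.update T i a) j b) := fun _ _ _ _ => rfl
  have hCi : C i = B := LinearMap.ext fun a => LinearMap.ext fun b => by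
    simp only [hC, hB, hslot, hT', Function.update_idem]
  have hCj : C j = B := LinearMap.ext fun a => LinearMap.ext fun b => by
    simp only [hC, hB, hslot, hT']
    rw [Function.update_comm hij.symm, Function.update_idem]
  -- In `∑ l, C l` the terms `l = i` and `l = j` both equal `B`, since their slots are overwritten.
  -- Only the other arguments should be differentiated there, hence the subtraction of `2 • B`.
  have hcov : X (formTrace g.tractorMetric B) =
      formTrace g.tractorMetric (PseudoRiemMetric.slotForm (g.covTensor d X F) T i j hij +
        ∑ l, C l - (2 : A) • B) := by
    refine derivation_formTrace D X
      (g.tractorConnection_metric d X) B _ fun a b => ?_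
    have hsum : ∑ l, F (Function.update (Function.update (Function.update T i a) j b) l
          (D.cov X (Function.update (Function.update T i a) j b l))) =
        ∑ l, C l a b + (B (D.cov X a) b - B a b) + (B a (D.cov X b) - B a b) := by
      have := sum_eq_of_two (u := fun l =>
        F (Function.update (Function.update (Function.update T i a) j b) l
          (D.cov X (Function.update (Function.update T i a) j b l))))
        (v := fun l => C l a b) hij (fun l hi hj => by
          simp only [hC, hslot, hT', Function.update_of_ne hj, Function.update_of_ne hi]
          rw [Function.update_comm hj.symm, Function.update_comm hi.symm])
      rw [this, hCi, hCj]
      congr 2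
      · congr 1
        simp only [hB, hslot, Function.update_of_ne hij, Function.update_self]
        rw [Function.update_comm hij.symm, Function.update_idem]
      · simp only [hB, hslot, Function.update_self, Function.update_idem]
    have hs : (∑ l, C l) a b = ∑ l, C l a b := by simp only [LinearMap.sum_apply]
    simp only [LinearMap.sub_apply, LinearMap.add_apply, LinearMap.smul_apply, smul_eq_mul, hs]
    rw [hslot, covTensor_apply, hsum]
    simp only [hB, hslot]
    ring
  have hKsum : ∑ l, K F (T' l) = ∑ l, g.tractorMetric (T i) (T j) * formTrace g.tractorMetric (C l)
      + (g.tractorMetric (D.cov X (T i)) (T j) - g.tractorMetric (T i) (T j))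
        * formTrace g.tractorMetric B
      + (g.tractorMetric (T i) (D.cov X (T j)) - g.tractorMetric (T i) (T j))
        * formTrace g.tractorMetric B := by
    have := sum_eq_of_two (u := fun l => K F (T' l))
      (v := fun l => g.tractorMetric (T i) (T j) * formTrace g.tractorMetric (C l)) hij
      (fun l hi hj => by
        simp only [hK, hT', Function.update_of_ne hi.symm, Function.update_of_ne hj.symm, hC])
    rw [this]
    simp only [hK]
    change _ + (g.tractorMetric (T' i i) (T' i j) * formTrace g.tractorMetric (C i) -
      g.tractorMetric (T i) (T j) * formTrace g.tractorMetric (C i)) +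
      (g.tractorMetric (T' j i) (T' j j) * formTrace g.tractorMetric (C j) -
      g.tractorMetric (T i) (T j) * formTrace g.tractorMetric (C j)) = _
    rw [hCi, hCj]
    simp only [hT', Function.update_self, Function.update_of_ne hij, Function.update_of_ne hij.symm]
    ring
  rw [formTrace_sub, map_add, map_sum, map_smul, smul_eq_mul] at hcov
  rw [hK, covTensor_apply, hKsum, hK, Derivation.leibniz, hcov,
    g.tractorConnection_metric d X (T i) (T j), ← Finset.mul_sum]
  simp only [smul_eq_mul]
  ring

end Invariance

/-! ## Differential operators over a commutative ring -/

section Order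

variable {A V : Type*} [CommRing A] [AddCommGroup V] [Module A V]

/-- Multiplication by a ring element. -/
def mulHom (V : Type*) [AddCommGroup V] [Module A V] (f : A) : V →+ V :=
  DistribSMul.toAddMonoidHom V f

/-- The commutator of an additive operator with the multiplication by `f`. -/
def commutator (O : V →+ V) (f : A) : V →+ V := O.comp (mulHom V f) - (mulHom V f).comp O

theorem commutator_apply (O : V →+ V) (f : A) (v : V) : commutator O f v = O (f • v) - f • O v :=
  rfl

variable (A) in
/-- Differential operators of order at most `m`. -/
def IsOrder : ℕ → (V →+ V) → Prop
  | 0, O => ∀ (f : A) v, O (f • v) = f • O v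
  | m + 1, O => ∀ f : A, IsOrder m (commutator O f)

namespace IsOrder

theorem add {m : ℕ} {O O' : V →+ V} (h : IsOrder A m O) (h' : IsOrder A m O') :
    IsOrder A m (O + O') := by
  induction m generalizing O O' with
  | zero =>
    intro f v
    rw [AddMonoidHom.add_apply, h, h', AddMonoidHom.add_apply, smul_add]
  | succ m ih =>
    intro f
    have : commutator (O + O') f = commutator O f + commutator O' f := by
      ext v
      simp only [commutator_apply, AddMonoidHom.add_apply, smul_add]
      abel
    rw [this]
    exact ih (h f) (h' f)

theorem comp_zero_left {m : ℕ} {O O' : V →+ V} (h : IsOrder A 0 O) (h' : IsOrder A m O') :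
    IsOrder A m (O.comp O') := by
  induction m generalizing O' with
  | zero =>
    intro f v
    rw [AddMonoidHom.comp_apply, h', h, AddMonoidHom.comp_apply]
  | succ m ih =>
    intro f
    have : commutator (O.comp O') f = O.comp (commutator O' f) := by
      ext v
      simp only [commutator_apply, AddMonoidHom.comp_apply, map_sub, h f]
    rw [this]
    exact ih (h' f)

/-- Induction on both orders, through `[O O', f] = O [O', f] + [O, f] O'`. -/
theorem comp {m m' : ℕ} {O O' : V →+ V} (h : IsOrder A m O) (h' : IsOrder A m' O') :
    IsOrder A (m + m') (O.comp O') := by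
  induction m generalizing O O' m' with
  | zero => rw [zero_add]; exact comp_zero_left h h'
  | succ m ih =>
    induction m' generalizing O O' with
    | zero =>
      intro f
      have : commutator (O.comp O') f = (commutator O f).comp O' := by
        ext v
        simp only [commutator_apply, AddMonoidHom.comp_apply, h' f]
      rw [this]
      exact ih (h f) h'
    | succ m' ih' =>
      rw [show m + 1 + (m' + 1) = m + (m' + 1) + 1 by omega]
      intro f
      have : commutator (O.comp O') f = O.comp (commutator O' f) + (commutator O f).comp O' := by
        ext v
        simp only [commutator_apply, AddMonoidHom.comp_apply, AddMonoidHom.add_apply, map_sub]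
        abel
      rw [this]
      refine add ?_ ?_
      · have h1 := ih' h (h' f)
        rwa [show m + 1 + m' = m + (m' + 1) by ring] at h1
      · exact ih (h f) h'

end IsOrder

end Order

/-! ## The degenerate Laplacian in a scale -/

section Scale

open PseudoRiemMetric

variable {A : Type*} [CommRing A] [Algebra ℝ A] (g : PseudoRiemMetric A) (d : ℕ) (σ : A)

theorem hessian_add {S : Type*} [AddCommGroup S] [Module A S] (D : Connection (A := A) S)
    (s t : S) : g.hessian D (s + t) = g.hessian D s + g.hessian D t := by
  refine LinearMap.ext fun X => LinearMap.ext fun Y => ?_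
  change D.cov X (D.cov Y (s + t)) - D.cov (g.leviCivita.cov X Y) (s + t) =
    D.cov X (D.cov Y s) - D.cov (g.leviCivita.cov X Y) s
      + (D.cov X (D.cov Y t) - D.cov (g.leviCivita.cov X Y) t)
  rw [D.add_right, D.add_right, D.add_right]
  abel

theorem degenerateLaplacian_add {r : ℕ} (w : ℝ) (F G : TractorTensor A r) :
    g.degenerateLaplacian d σ w (F + G) =
      g.degenerateLaplacian d σ w F + g.degenerateLaplacian d σ w G := by
  simp only [degenerateLaplacian, contract, thomasD, laplacian, hessian_add, map_add,
    LinearMap.smul_apply, LinearMap.coe_mk, AddHom.coe_mk, Connection.add_right]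
  module

/-- The operator `-(1/I²) I·D` as an additive map. -/
def yHom {r : ℕ} (w : ℝ) : TractorTensor A r →+ TractorTensor A r :=
  AddMonoidHom.mk' (g.yOp d σ w) fun F G => by
    simp only [yOp, degenerateLaplacian_add, smul_add]
    abel

/-- The power of `-(1/I²) I·D` as an additive map. -/
def yPowHom {r : ℕ} : ℕ → ℝ → (TractorTensor A r →+ TractorTensor A r)
  | 0, _ => AddMonoidHom.id _
  | k + 1, w => (yPowHom k (w - 1)).comp (yHom g d σ w)

theorem yPowHom_apply {r : ℕ} (k : ℕ) (w : ℝ) (F : TractorTensor A r) :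
    yPowHom g d σ k w F = g.yPow d σ k w F := by
  induction k generalizing w F with
  | zero => rfl
  | succ k ih => exact ih (w - 1) _

theorem scaleTractor_fst (hd : d ≠ 0) : (g.scaleTractor d σ).1 = σ := by
  have hd' : (d : ℝ) ≠ 0 := by exact_mod_cast hd
  change algebraMap ℝ A (1 / (d : ℝ)) * (algebraMap ℝ A (((d : ℝ) + 2 * 1 - 2) * 1) * σ) = σ
  rw [← mul_assoc, ← map_mul, show 1 / (d : ℝ) * (((d : ℝ) + 2 * 1 - 2) * 1) = 1 by field_simp; ring,
    map_one, one_mul]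

theorem scaleTractor_snd (hd : d ≠ 0) : (g.scaleTractor d σ).2.1 = differential σ := by
  have hd' : (d : ℝ) ≠ 0 := by exact_mod_cast hd
  refine LinearMap.ext fun X => ?_
  change algebraMap ℝ A (1 / (d : ℝ)) * (algebraMap ℝ A ((d : ℝ) + 2 * 1 - 2) * X σ) = X σ
  rw [← mul_assoc, ← map_mul, show 1 / (d : ℝ) * ((d : ℝ) + 2 * 1 - 2) = 1 by field_simp; ring,
    map_one, one_mul]

/-- This relation converts the Laplacian of `σ`, which arises on commuting with `σ`, into a
contribution to `I²`. -/
theorem algebraMap_mul_scaleTractor (hd : d ≠ 0) :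
    algebraMap ℝ A d * (g.scaleTractor d σ).2.2 =
      -(g.laplacian trivialConnection σ + g.schoutenTrace d * σ) := by
  have hd' : (d : ℝ) ≠ 0 := by exact_mod_cast hd
  change algebraMap ℝ A d * (algebraMap ℝ A (1 / (d : ℝ)) * -(g.laplacian trivialConnection σ
    + algebraMap ℝ A 1 * g.schoutenTrace d * σ)) = _
  rw [← mul_assoc, ← map_mul, mul_one_div_cancel hd', map_one, one_mul, one_mul]

theorem scaleSq_eq (hd : d ≠ 0) :
    g.scaleSq d σ = g.grad σ σ + 2 * (σ * (g.scaleTractor d σ).2.2) := by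
  rw [scaleSq, tractorMetric_apply, scaleTractor_fst g d σ hd, scaleTractor_snd g d σ hd,
    inv_differential]
  change g.grad σ σ + _ + _ = _
  ring

theorem degenerateLaplacian_eq (hd : d ≠ 0) {r : ℕ} (w : ℝ) (F : TractorTensor A r) :
    g.degenerateLaplacian d σ w F =
      algebraMap ℝ A ((d : ℝ) + 2 * w - 2) • (g.tensorConnection d r).cov (g.grad σ) F
      + σ • -(g.laplacian (g.tensorConnection d r) F + (algebraMap ℝ A w * g.schoutenTrace d) • F)
      + (g.scaleTractor d σ).2.2 • (algebraMap ℝ A (((d : ℝ) + 2 * w - 2) * w) • F) := by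
  rw [degenerateLaplacian, contract, scaleTractor_fst g d σ hd, scaleTractor_snd g d σ hd]
  rfl

variable [∀ g : PseudoRiemMetric A, IsTraceForm g.form A] {r : ℕ}
  [∀ g : PseudoRiemMetric A, IsTraceForm g.form (TractorTensor A r)]

theorem degenerateLaplacian_smul (hd : d ≠ 0) (w : ℝ) (f : A) (F : TractorTensor A r) :
    g.degenerateLaplacian d σ w (f • F) = f • g.degenerateLaplacian d σ w F
      + (algebraMap ℝ A ((d : ℝ) + 2 * w - 2) * g.grad σ f
        - σ * g.laplacian trivialConnection f) • F
      - (2 * σ) • (g.tensorConnection d r).cov (g.grad f) F := by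
  rw [degenerateLaplacian_eq g d σ hd, degenerateLaplacian_eq g d σ hd, laplacian_smul,
    Connection.leibniz]
  module

/-- By `degenerateLaplacian_smul` the first commutator is a first-order operator, and the second is
a multiplication. -/
theorem isOrder_degenerateLaplacian (hd : d ≠ 0) (w : ℝ) :
    IsOrder A 2 (AddMonoidHom.mk' (g.degenerateLaplacian d σ w (r := r))
      (degenerateLaplacian_add g d σ w)) := by
  intro f f' f'' F
  simp only [commutator_apply, AddMonoidHom.mk'_apply, degenerateLaplacian_smul g d σ hd w,
    Connection.leibniz, smul_sub, smul_add]
  module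

theorem isOrder_yHom (hd : d ≠ 0) (w : ℝ) : IsOrder A 2 (yHom g d σ w (r := r)) := by
  have h : yHom g d σ w (r := r) = (mulHom _ (-(Ring.inverse (g.scaleSq d σ)))).comp
      (AddMonoidHom.mk' (g.degenerateLaplacian d σ w (r := r))
      (degenerateLaplacian_add g d σ w)) := by
    exact AddMonoidHom.ext fun F => (neg_smul _ _).symm
  rw [h]
  exact IsOrder.comp_zero_left (fun f v => smul_comm _ _ _)
    (isOrder_degenerateLaplacian g d σ hd w)

theorem isOrder_yPowHom (hd : d ≠ 0) (k : ℕ) (w : ℝ) :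
    IsOrder A (2 * k) (yPowHom g d σ k w (r := r)) := by
  induction k generalizing w with
  | zero => exact fun _ _ => rfl
  | succ k ih => exact (ih (w - 1)).comp (isOrder_yHom g d σ hd w)

/-- The commutator of `I·D` with the multiplication by `σ`. -/
theorem degenerateLaplacian_mul_scale (hd : d ≠ 0) (w : ℝ) (F : TractorTensor A r) :
    g.degenerateLaplacian d σ (w + 1) (σ • F) = σ • g.degenerateLaplacian d σ w F
      + (algebraMap ℝ A ((d : ℝ) + 2 * w) * g.scaleSq d σ) • F := by
  have h := algebraMap_mul_scaleTractor g d σ hd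
  rw [degenerateLaplacian_eq g d σ hd, degenerateLaplacian_eq g d σ hd, laplacian_smul,
    Connection.leibniz, scaleSq_eq g d σ hd]
  simp only [map_mul, map_add, map_sub, map_ofNat, map_one] at h ⊢
  generalize g.laplacian (g.tensorConnection d r) F = L at *
  generalize (g.tensorConnection d r).cov (g.grad σ) F = N at *
  generalize g.laplacian trivialConnection σ = l at *
  generalize g.grad σ σ = u at *
  generalize g.schoutenTrace d = J at *
  generalize (g.scaleTractor d σ).2.2 = ρ at *
  generalize algebraMap ℝ A w = p at *
  generalize algebraMap ℝ A d = δ at *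
  -- The Laplacian and gradient terms of `F` cancel. In the coefficient of `F`, `d · ρ = -(Δσ + Jσ)`
  -- turns `-σ (Δσ + Jσ) + (d + 4w) σ ρ` into `2 (d + 2w) σ ρ`.
  match_scalars
  · linear_combination -σ * h
  · ring
  · ring

/-- The `sl(2)` relation `[y, σ] = -(d + 2w)`: dividing by `I²` leaves a real constant in the
commutator. -/
theorem yOp_mul_scale (hd : d ≠ 0) (hI : IsUnit (g.scaleSq d σ)) (w : ℝ) (F : TractorTensor A r) :
    g.yOp d σ (w + 1) (σ • F) = σ • g.yOp d σ w F - algebraMap ℝ A ((d : ℝ) + 2 * w) • F := by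
  rw [yOp, yOp, degenerateLaplacian_mul_scale g d σ hd]
  have h := Ring.inverse_mul_cancel _ hI
  generalize Ring.inverse (g.scaleSq d σ) = q at *
  generalize g.scaleSq d σ = I at *
  generalize algebraMap ℝ A ((d : ℝ) + 2 * w) = c at *
  match_scalars
  · ring
  · linear_combination (-c) * h

theorem yOp_real_smul (hd : d ≠ 0) (w t : ℝ) (F : TractorTensor A r) :
    g.yOp d σ w (algebraMap ℝ A t • F) = algebraMap ℝ A t • g.yOp d σ w F := by
  have h1 : g.grad (algebraMap ℝ A t) = 0 := g.ext_form fun Z => by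
    rw [form_grad, Derivation.map_algebraMap, map_zero, LinearMap.zero_apply]
  have h2 : g.hess (algebraMap ℝ A t) = 0 := LinearMap.ext fun X => LinearMap.ext fun Y => by
    rw [hess_apply, Derivation.map_algebraMap, Derivation.map_algebraMap, map_zero, sub_zero]
    rfl
  have h3 : g.laplacian trivialConnection (algebraMap ℝ A t) = 0 := by
    change formTrace g.form (g.hess _) = 0
    rw [h2, map_zero]
  have h4 : (g.tensorConnection d r).cov 0 F = 0 := by
    have := (g.tensorConnection d r).smul_left 0 0 F
    rwa [zero_smul, zero_smul] at this
  rw [yOp, yOp, degenerateLaplacian_smul g d σ hd, h1, h3, h4, Derivation.map_algebraMap]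
  module

theorem yPow_real_smul (hd : d ≠ 0) (k : ℕ) (w t : ℝ) (F : TractorTensor A r) :
    g.yPow d σ k w (algebraMap ℝ A t • F) = algebraMap ℝ A t • g.yPow d σ k w F := by
  induction k generalizing w F with
  | zero => rfl
  | succ k ih =>
    change g.yPow d σ k (w - 1) (g.yOp d σ w _) = _ • g.yPow d σ k (w - 1) (g.yOp d σ w _)
    rw [yOp_real_smul g d σ hd, ih]

theorem yPow_sub (k : ℕ) (w : ℝ) (F G : TractorTensor A r) :
    g.yPow d σ k w (F - G) = g.yPow d σ k w F - g.yPow d σ k w G := by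
  simp only [← yPowHom_apply, map_sub]

/-- The factors act on `F` at the weights `w, w - 1, …, w - k`, so moving `σ` past all of them adds
up `∑_{j ≤ k} (d + 2 (w - j)) = (k + 1) (d + 2w - k)`. -/
theorem yPow_succ_mul_scale (hd : d ≠ 0) (hI : IsUnit (g.scaleSq d σ)) (k : ℕ) (w : ℝ)
    (F : TractorTensor A r) : g.yPow d σ (k + 1) (w + 1) (σ • F) = σ • g.yPow d σ (k + 1) w F
      - algebraMap ℝ A ((k + 1) * ((d : ℝ) + 2 * w - k)) • g.yPow d σ k w F := by
  induction k generalizing w F with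
  | zero =>
    change g.yOp d σ (w + 1) (σ • F) = σ • g.yOp d σ w F - _ • F
    rw [yOp_mul_scale g d σ hd hI]
    congr 3
    push_cast
    ring
  | succ k ih =>
    have h1 : g.yPow d σ (k + 1 + 1) (w + 1) (σ • F) =
        g.yPow d σ (k + 1) (w - 1 + 1) (σ • g.yOp d σ w F)
          - algebraMap ℝ A ((d : ℝ) + 2 * w) • g.yPow d σ (k + 1) w F := by
      change g.yPow d σ (k + 1) (w + 1 - 1) (g.yOp d σ (w + 1) (σ • F)) = _
      rw [yOp_mul_scale g d σ hd hI, yPow_sub, yPow_real_smul g d σ hd, sub_add_cancel,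
        add_sub_cancel_right]
    rw [h1, ih]
    change σ • g.yPow d σ (k + 1 + 1) w F - _ • g.yPow d σ (k + 1) w F - _ = _
    rw [sub_sub, ← add_smul, ← map_add]
    congr 3
    push_cast
    ring

/-- At the weight `w = (k + 2 - d) / 2` the power of order `k` commutes with `σ`. -/
theorem yPow_mul_scale (hd : d ≠ 0) (hI : IsUnit (g.scaleSq d σ)) {k : ℕ} (hk : 1 ≤ k) {w : ℝ}
    (hw : 2 * w = k + 1 - d) (F : TractorTensor A r) :
    g.yPow d σ k w (σ • F) = σ • g.yPow d σ k (w - 1) F := by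
  -- With the power written as `k + 1` and `F` at weight `w - 1`, the coefficient contains `d + 2 (w
  -- - 1) - k`, which is zero by `hw`.
  obtain ⟨k, rfl⟩ := Nat.exists_eq_add_of_le' hk
  have h := yPow_succ_mul_scale g d σ hd hI k (w - 1) F
  rw [sub_add_cancel] at h
  push_cast at hw
  rw [h, show (d : ℝ) + 2 * (w - 1) - k = 0 by linarith, mul_zero, map_zero, zero_smul, sub_zero]

/-- A parallel linear map commutes with the powers of `-(1/I²) I·D`. -/
theorem map_yPow (K : TractorTensor A r →ₗ[A] TractorTensor A r)
    (hK : ∀ X F, K (g.covTensor d X F) = g.covTensor d X (K F)) (k : ℕ) (w : ℝ)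
    (F : TractorTensor A r) : K (g.yPow d σ k w F) = g.yPow d σ k w (K F) := by
  induction k generalizing w F with
  | zero => rfl
  | succ k ih =>
    change K (g.yPow d σ k (w - 1) (g.yOp d σ w F)) = g.yPow d σ k (w - 1) (g.yOp d σ w (K F))
    rw [ih, yOp, yOp, map_neg, map_smul, degenerateLaplacian, degenerateLaplacian,
      g.map_contract_thomasD (D := g.tensorConnection d r) K hK]

end Scale

/-! ## Operators on sections of weighted tractor bundles -/

section Sections

variable {d : ℕ} {M : Type*} [TopologicalSpace M] [ChartedSpace (EuclideanSpace ℝ (Fin d)) M]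

theorem expFn_mul (a b : ℝ) (Υ : Fn d M) : expFn a Υ * expFn b Υ = expFn (a + b) Υ := by
  ext x
  change Real.exp (a * Υ x) * Real.exp (b * Υ x) = Real.exp ((a + b) * Υ x)
  rw [← Real.exp_add, add_mul]

theorem expFn_zero (Υ : Fn d M) : expFn 0 Υ = 1 := by
  ext x
  change Real.exp (0 * Υ x) = 1
  rw [zero_mul, Real.exp_zero]

/-! ### Real and imaginary parts -/

theorem ctensor_ext {r : ℕ} {F G : CTractorTensor d M r} (hre : reT F = reT G)
    (him : imT F = imT G) : F = G := by
  ext T x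
  exact Complex.ext (congrArg (fun f : Fn d M => f x) (DFunLike.congr_fun hre T))
    (congrArg (fun f : Fn d M => f x) (DFunLike.congr_fun him T))

theorem reT_complexify {r : ℕ} (O : TractorTensor (Fn d M) r → TractorTensor (Fn d M) r)
    (F : CTractorTensor d M r) : reT (complexify O F) = O (reT F) := by
  ext T x
  change ((O (reT F) T x : ℂ) + Complex.I * (O (imT F) T x : ℂ)).re = _
  simp

theorem imT_complexify {r : ℕ} (O : TractorTensor (Fn d M) r → TractorTensor (Fn d M) r)
    (F : CTractorTensor d M r) : imT (complexify O F) = O (imT F) := by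
  ext T x
  change ((O (reT F) T x : ℂ) + Complex.I * (O (imT F) T x : ℂ)).im = _
  simp

/-- The change of splitting as a linear map. -/
abbrev splittingChange (g : PseudoRiemMetric (Fn d M)) (Υ : Fn d M) :
    TractorField (Fn d M) →ₗ[Fn d M] TractorField (Fn d M) :=
  g.splitting Υ (expFn 1 Υ) (expFn (-1) Υ)

/-- The tensor calculus is real, so the law of a complex tensor is split into its two real parts, in
the form that `IsConformalChange.yPow` uses. -/
theorem changeSplitting_law_iff {r : ℕ} (g : PseudoRiemMetric (Fn d M)) (Υ e : Fn d M)
    (F F' : CTractorTensor d M r) :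
    (∀ T, F' (fun i => changeSplitting g Υ (T i)) = e • F T) ↔
      pullback (splittingChange g Υ) r (reT F') = e • reT F ∧
      pullback (splittingChange g Υ) r (imT F') = e • imT F := by
  constructor
  · intro h
    exact ⟨MultilinearMap.ext fun T => (congrArg reFn (h T)).trans (reFn.map_smul _ _),
      MultilinearMap.ext fun T => (congrArg imFn (h T)).trans (imFn.map_smul _ _)⟩
  · rintro ⟨hre, him⟩ T
    ext x
    refine Complex.ext ?_ ?_
    · exact (congrArg (fun f : Fn d M => f x) (DFunLike.congr_fun hre T)).trans
        (Complex.smul_re (e x) (F T x)).symm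
    · exact (congrArg (fun f : Fn d M => f x) (DFunLike.congr_fun him T)).trans
        (Complex.smul_im (e x) (F T x)).symm

variable {c : ConformalStructure d M} (Φ : TractorBundle c)

/-- The operator on sections that is given in each scale by the operator `O g` on real tensors. -/
def liftOp {w w' : ℝ}
    (O : c.metrics → (TractorTensor (Fn d M) Φ.rank →+ TractorTensor (Fn d M) Φ.rank))
    (hreal : ∀ g t F, O g (algebraMap ℝ (Fn d M) t • F) = algebraMap ℝ (Fn d M) t • O g F)
    (hproj : ∀ g F, Φ.proj g (O g F) = O g (Φ.proj g F))
    (hequiv : ∀ (g g' : c.metrics) (Υ : Fn d M), IsRescaling g.1 Υ g'.1 → ∀ F F',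
      pullback (splittingChange g.1 Υ) Φ.rank F' = expFn w Υ • F →
      pullback (splittingChange g.1 Υ) Φ.rank (O g' F') = expFn w' Υ • O g F) :
    sections Φ w →ₗ[ℂ] sections Φ w' where
  toFun F := ⟨fun g => complexify (O g) (F.1 g), by
    refine ⟨fun g g' Υ h => ?_, fun g => ⟨?_, ?_⟩⟩
    · have hF := (changeSplitting_law_iff _ _ _ _ _).1 (F.2.1 g g' Υ h)
      rw [changeSplitting_law_iff]
      simp only [reT_complexify, imT_complexify]
      exact ⟨hequiv g g' Υ h _ _ hF.1, hequiv g g' Υ h _ _ hF.2⟩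
    · rw [reT_complexify, hproj, (F.2.2 g).1]
    · rw [imT_complexify, hproj, (F.2.2 g).2]⟩
  map_add' F G := Subtype.ext <| funext fun g => by
    change complexify (O g) (F.1 g + G.1 g) = complexify (O g) (F.1 g) + complexify (O g) (G.1 g)
    refine ctensor_ext ?_ ?_
    · simp only [reT_add, reT_complexify, map_add]
    · simp only [imT_add, imT_complexify, map_add]
  map_smul' z F := Subtype.ext <| funext fun g => by
    change complexify (O g) (z • F.1 g) = z • complexify (O g) (F.1 g)
    refine ctensor_ext ?_ ?_
    · simp only [reT_smul, reT_complexify, imT_complexify, map_sub, hreal]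
    · simp only [imT_smul, reT_complexify, imT_complexify, map_add, hreal]

/-- An operator on sections that is given in each scale by an operator of order at most `m` is a
differential operator of order at most `m`. -/
theorem isDiffOp_of_isOrder {w w' : ℝ} {m : ℕ} (P : sections Φ w →ₗ[ℂ] sections Φ w')
    (O : c.metrics → (TractorTensor (Fn d M) Φ.rank →+ TractorTensor (Fn d M) Φ.rank))
    (hre : ∀ F g, reT ((P F).1 g) = O g (reT (F.1 g)))
    (him : ∀ F g, imT ((P F).1 g) = O g (imT (F.1 g)))
    (hO : ∀ g, IsOrder (Fn d M) m (O g)) :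
    IsDiffOp (V := sections Φ w) (W := sections Φ w') (mulFn Φ w) (mulFn Φ w') m P := by
  induction m generalizing P O with
  | zero =>
    intro f
    refine LinearMap.ext fun F => Subtype.ext <| funext fun g => ctensor_ext ?_ ?_
    · exact (hre (mulFn Φ w f F) g).trans (((congrArg (O g) (reT_fnSMul f (F.1 g))).trans
        ((hO g f _).trans (congrArg (f • ·) (hre F g).symm))).trans
          (reT_fnSMul f ((P F).1 g)).symm)
    · exact (him (mulFn Φ w f F) g).trans (((congrArg (O g) (imT_fnSMul f (F.1 g))).trans
        ((hO g f _).trans (congrArg (f • ·) (him F g).symm))).trans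
          (imT_fnSMul f ((P F).1 g)).symm)
  | succ m ih =>
    intro f
    -- The commutator of `P` with `f` is given in each scale by the commutator of `O g`, whose order
    -- is lower by one.
    refine ih _ (fun g => commutator (O g) f) (fun F g => ?_) (fun F g => ?_) fun g => hO g f
    · exact congrArg₂ (· - ·) ((hre (mulFn Φ w f F) g).trans
        (congrArg (O g) (reT_fnSMul f (F.1 g))))
        ((reT_fnSMul f ((P F).1 g)).trans (congrArg (f • ·) (hre F g)))
    · exact congrArg₂ (· - ·) ((him (mulFn Φ w f F) g).trans
        (congrArg (O g) (imT_fnSMul f (F.1 g))))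
        ((imT_fnSMul f ((P F).1 g)).trans (congrArg (f • ·) (him F g)))

variable [T2Space M] [IsManifold (𝓡 d) ∞ M]

theorem IsRescaling.isConformalChange {g g' : PseudoRiemMetric (Fn d M)} {Υ : Fn d M}
    (h : IsRescaling g Υ g') : IsConformalChange g g' Υ (expFn 1 Υ) (expFn (-1) Υ) where
  form X Y := by rw [h X Y, expFn_mul]; norm_num
  mul_inv := by rw [expFn_mul, add_neg_cancel, expFn_zero]
  deriv X := by rw [derivation_expFn, map_one, one_mul]
  deriv_inv X := by rw [derivation_expFn, map_neg, map_one]; ring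

instance (g : PseudoRiemMetric (Fn d M)) : IsTraceForm g.tractorMetric (Fn d M) :=
  isTraceForm g.tractorMetric_comm g.tractorMetric_surjective

/-- Natural endomorphisms are parallel for the tractor connection. -/
theorem IsNaturalEnd.covTensor {r : ℕ}
    {K : c.metrics → Module.End (Fn d M) (TractorTensor (Fn d M) r)} (hK : IsNaturalEnd c r K)
    (g : c.metrics) (X : VectorField (Fn d M)) (F : TractorTensor (Fn d M) r) :
    K g (g.1.covTensor d X F) = g.1.covTensor d X (K g F) := by
  induction hK generalizing F with
  | perm e K h => exact covTensor_perm g.1 d e (K g) (h g) X F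
  | contraction i j hij K h => exact covTensor_contraction g.1 d i j hij (K g) (h g) X F
  | add K L _ _ hK hL =>
    change K g _ + L g _ = g.1.covTensor d X (K g F + L g F)
    rw [hK, hL]
    exact ((g.1.tensorConnection d r).add_right X _ _).symm
  | comp K L _ _ hK hL =>
    change K g (L g _) = g.1.covTensor d X (K g (L g F))
    rw [hL, hK]
  | smul t K _ hK =>
    have h := (g.1.tensorConnection d r).leibniz X (algebraMap ℝ (Fn d M) t) (K g F)
    rw [Derivation.map_algebraMap, zero_smul, zero_add] at h
    change algebraMap ℝ (Fn d M) t • K g _ = g.1.covTensor d X (algebraMap ℝ (Fn d M) t • K g F)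
    rw [hK]
    exact h.symm

/-- The power `(-(1/I²) I·D)^k` on sections of weight `w`. -/
def sectionPow (hd : 3 ≤ d) (σ : RealDensity c 1) (k : ℕ) {w w' : ℝ} (hw : w - k = w') :
    sections Φ w →ₗ[ℂ] sections Φ w' :=
  liftOp Φ (fun g => yPowHom g.1 d (σ.val g) k w)
    (fun g t F => by
      rw [yPowHom_apply, yPowHom_apply, yPow_real_smul g.1 d (σ.val g) (by omega)])
    (fun g F => by
      rw [yPowHom_apply, yPowHom_apply]
      exact map_yPow g.1 d (σ.val g) (Φ.proj g) (Φ.natural.covTensor g) k w F)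
    (fun g g' Υ h F F' hF => by
      rw [yPowHom_apply, yPowHom_apply, σ.equivariant g g' Υ h, ← hw]
      exact h.isConformalChange.yPow hd (E := fun w => expFn w Υ)
        (fun w X => derivation_expFn X w Υ)
        (fun w => by rw [expFn_mul, sub_eq_add_neg]) (σ.val g) k w hF)

theorem sectionPow_apply (hd : 3 ≤ d) (σ : RealDensity c 1) (k : ℕ) {w w' : ℝ} (hw : w - k = w')
    (F : sections Φ w) (g : c.metrics) :
    (sectionPow Φ hd σ k hw F).1 g = complexify (g.1.yPow d (σ.val g) k w) (F.1 g) := by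
  refine ctensor_ext ?_ ?_
  · rw [reT_complexify, ← yPowHom_apply]
    exact reT_complexify _ _
  · rw [imT_complexify, ← yPowHom_apply]
    exact imT_complexify _ _

theorem isDifferentialOperator_sectionPow (hd : 3 ≤ d) (σ : RealDensity c 1) (k : ℕ) {w w' : ℝ}
    (hw : w - k = w') : IsDifferentialOperator Φ (sectionPow Φ hd σ k hw) :=
  ⟨2 * k, isDiffOp_of_isOrder Φ _ (fun g => yPowHom g.1 d (σ.val g) k w)
    (fun _ _ => reT_complexify _ _) (fun _ _ => imT_complexify _ _)
    fun g => isOrder_yPowHom g.1 d (σ.val g) (by omega) k w⟩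

/-- The operator on the right is the same power started one weight lower. That `I²` has no zeros
makes it a unit among the smooth functions. -/
theorem sectionPow_mulDensity (hd : 3 ≤ d) (σ : RealDensity c 1)
    (hI : ∀ (g : c.metrics) (x : M), g.1.scaleSq d (σ.val g) x ≠ 0) {k : ℕ} (hk : 1 ≤ k)
    {w w' : ℝ} (hw : w - k = w') (hwk : 2 * w = k + 1 - d) :
    sectionPow Φ hd σ k hw ∘ₗ mulDensity Φ σ w =
      mulDensity Φ σ w' ∘ₗ sectionPow Φ hd σ k (w := w - 1) (w' := w' - 1) (by rw [← hw]; ring) := by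
  refine LinearMap.ext fun F => Subtype.ext <| funext fun g => ?_
  have h := yPow_mul_scale (r := Φ.rank) g.1 d (σ.val g) (by omega)
    (isUnit_of_forall_ne_zero _ (hI g)) hk hwk
  refine (sectionPow_apply Φ hd σ k hw (mulDensity Φ σ w F) g).trans (Eq.trans ?_
    (congrArg (σ.val g • ·) (sectionPow_apply Φ hd σ k _ F g)).symm)
  refine ctensor_ext ?_ ?_
  · refine (reT_complexify _ _).trans ((congrArg _ (reT_fnSMul (σ.val g) (F.1 g))).trans ?_)
    rw [h, reT_fnSMul, reT_complexify]
  · refine (imT_complexify _ _).trans ((congrArg _ (imT_fnSMul (σ.val g) (F.1 g))).trans ?_)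
    rw [h, imT_fnSMul, imT_complexify]

end Sections

/-! ## Restriction to the zero locus -/

section Descent

variable {R R' V W V' W' : Type*} [AddCommGroup V] [Module ℂ V] [AddCommGroup W] [Module ℂ W]
  [AddCommGroup V'] [Module ℂ V'] [AddCommGroup W'] [Module ℂ W']

/-- `S` factors through the quotient by the kernel of `ρ`, which surjectivity identifies with `V'`.
-/
theorem exists_descent {ρ : V →ₗ[ℂ] V'} (hρ : Function.Surjective ρ) (S : V →ₗ[ℂ] W')
    (hS : ∀ v, ρ v = 0 → S v = 0) : ∃ Q : V' →ₗ[ℂ] W', ∀ v, Q (ρ v) = S v := by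
  refine ⟨(LinearMap.ker ρ).liftQ S (fun v hv => hS v hv) ∘ₗ
    (ρ.quotKerEquivOfSurjective hρ).symm.toLinearMap, fun v => ?_⟩
  have h : (ρ.quotKerEquivOfSurjective hρ).symm (ρ v) = (LinearMap.ker ρ).mkQ v := by
    rw [LinearEquiv.symm_apply_eq]
    rfl
  rw [LinearMap.comp_apply, LinearEquiv.coe_coe, h]
  rfl

/-- A differential operator that descends to quotients is a differential operator there. -/
theorem isDiffOp_of_descent {μ : R → V →ₗ[ℂ] V} {ν : R → W →ₗ[ℂ] W} {μ' : R' → V' →ₗ[ℂ] V'}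
    {ν' : R' → W' →ₗ[ℂ] W'} {ρ : V →ₗ[ℂ] V'} {τ : W →ₗ[ℂ] W'} (hρ : Function.Surjective ρ)
    (hext : ∀ f' : R', ∃ f : R, (∀ v, ρ (μ f v) = μ' f' (ρ v)) ∧ ∀ v, τ (ν f v) = ν' f' (τ v))
    {m : ℕ} {P : V →ₗ[ℂ] W} {Q : V' →ₗ[ℂ] W'} (hQ : ∀ v, Q (ρ v) = τ (P v))
    (hP : IsDiffOp μ ν m P) : IsDiffOp μ' ν' m Q := by
  induction m generalizing P Q with
  | zero =>
    intro f'
    obtain ⟨f, hμ, hν⟩ := hext f'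
    refine LinearMap.ext fun v' => ?_
    obtain ⟨v, rfl⟩ := hρ v'
    rw [LinearMap.comp_apply, LinearMap.comp_apply, ← hμ, hQ, hQ, ← hν]
    exact congrArg τ (LinearMap.congr_fun (hP f) v)
  | succ m ih =>
    intro f'
    obtain ⟨f, hμ, hν⟩ := hext f'
    refine ih (fun v => ?_) (hP f)
    simp only [LinearMap.sub_apply, LinearMap.comp_apply, map_sub, ← hμ, hQ, ← hν]

end Descent

/-! ### Division, gluing and extension of sections, and descent to the zero locus. -/

section Restriction

variable {d : ℕ} {M : Type*} [TopologicalSpace M] [ChartedSpace (EuclideanSpace ℝ (Fin d)) M]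
  {c : ConformalStructure d M} (Φ : TractorBundle c)

theorem exists_ctensor {r : ℕ} (R S : TractorTensor (Fn d M) r) :
    ∃ G : CTractorTensor d M r, reT G = R ∧ imT G = S := by
  refine ⟨ofRealFn.compMultilinearMap R + Complex.I • ofRealFn.compMultilinearMap S, ?_, ?_⟩
  · ext T x
    change ((R T x : ℂ) + Complex.I * (S T x : ℂ)).re = _
    simp
  · ext T x
    change ((R T x : ℂ) + Complex.I * (S T x : ℂ)).im = _
    simp

/-- The value of a section at a point, evaluated on tractor fields. -/
def evalSection {w : ℝ} (g : c.metrics) (T : Fin Φ.rank → TractorField (Fn d M)) (x : M) :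
    sections Φ w →+ ℂ where
  toFun F := F.1 g T x
  map_zero' := rfl
  map_add' _ _ := rfl

theorem RealDensity.mem_zeroLocus_iff {w : ℝ} (σ : RealDensity c w) (g : c.metrics) {x : M} :
    x ∈ σ.zeroLocus ↔ σ.val g x = 0 := by
  refine ⟨fun h => h g, fun h g' => ?_⟩
  obtain ⟨Υ, hΥ⟩ := (c.mem_iff g.1 g.2 g'.1).1 g'.2
  rw [σ.equivariant g g' Υ hΥ, Fn.mul_apply, h, mul_zero]

theorem RealDensity.isClosed_zeroLocus {w : ℝ} (σ : RealDensity c w) : IsClosed σ.zeroLocus := by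
  have h : σ.zeroLocus = ⋂ g, {x | σ.val g x = 0} := by
    ext x
    simp [RealDensity.zeroLocus]
  rw [h]
  exact isClosed_iInter fun g => isClosed_eq (σ.val g).contMDiff.continuous continuous_const

variable [T2Space M] [IsManifold (𝓡 d) ∞ M]

/-- At a zero of `s` the term `2 s ρ` of `I²` drops out, so the gradient of `s` is itself a field
along which `s` has nonzero derivative. -/
theorem isDefining_of_scaleSq (hd : d ≠ 0) (g : PseudoRiemMetric (Fn d M)) {s : Fn d M}
    (hI : ∀ x, g.scaleSq d s x ≠ 0) : IsDefining s := by
  intro x hx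
  refine ⟨g.grad s, ?_⟩
  have h := hI x
  rw [scaleSq_eq g d s hd, Fn.add_apply, Fn.mul_apply, Fn.mul_apply, hx, zero_mul, mul_zero,
    add_zero] at h
  exact h

theorem IsDefining.smul_cancel {s : Fn d M} (hs : IsDefining s) {r : ℕ}
    {R S : TractorTensor (Fn d M) r} (h : s • R = s • S) : R = S := by
  refine MultilinearMap.ext fun T => sub_eq_zero.1 (hs.eq_zero_of_mul ?_)
  rw [mul_sub]
  exact sub_eq_zero.2 (DFunLike.congr_fun h T)

/-- Multiplication by `s` is injective, so the quotients of the values of `R` are unique and inherit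
multilinearity. -/
theorem IsDefining.exists_tensor_quotient {s : Fn d M} (hs : IsDefining s) {r : ℕ}
    (R : TractorTensor (Fn d M) r) (hR : ∀ T x, s x = 0 → R T x = 0) :
    ∃ S : TractorTensor (Fn d M) r, R = s • S := by
  choose q hq using fun T => hs.exists_quotient (R T) (hR T)
  have hc : ∀ {a b : Fn d M}, s * a = s * b → a = b := fun {a b} h =>
    sub_eq_zero.1 (hs.eq_zero_of_mul (by rw [mul_sub, h, sub_self]))
  refine ⟨MultilinearMap.mk' q (fun T i a b => hc ?_) (fun T i f a => hc ?_),
    MultilinearMap.ext fun T => hq T⟩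
  · rw [mul_add, ← hq, ← hq, ← hq, R.map_update_add]
  · rw [← hq, R.map_update_smul, hq, smul_eq_mul, smul_eq_mul, mul_left_comm]

/-- A section that vanishes on the zero locus of a defining density is divisible by it. -/
theorem exists_mulDensity_eq {w : ℝ} (σ : RealDensity c 1) (hσ : ∀ g, IsDefining (σ.val g))
    (F : sections Φ w) (hF : ∀ g T, ∀ x ∈ σ.zeroLocus, F.1 g T x = 0) :
    ∃ G, mulDensity Φ σ w G = F := by
  have hre : ∀ g, ∃ S, reT (F.1 g) = σ.val g • S := fun g =>
    (hσ g).exists_tensor_quotient _ fun T x hx => congrArg Complex.re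
      (hF g T x ((σ.mem_zeroLocus_iff g).2 hx))
  have him : ∀ g, ∃ S, imT (F.1 g) = σ.val g • S := fun g =>
    (hσ g).exists_tensor_quotient _ fun T x hx => congrArg Complex.im
      (hF g T x ((σ.mem_zeroLocus_iff g).2 hx))
  choose R hR using hre
  choose S hS using him
  choose G hGre hGim using fun g => exists_ctensor (R g) (S g)
  -- Cancelling `σ`, which itself has weight `1`, from a law of weight `w` leaves the law of weight
  -- `w - 1`.
  have key : ∀ (g g' : c.metrics) (Υ : Fn d M), IsRescaling g.1 Υ g'.1 →
      ∀ N N' : TractorTensor (Fn d M) Φ.rank,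
      pullback (splittingChange g.1 Υ) Φ.rank (σ.val g' • N') = expFn w Υ • σ.val g • N →
      pullback (splittingChange g.1 Υ) Φ.rank N' = expFn (w - 1) Υ • N := by
    intro g g' Υ h N N' hN
    refine (hσ g').smul_cancel ?_
    rw [← map_smul, hN, σ.equivariant g g' Υ h, smul_smul, smul_smul, mul_right_comm, expFn_mul,
      add_sub_cancel]
  have keyp : ∀ g (N : TractorTensor (Fn d M) Φ.rank), Φ.proj g (σ.val g • N) = σ.val g • N →
      Φ.proj g N = N := by
    intro g N hN
    exact (hσ g).smul_cancel ((map_smul _ _ _).symm.trans hN)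
  refine ⟨⟨G, fun g g' Υ h => ?_, fun g => ⟨?_, ?_⟩⟩, Subtype.ext <| funext fun g => ?_⟩
  · have hFg := (changeSplitting_law_iff _ _ _ _ _).1 (F.2.1 g g' Υ h)
    rw [hR, hR, hS, hS] at hFg
    rw [changeSplitting_law_iff, hGre, hGre, hGim, hGim]
    exact ⟨key g g' Υ h _ _ hFg.1, key g g' Υ h _ _ hFg.2⟩
  · rw [hGre]
    refine keyp g _ ?_
    rw [← hR]
    exact (F.2.2 g).1
  · rw [hGim]
    refine keyp g _ ?_
    rw [← hS]
    exact (F.2.2 g).2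
  · refine ctensor_ext ?_ ?_
    · exact (reT_fnSMul _ _).trans ((congrArg _ (hGre g)).trans (hR g).symm)
    · exact (imT_fnSMul _ _).trans ((congrArg _ (hGim g)).trans (hS g).symm)

/-- Sections that are locally equal glue together. -/
theorem exists_section_of_local {w : ℝ} (h : M → sections Φ w)
    (hh : ∀ x, ∀ᶠ y in 𝓝 x, ∀ g T, (h x).1 g T y = (h y).1 g T y) :
    ∃ H : sections Φ w, ∀ g T x, H.1 g T x = (h x).1 g T x := by
  let G : c.metrics → CTractorTensor d M Φ.rank := fun g => MultilinearMap.mk'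
    (fun T => ⟨fun x => (h x).1 g T x, fun x =>
      ((h x).1 g T).contMDiff.contMDiffAt.congr_of_eventuallyEq
        ((hh x).mono fun y hy => (hy g T).symm)⟩)
    (fun T i a b => by
      ext x
      exact DFunLike.congr_fun (((h x).1 g).map_update_add T i a b) x)
    (fun T i f a => by
      ext x
      exact DFunLike.congr_fun (((h x).1 g).map_update_smul T i f a) x)
  -- The transformation law can be read off pointwise, but the projections act on whole tensor
  -- fields, so membership in `E^Φ` is tested after multiplication by a cut-off.
  have hG : ∀ g x, ∃ χ : Fn d M, χ x = 1 ∧ χ • G g = χ • (h x).1 g := by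
    intro g x
    obtain ⟨χ, h1, hs, -⟩ := exists_bump (d := d) (hh x)
    refine ⟨χ, h1.self_of_nhds, MultilinearMap.ext fun T => ContMDiffMap.ext fun y => ?_⟩
    change χ y • (h y).1 g T y = χ y • (h x).1 g T y
    by_cases hy : y ∈ tsupport χ
    · rw [hs hy g T]
    · rw [image_eq_zero_of_notMem_tsupport hy, zero_smul, zero_smul]
  refine ⟨⟨G, fun g g' Υ hΥ T => ContMDiffMap.ext fun x => ?_, fun g => ⟨?_, ?_⟩⟩,
    fun _ _ _ => rfl⟩
  · exact DFunLike.congr_fun ((h x).2.1 g g' Υ hΥ T) x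
  · refine IsLocalModule.ext (d := d) (M := M) fun x => ?_
    obtain ⟨χ, h1, hχ⟩ := hG g x
    refine ⟨χ, h1, ?_⟩
    rw [← map_smul, ← reT_fnSMul, hχ, reT_fnSMul, map_smul, ((h x).2.2 g).1]
  · refine IsLocalModule.ext (d := d) (M := M) fun x => ?_
    obtain ⟨χ, h1, hχ⟩ := hG g x
    refine ⟨χ, h1, ?_⟩
    rw [← map_smul, ← imT_fnSMul, hχ, imT_fnSMul, map_smul, ((h x).2.2 g).2]

variable [SecondCountableTopology M]

/-- A partition of unity on a closed set, subordinate to given neighbourhoods of its points. -/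
theorem exists_partition {Z : Set M} (hZ : IsClosed Z) {U : Z → Set M}
    (hU : ∀ p : Z, U p ∈ 𝓝 (p : M)) :
    ∃ (N : M → Finset Z) (ρ : Z → Fn d M), (∀ x, ∀ᶠ y in 𝓝 x, N y ⊆ N x) ∧
      (∀ x, ∀ p ∉ N x, ρ p x = 0) ∧ (∀ p x, ρ p x ≠ 0 → x ∈ U p) ∧
      ∀ x ∈ Z, ∑ p ∈ N x, ρ p x = 1 := by
  -- Together with second countability this gives the σ-compactness that partitions of unity need.
  have : LocallyCompactSpace M := ChartedSpace.locallyCompactSpace (EuclideanSpace ℝ (Fin d)) M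
  obtain ⟨ρ, hρ⟩ := SmoothPartitionOfUnity.exists_isSubordinate (𝓡 d) hZ
    (fun p => interior (U p)) (fun _ => isOpen_interior)
    (fun x hx => Set.mem_iUnion.2 ⟨⟨x, hx⟩, mem_interior_iff_mem_nhds.2 (hU ⟨x, hx⟩)⟩)
  -- The index set at `x` is taken with closed supports, so that it can only shrink near `x`; this
  -- makes the finite sums locally compatible.
  refine ⟨ρ.fintsupport, fun p => ρ p, fun x => ρ.eventually_fintsupport_subset x,
    fun x p hp => ?_, fun p x hx => ?_, fun x hx => ?_⟩
  · rw [ρ.mem_fintsupport_iff] at hp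
    exact image_eq_zero_of_notMem_tsupport hp
  · exact interior_subset (hρ p (subset_tsupport _ hx))
  · exact ρ.sum_finsupport' x hx (ρ.finsupport_subset_fintsupport x)

/-- Local extensions are averaged with a partition of unity, whose members need to sum to `1` on `Z`
only. -/
theorem restrict_surjective {w : ℝ} {Z : Set M} (hZ : IsClosed Z) :
    Function.Surjective (restrict Φ w Z) := by
  intro s
  choose U hU F hF using s.2
  obtain ⟨N, ρ, hN, hρ, hρU, hsum⟩ := exists_partition (d := d) hZ hU
  let h : M → sections Φ w := fun x => ∑ p ∈ N x, mulFn Φ w (ρ p) (F p)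
  have hval : ∀ x g T y, (h x).1 g T y = ∑ p ∈ N x, ρ p y • (F p).1 g T y := fun x g T y =>
    map_sum (evalSection Φ g T y) _ _
  obtain ⟨H, hH⟩ := exists_section_of_local Φ h fun x => (hN x).mono fun y hy g T => by
    rw [hval, hval]
    exact (Finset.sum_subset hy fun p _ hp => by rw [hρ y p hp, zero_smul]).symm
  refine ⟨H, Subtype.ext <| funext fun g => funext fun T => funext fun x => ?_⟩
  change H.1 g T x = s.1 g T x
  have h1 : ∀ p ∈ N x, ρ p x • (F p).1 g T x = ρ p x • s.1 g T x := by
    intro p _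
    by_cases hp : ρ p x = 0
    · rw [hp, zero_smul, zero_smul]
    · rw [hF p g T x (hρU p x hp)]
  rw [hH, hval, Finset.sum_congr rfl h1, ← Finset.sum_smul, hsum x x.2, one_smul]

/-- Every multiplication on `Z` is thereby induced by one on `M`, which lets the commutators in the
definition of a differential operator descend. -/
theorem FnOn.exists_extension {Z : Set M} (hZ : IsClosed Z) (f : FnOn d Z) :
    ∃ F : Fn d M, ∀ x : Z, F x = f.val x := by
  choose U hU F hF using f.smooth
  obtain ⟨N, ρ, hN, hρ, hρU, hsum⟩ := exists_partition (d := d) hZ hU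
  let h : M → Fn d M := fun x => ∑ p ∈ N x, ρ p * F p
  have hval : ∀ x y, h x y = ∑ p ∈ N x, ρ p y * F p y := fun x y => Fn.sum_apply _ _ _
  obtain ⟨H, hH⟩ := exists_fn_of_local h fun x => (hN x).mono fun y hy => by
    rw [hval, hval]
    exact (Finset.sum_subset hy fun p _ hp => by rw [hρ y p hp, zero_mul]).symm
  refine ⟨H, fun x => ?_⟩
  have h1 : ∀ p ∈ N x, ρ p x * F p x = ρ p x * f.val x := by
    intro p _
    by_cases hp : ρ p x = 0
    · rw [hp, zero_mul, zero_mul]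
    · rw [hF p x (hρU p x hp)]
  rw [hH, hval, Finset.sum_congr rfl h1, ← Finset.sum_mul, hsum x x.2, one_mul]

theorem restrict_mulFn {w : ℝ} {Z : Set M} {f : FnOn d Z} {f' : Fn d M}
    (h : ∀ x : Z, f' x = f.val x) (F : sections Φ w) :
    restrict Φ w Z (mulFn Φ w f' F) = mulFnOn Φ w Z f (restrict Φ w Z F) :=
  Subtype.ext <| funext fun g => funext fun T => funext fun x =>
    congrArg (· • F.1 g T x) (h x)

/-- A tangential differential operator induces a differential operator on the zero locus. -/
theorem exists_unique_restriction {w w' : ℝ} (σ : RealDensity c 1)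
    (hσ : ∀ g, IsDefining (σ.val g)) {P : sections Φ w →ₗ[ℂ] sections Φ w'}
    (hP : IsDifferentialOperator Φ P) (hPσ : ActsTangentially Φ σ P) :
    ∃ Q : sectionsOn Φ w σ.zeroLocus →ₗ[ℂ] sectionsOn Φ w' σ.zeroLocus,
      IsDifferentialOperatorOn Φ σ.zeroLocus Q ∧
      (∀ F, Q (restrict Φ w σ.zeroLocus F) = restrict Φ w' σ.zeroLocus (P F)) ∧
      ∀ Q' : sectionsOn Φ w σ.zeroLocus →ₗ[ℂ] sectionsOn Φ w' σ.zeroLocus,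
        (∀ F, Q' (restrict Φ w σ.zeroLocus F) = restrict Φ w' σ.zeroLocus (P F)) → Q' = Q := by
  have hZ := σ.isClosed_zeroLocus
  have hsurj := restrict_surjective Φ (w := w) hZ
  obtain ⟨P', hP'⟩ := hPσ
  obtain ⟨Q, hQ⟩ := exists_descent (V := sections Φ w) (V' := sectionsOn Φ w σ.zeroLocus)
      (W' := sectionsOn Φ w' σ.zeroLocus) hsurj (restrict Φ w' σ.zeroLocus ∘ₗ P) fun F hF => by
    -- A section that restricts to zero is a multiple of `σ`; by tangentiality so is its image under
    -- `P`, which therefore restricts to zero.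
    have hF' : ∀ g T (x : σ.zeroLocus), F.1 g T x = 0 := fun g T x =>
      congrFun (congrFun (congrFun (Subtype.ext_iff.1 hF) g) T) x
    obtain ⟨G, rfl⟩ := exists_mulDensity_eq Φ σ hσ F fun g T x hx => hF' g T ⟨x, hx⟩
    refine Subtype.ext <| funext fun g => funext fun T => funext fun x => ?_
    have h : P (mulDensity Φ σ w G) = mulDensity Φ σ w' (P' G) := LinearMap.congr_fun hP' G
    change (P (mulDensity Φ σ w G)).1 g T x = 0
    rw [h]
    change σ.val g x • (P' G).1 g T x = 0
    rw [x.2 g, zero_smul]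
  obtain ⟨m, hm⟩ := hP
  have hext : ∀ f : FnOn d σ.zeroLocus, ∃ f' : Fn d M,
      (∀ F, restrict Φ w σ.zeroLocus (mulFn Φ w f' F) =
        mulFnOn Φ w σ.zeroLocus f (restrict Φ w σ.zeroLocus F)) ∧
      ∀ F, restrict Φ w' σ.zeroLocus (mulFn Φ w' f' F) =
        mulFnOn Φ w' σ.zeroLocus f (restrict Φ w' σ.zeroLocus F) := fun f =>
    (f.exists_extension hZ).imp fun _ h => ⟨restrict_mulFn Φ h, restrict_mulFn Φ h⟩
  have hQm : IsDifferentialOperatorOn Φ σ.zeroLocus Q :=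
    ⟨m, isDiffOp_of_descent (V := sections Φ w) (W := sections Φ w')
      (μ := mulFn Φ w) (ν := mulFn Φ w') (ρ := restrict Φ w σ.zeroLocus)
      (τ := restrict Φ w' σ.zeroLocus) hsurj hext hQ hm⟩
  refine ⟨Q, hQm, hQ, fun Q' hQ' => ?_⟩
  refine LinearMap.ext fun s => ?_
  obtain ⟨F, rfl⟩ := hsurj s
  exact (hQ' F).trans (hQ F).symm

end Restriction

end Tractor

end

theorem theorem4p1 (n : ℕ) (hn : 2 ≤ n) {M : Type*} [TopologicalSpace M] [T2Space M]
    [SecondCountableTopology M] [ChartedSpace (EuclideanSpace ℝ (Fin (n + 1))) M]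
    [IsManifold (𝓡 (n + 1)) ∞ M] (c : ConformalStructure (n + 1) M) (σ : RealDensity c 1)
    (hI : ∀ (g : c.metrics) (x : M), g.1.scaleSq (n + 1) (σ.val g) x ≠ 0)
    (Φ : TractorBundle c) (k : ℕ) (hk : 1 ≤ k) :
    ∃ P : sections Φ (((k : ℝ) - n) / 2) →ₗ[ℂ] sections Φ ((-(k : ℝ) - n) / 2),
      (∀ F g, (P F).1 g =
        complexify (g.1.yPow (n + 1) (σ.val g) k (((k : ℝ) - n) / 2)) (F.1 g)) ∧
      IsDifferentialOperator Φ P ∧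
      ActsTangentially Φ σ P ∧
      ∃ Q : sectionsOn Φ (((k : ℝ) - n) / 2) σ.zeroLocus →ₗ[ℂ]
          sectionsOn Φ ((-(k : ℝ) - n) / 2) σ.zeroLocus,
        IsDifferentialOperatorOn Φ σ.zeroLocus Q ∧
        (∀ F, Q (restrict Φ _ σ.zeroLocus F) = restrict Φ _ σ.zeroLocus (P F)) ∧
        ∀ Q' : sectionsOn Φ (((k : ℝ) - n) / 2) σ.zeroLocus →ₗ[ℂ]
            sectionsOn Φ ((-(k : ℝ) - n) / 2) σ.zeroLocus,
          (∀ F, Q' (restrict Φ _ σ.zeroLocus F) = restrict Φ _ σ.zeroLocus (P F)) → Q' = Q := by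
  have hd : 3 ≤ n + 1 := by omega
  have hw : ((k : ℝ) - n) / 2 - k = (-(k : ℝ) - n) / 2 := by ring
  -- Here `2w = k - n = k + 1 - (n + 1)`, exactly the weight at which the commutator with `σ`
  -- vanishes.
  have ht : ActsTangentially Φ σ (sectionPow Φ hd σ k hw) :=
    ⟨_, sectionPow_mulDensity Φ hd σ hI hk hw (by push_cast; ring)⟩
  have hD := isDifferentialOperator_sectionPow Φ hd σ k hw
  exact ⟨_, sectionPow_apply Φ hd σ k hw, hD, ht, exists_unique_restriction Φ σ
    (fun g => isDefining_of_scaleSq n.succ_ne_zero g.1 (hI g)) hD ht⟩
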